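/- For $k\ge 1$ let $\mathcal B_k$ be the Bargmann space of functions $\varphi(z)=f(z)e^{-k|z|^2/2}$ on $\mathbb C$, with $f$ entire and $\varphi\in L^2(\mathbb C,\lambda)$, where $z=(x-i\xi)/\sqrt2$ and $\lambda$ is Lebesgue measure $dx\,d\xi$. Let $\Pi_k$ be the orthogonal projector of $L^2(\mathbb C,\lambda)$ onto $\mathcal B_k$, and let $\mathfrak S_k\subset\mathcal B_k$ be the subspace of the $\varphi$ such that $\sup_z|\varphi(z)|(1+|z|^2)^{i/2}<\infty$ for all $i\in\mathbb N$. For $j\in\mathbb Z$, the class $\mathcal S_j$ consists of the sequences $(a(\cdot,k))_{k\ge1}$ of functions in $C^\infty(\mathbb C)$ that admit an expansion $a(\cdot,k)\sim\sum_{\ell\ge0}k^{-\ell}a_\ell$, with $a_\ell\in C^\infty(\mathbb C)$, in the following sense: for all $\ell,\alpha,\beta\in\mathbb N$ and all $L\ge1$ there are constants $C_{\ell,\alpha,\beta}$ and $C_{L,\alpha,\beta}$ such that, on $\mathbb C$ and for all $k\ge1$, $$|\partial_z^\alpha\partial_{\bar z}^\beta a_\ell|\le C_{\ell,\alpha,\beta}(1+|z|^2)^{j/2},\qquad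 \Big|\partial_z^\alpha\partial_{\bar z}^\beta\Big(a(\cdot,k)-\sum_{\ell<L}k^{-\ell}a_\ell\Big)\Big|\le C_{L,\alpha,\beta}\,k^{-L}(1+|z|^2)^{j/2}.$$ A sequence $(S_k)_{k\ge1}$ of operators $\mathfrak S_k\to\mathfrak S_k$ is called residual if $S_k$ has, with respect to $\lambda$, a Schwartz kernel $R_k(z_1,z_2)e^{-Ck|z_1-z_2|^2}$, where $C>0$ does not depend on $k$ and the functions $R_k\in C^\infty(\mathbb C^2)$ are negligible (on every compact subset of $\mathbb C^2$ each derivative of $R_k$ is $O(k^{-N})$ for every $N$) and tempered (each derivative of $R_k$ is bounded on $\mathbb C^2$ by $c\,k^M(1+|z_1|+|z_2|)^p$, with $c,M,p$ independent of $k$). A sequence $(A_k)_{k\ge1}$ of operators $\mathfrak S_k\to\mathfrak S_k$ belongs to $\mathcal T_j$, with contravariant symbol $\sigma_{\rm cont}(A_k)=\sum_\ell\hbar^\ell a_\ell$, if $A_k=\Pi_kM_{a(\cdot,k)}\Pi_k+S_k$ for all $k\geq 1$, where $M_{a(\cdot,k)}$ is multiplication by $a(\cdot,k)$, $a\in\mathcal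 S_j$ has the expansion $\sum_\ell k^{-\ell}a_\ell$, and $(S_k)$ is residual. Let $j,j'\in\mathbb Z$, and let $A_k\in\mathcal T_j$ and $B_k\in\mathcal T_{j'}$. Then $C_k=A_kB_k$ belongs to $\mathcal T_{j+j'}$. Its contravariant symbol is uniquely determined, and is given by $$\sigma_{\rm cont}(C_k)(z)=\Big(\exp\Big(-\hbar\frac{\partial}{\partial z_1}\frac{\partial}{\partial\bar z_2}\Big)\,\sigma_{\rm cont}(A_k)(z_1)\,\sigma_{\rm cont}(B_k)(z_2)\Big)_{|z_1=z_2=z}$$ as an identity of formal power series in $\hbar$ with coefficients in $C^\infty(\mathbb C)$. -/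

import Mathlib

open scoped ContDiff ENNReal

noncomputable section

namespace Bargmann

open MeasureTheory

/-- Lebesgue measure `dx dξ` on the phase plane `ℝ²`, written in the complex coordinate
`z = (x - iξ)/√2`: since `(x, ξ) = √2 (Re z, -Im z)`, it is `2 d(Re z) d(Im z)`. -/
def lam : Measure ℂ := (2 : ℝ≥0∞) • (volume : Measure ℂ)

/-- The Bargmann space `𝓑_k`: functions `f(z) exp(-k|z|²/2)` with `f` entire, which are square
integrable for `lam` (that is, `∫ |f|² exp(-k|z|²) dλ < ∞`). -/
def bargmannSpace (k : ℕ) : Submodule ℂ (ℂ → ℂ) where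
  carrier := {φ | (∃ f : ℂ → ℂ, Differentiable ℂ f ∧
      ∀ z, φ z = f z * (Real.exp (-(k : ℝ) / 2 * ‖z‖ ^ 2) : ℂ)) ∧ MemLp φ 2 lam}
  add_mem' := by
    rintro φ χ ⟨⟨f, hf, hφ⟩, h1⟩ ⟨⟨g, hg, hχ⟩, h2⟩
    exact ⟨⟨fun z => f z + g z, hf.add hg, fun z => by
      simp only [Pi.add_apply, hφ z, hχ z, add_mul]⟩, h1.add h2⟩
  zero_mem' := ⟨⟨fun _ => 0, differentiable_const 0, fun z => by simp⟩, MemLp.zero⟩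
  smul_mem' := by
    rintro c φ ⟨⟨f, hf, hφ⟩, h1⟩
    exact ⟨⟨fun z => c * f z, hf.const_mul c, fun z => by
      simp only [Pi.smul_apply, smul_eq_mul, hφ z, mul_assoc]⟩, h1.const_smul c⟩

/-- The space `𝔖_k` of the rapidly decreasing elements of `𝓑_k`. -/
def schwartzSpace (k : ℕ) : Submodule ℂ (ℂ → ℂ) where
  carrier := {φ | φ ∈ bargmannSpace k ∧
    ∀ j : ℕ, ∃ M : ℝ, ∀ z, ‖φ z‖ * (1 + ‖z‖ ^ 2) ^ ((j : ℝ) / 2) ≤ M}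
  add_mem' := by
    rintro φ χ ⟨h1, h2⟩ ⟨h3, h4⟩
    refine ⟨add_mem h1 h3, fun j => ?_⟩
    obtain ⟨M, hM⟩ := h2 j
    obtain ⟨N, hN⟩ := h4 j
    refine ⟨M + N, fun z => ?_⟩
    have hw : 0 ≤ (1 + ‖z‖ ^ 2) ^ ((j : ℝ) / 2) := by positivity
    calc ‖(φ + χ) z‖ * (1 + ‖z‖ ^ 2) ^ ((j : ℝ) / 2)
        ≤ (‖φ z‖ + ‖χ z‖) * (1 + ‖z‖ ^ 2) ^ ((j : ℝ) / 2) :=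
          mul_le_mul_of_nonneg_right (norm_add_le _ _) hw
      _ ≤ M + N := by rw [add_mul]; exact add_le_add (hM z) (hN z)
  zero_mem' := ⟨zero_mem _, fun j => ⟨0, fun z => by simp⟩⟩
  smul_mem' := by
    rintro c φ ⟨h1, h2⟩
    refine ⟨Submodule.smul_mem _ c h1, fun j => ?_⟩
    obtain ⟨M, hM⟩ := h2 j
    refine ⟨‖c‖ * M, fun z => ?_⟩
    rw [Pi.smul_apply, norm_smul, mul_assoc]
    exact mul_le_mul_of_nonneg_left (hM z) (norm_nonneg c)

/-- `p` is the orthogonal projection `Π_k g` of the square integrable function `g` onto `𝓑_k`. -/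
def IsProjection (k : ℕ) (g p : ℂ → ℂ) : Prop :=
  MemLp g 2 lam ∧ p ∈ bargmannSpace k ∧
    ∀ χ ∈ bargmannSpace k, ∫ z, (starRingEnd ℂ) (χ z) * (g z - p z) ∂lam = 0

/-- `T` is the operator `Op(a) = Π_k M_a Π_k` on `𝔖_k`
(elements of `𝔖_k ⊆ 𝓑_k` are fixed by `Π_k`). -/
def IsOp (k : ℕ) (a : ℂ → ℂ) (T : schwartzSpace k →ₗ[ℂ] schwartzSpace k) : Prop :=
  ∀ φ : schwartzSpace k, IsProjection k (fun z => a z * φ.1 z) (T φ).1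

/-- `T` admits the Schwartz kernel `K` (with respect to `lam`). -/
def HasKernel (k : ℕ) (K : ℂ × ℂ → ℂ) (T : schwartzSpace k →ₗ[ℂ] schwartzSpace k) : Prop :=
  ∀ (φ : schwartzSpace k) (z : ℂ), Integrable (fun w => K (z, w) * φ.1 w) lam ∧
    (T φ).1 z = ∫ w, K (z, w) * φ.1 w ∂lam

/-- The Wirtinger derivative `∂/∂z`. -/
def dz (f : ℂ → ℂ) (z : ℂ) : ℂ :=
  (fderiv ℝ f z 1 - Complex.I * fderiv ℝ f z Complex.I) / 2

/-- The Wirtinger derivative `∂/∂z̄`. -/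
def dzbar (f : ℂ → ℂ) (z : ℂ) : ℂ :=
  (fderiv ℝ f z 1 + Complex.I * fderiv ℝ f z Complex.I) / 2

/-- The weight `m(u) = (1 + |u|²)^{1/2}`. -/
def wt (u : ℂ) : ℝ := Real.sqrt (1 + ‖u‖ ^ 2)

/-- The sequence `(a(·,k))_{k ≥ 1}` belongs to the symbol class `𝓢_j` on `ℂ`, with asymptotic
expansion `∑ k^{-ℓ} σ_ℓ`. -/
def IsSymbol (j : ℤ) (a σ : ℕ → ℂ → ℂ) : Prop :=
  (∀ k, 1 ≤ k → ContDiff ℝ ∞ (a k)) ∧ (∀ l, ContDiff ℝ ∞ (σ l)) ∧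
  (∀ l α β : ℕ, ∃ C : ℝ, ∀ z, ‖dz^[α] (dzbar^[β] (σ l)) z‖ ≤ C * wt z ^ j) ∧
  (∀ L : ℕ, 1 ≤ L → ∀ α β : ℕ, ∃ C : ℝ, ∀ k : ℕ, 1 ≤ k → ∀ z,
    ‖dz^[α] (dzbar^[β] (fun u => a k u - ∑ l ∈ Finset.range L, ((k : ℂ) ^ l)⁻¹ * σ l u)) z‖
      ≤ C * ((k : ℝ) ^ L)⁻¹ * wt z ^ j)

/-- Negligible sequences on `ℂ²`: every derivative is `O(k^{-N})` on every compact set,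
for every `N`. -/
def IsNegligible (R : ℕ → ℂ × ℂ → ℂ) : Prop :=
  (∀ k, 1 ≤ k → ContDiff ℝ ∞ (R k)) ∧
  ∀ (n N : ℕ) (K : Set (ℂ × ℂ)), IsCompact K → ∃ c : ℝ, ∀ k : ℕ, 1 ≤ k → ∀ x ∈ K,
    ‖iteratedFDeriv ℝ n (R k) x‖ ≤ c * ((k : ℝ) ^ N)⁻¹

/-- Tempered sequences on `ℂ²`: every derivative has at most polynomial growth, jointly in `k` and
in the point. -/
def IsTempered (R : ℕ → ℂ × ℂ → ℂ) : Prop :=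
  ∀ n : ℕ, ∃ (c : ℝ) (M p : ℕ), ∀ k : ℕ, 1 ≤ k → ∀ x : ℂ × ℂ,
    ‖iteratedFDeriv ℝ n (R k) x‖ ≤ c * (k : ℝ) ^ M * (1 + ‖x‖) ^ p

/-- The sequence `S_k : 𝔖_k → 𝔖_k` has kernels `R_k(z₁,z₂) exp(-Ck|z₁-z₂|²)` with `C > 0` and `R_k`
negligible (and tempered). -/
def IsResidual (S : (k : ℕ) → schwartzSpace k →ₗ[ℂ] schwartzSpace k) : Prop :=
  ∃ (R : ℕ → ℂ × ℂ → ℂ) (C : ℝ), 0 < C ∧ IsNegligible R ∧ IsTempered R ∧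
    ∀ k : ℕ, 1 ≤ k →
      HasKernel k (fun x => R k x * (Real.exp (-C * k * ‖x.1 - x.2‖ ^ 2) : ℂ)) (S k)

/-- `A` belongs to `𝓣_j`, with contravariant symbol `∑ ħ^ℓ σ_ℓ`:
`A_k = Op(a(·,k)) + S_k` with `a ∈ 𝓢_j`, `a ~ ∑ k^{-ℓ} σ_ℓ`, and `S` residual. -/
def IsToeplitz (j : ℤ) (A : (k : ℕ) → schwartzSpace k →ₗ[ℂ] schwartzSpace k)
    (σ : ℕ → ℂ → ℂ) : Prop :=
  ∃ (a : ℕ → ℂ → ℂ) (T S : (k : ℕ) → schwartzSpace k →ₗ[ℂ] schwartzSpace k),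
    IsSymbol j a σ ∧ (∀ k, 1 ≤ k → IsOp k (a k) (T k)) ∧ IsResidual S ∧
      ∀ k, 1 ≤ k → A k = T k + S k

/-- The operator `∂/∂z₁ ∂/∂z̄₂` on functions of `(z₁, z₂)`. -/
def mixedD (F : ℂ → ℂ → ℂ) : ℂ → ℂ → ℂ :=
  fun z₁ z₂ => dz (fun u => dzbar (fun v => F u v) z₂) z₁

/-- The formal series `σ(z₁) τ(z₂)`: its coefficient of `ħ^n`. -/
def tensorSeries (σ τ : ℕ → ℂ → ℂ) (n : ℕ) (z₁ z₂ : ℂ) : ℂ :=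
  ∑ p ∈ Finset.HasAntidiagonal.antidiagonal n, σ p.1 z₁ * τ p.2 z₂

/-- The formal series `exp(-ħ ∂/∂z₁ ∂/∂z̄₂) F` for a formal series `F = ∑ ħ^n F_n`:
its coefficient of `ħ^n`. -/
def expMixedD (F : ℕ → ℂ → ℂ → ℂ) (n : ℕ) (z₁ z₂ : ℂ) : ℂ :=
  ∑ p ∈ Finset.HasAntidiagonal.antidiagonal n, (-1 : ℂ) ^ p.1 / (Nat.factorial p.1 : ℂ) * mixedD^[p.1] (F p.2) z₁ z₂

/-- `(exp(-ħ ∂/∂z₁ ∂/∂z̄₂) σ(z₁) τ(z₂))` restricted to `z₁ = z₂ = z`. -/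
def symbolProduct (σ τ : ℕ → ℂ → ℂ) (n : ℕ) (z : ℂ) : ℂ :=
  expMixedD (tensorSeries σ τ) n z z

end Bargmann

end

/-!
Composition of Toeplitz operators on the Bargmann space, with their contravariant symbols.

The projector `Π_k` has the reproducing kernel `repKernel k`, of Gaussian size
`exp(-k|z - w|²/2)`, and on `𝔖_k` every operator may be composed with `Π_k` on either side. Hence
`Op(a)` and residual operators all have kernels in the class `IsGaussKernel`, which is stable under
composition, and in which the locally negligible kernels (`IsLocNegl`) form an ideal. Conversely an
operator on `𝔖_k` with a locally negligible Gaussian kernel is residual (`isResidual_of_kernel`):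
sandwiching the kernel between two copies of `repKernel` does not change the operator, and it makes
the kernel smooth, with derivatives controlled by differentiation under the integral sign. So only
`Op(a) Op(b)` matters, and only up to locally negligible kernels.

The expansion of `Op(a) Op(b)` comes from the family `interKernel k f g r`, which joins the kernel
of `Π_k f g Π_k` at `r = 0` to that of `Π_k f Π_k g Π_k` at `r = 1`. Integration by parts gives the
closed differential equation
`d/dr interKernel k f g r = -(2r/k) interKernel k (∂f) (∂̄g) r` (`hasDerivAt_interKernel`).
Iterating it, `Π_k f Π_k g Π_k` is the sum over `n < N` of the
`(-1)ⁿ/(n! kⁿ) Π_k (∂ⁿf)(∂̄ⁿg) Π_k`, up to `(2/k)^N` times a bound on the interpolating kernels of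
`∂^N f` and `∂̄^N g` (`interKernel_expansion`). This is the exponential `exp(-ħ ∂/∂z₁ ∂/∂z̄₂)`
of the statement. The bound loses a factor `k³`, harmless since `N` is arbitrary. A symbol `c` with
the resulting formal expansion exists by Borel summation (`exists_hasExpansion`), and
`Op(a) Op(b) - Op(c)` has a locally negligible kernel (`isLocNegl_kcomp_sub`).

For uniqueness, the kernel of `Op(a)` on the diagonal is the average of `a` against
a Gaussian of width `k^{-1/2}`, so that it determines the coefficients of the expansion of `a` one
after the other (`tendsto_toepKernel_diag`), while residual operators contribute `O(k^{-∞})`.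
-/

noncomputable section

namespace Bargmann

open MeasureTheory

open scoped ComplexConjugate

/-! ### Gaussian weights, parametric integrals and integration by parts -/

section GaussianIntegrals

variable {Y : Type*} [NormedAddCommGroup Y]

/-- The weight `(1 + ‖y‖)ⁿ exp(-c‖y‖²)`, against which all kernels are compared. -/
def gaussWeight (n : ℕ) (c : ℝ) (y : Y) : ℝ := (1 + ‖y‖) ^ n * Real.exp (-c * ‖y‖ ^ 2)

lemma gaussWeight_nonneg (n : ℕ) (c : ℝ) (y : Y) : 0 ≤ gaussWeight n c y := by
  unfold gaussWeight; positivity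

lemma continuous_gaussWeight (n : ℕ) (c : ℝ) : Continuous (gaussWeight n c : Y → ℝ) := by
  unfold gaussWeight; fun_prop

/-- A power times a Gaussian is bounded. -/
lemma exists_pow_mul_exp_le (n : ℕ) {c : ℝ} (hc : 0 < c) :
    ∃ C : ℝ, 0 ≤ C ∧ ∀ t : ℝ, 0 ≤ t → (1 + t) ^ n * Real.exp (-c * t ^ 2) ≤ C := by
  have h1 : Filter.Tendsto (fun t : ℝ => (1 + t) ^ n * Real.exp (-(c) * (1 + t)))
      Filter.atTop (nhds 0) := by
    have := Real.tendsto_pow_mul_exp_neg_atTop_nhds_zero n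
    have h2 : Filter.Tendsto (fun t : ℝ => c * (1 + t)) Filter.atTop Filter.atTop :=
      (Filter.tendsto_atTop_add_const_left _ 1 Filter.tendsto_id).const_mul_atTop hc
    have h3 := (this.comp h2).const_mul ((c ^ n)⁻¹)
    simp only [mul_zero] at h3
    refine h3.congr fun t => ?_
    simp only [Function.comp, mul_pow]
    field_simp
  have hcont : Continuous (fun t : ℝ => (1 + t) ^ n * Real.exp (-c * (1 + t))) := by fun_prop
  obtain ⟨T, hT⟩ := Filter.eventually_atTop.1 (h1.eventually (gt_mem_nhds zero_lt_one))
  obtain ⟨C, hC⟩ := (isCompact_Icc (a := (0 : ℝ)) (b := T)).bddAbove_image hcont.continuousOn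
  -- `t ^ 2 ≥ (1 + t) - 3` reduces the Gaussian to an exponential.
  refine ⟨max C 1 * Real.exp (3 * c), by positivity, fun t ht => ?_⟩
  have hb : (1 + t) ^ n * Real.exp (-c * (1 + t)) ≤ max C 1 := by
    rcases le_total t T with h | h
    · exact le_max_of_le_left (hC ⟨t, ⟨ht, h⟩, rfl⟩)
    · exact le_max_of_le_right (hT t h).le
  calc (1 + t) ^ n * Real.exp (-c * t ^ 2)
      ≤ (1 + t) ^ n * (Real.exp (-c * (1 + t)) * Real.exp (3 * c)) := by
        gcongr
        rw [← Real.exp_add]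
        apply Real.exp_le_exp.2
        nlinarith [sq_nonneg (t - 1 / 2)]
    _ = ((1 + t) ^ n * Real.exp (-c * (1 + t))) * Real.exp (3 * c) := by ring
    _ ≤ _ := by gcongr

variable [NormedSpace ℝ Y] [FiniteDimensional ℝ Y]
  [MeasurableSpace Y] [BorelSpace Y] (μ : Measure Y) [μ.IsAddHaarMeasure]

lemma integrable_gaussWeight (n : ℕ) {c : ℝ} (hc : 0 < c) :
    Integrable (gaussWeight n c : Y → ℝ) μ := by
  obtain ⟨C, hC0, hC⟩ := exists_pow_mul_exp_le (n + (Module.finrank ℝ Y + 1)) hc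
  have h := (integrable_one_add_norm (E := Y) (μ := μ)
    (r := (Module.finrank ℝ Y : ℝ) + 1) (by linarith)).const_mul C
  refine h.mono' (continuous_gaussWeight n c).aestronglyMeasurable (.of_forall fun y => ?_)
  rw [Real.norm_of_nonneg (gaussWeight_nonneg n c y), gaussWeight]
  have h1 : 0 < 1 + ‖y‖ := by positivity
  have h2 : (1 + ‖y‖) ^ (-((Module.finrank ℝ Y : ℝ) + 1))
      = ((1 + ‖y‖) ^ (Module.finrank ℝ Y + 1))⁻¹ := by
    rw [Real.rpow_neg h1.le, ← Real.rpow_natCast]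
    push_cast; rfl
  rw [h2, ← div_eq_mul_inv, le_div_iff₀ (by positivity)]
  calc _ = (1 + ‖y‖) ^ (n + (Module.finrank ℝ Y + 1)) * Real.exp (-c * ‖y‖ ^ 2) := by ring
    _ ≤ C := hC _ (norm_nonneg y)

lemma integrable_of_le_gaussWeight {F : Type*} [NormedAddCommGroup F] {f : Y → F}
    (hf : AEStronglyMeasurable f μ) {A c : ℝ} (hc : 0 < c) {n : ℕ} {x : Y}
    (h : ∀ y, ‖f y‖ ≤ A * gaussWeight n c (y - x)) : Integrable f μ :=
  (((integrable_gaussWeight μ n hc).comp_sub_right x).const_mul A).mono' hf (.of_forall h)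

lemma norm_integral_le_gaussWeight {F : Type*} [NormedAddCommGroup F] [NormedSpace ℝ F] {f : Y → F}
    {A c : ℝ} (hc : 0 < c) {n : ℕ} {x : Y}
    (h : ∀ y, ‖f y‖ ≤ A * gaussWeight n c (y - x)) :
    ‖∫ y, f y ∂μ‖ ≤ A * ∫ y : Y, gaussWeight n c y ∂μ := by
  refine (norm_integral_le_of_norm_le
    (((integrable_gaussWeight μ n hc).comp_sub_right x).const_mul A) (.of_forall h)).trans ?_
  rw [integral_const_mul, integral_sub_right_eq_self (fun y => gaussWeight n c y)]

end GaussianIntegrals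

section Parametric

variable {X : Type*} [NormedAddCommGroup X] [NormedSpace ℝ X]
  {Y : Type*} [NormedAddCommGroup Y] [NormedSpace ℝ Y] [FiniteDimensional ℝ Y]
  [MeasurableSpace Y] [BorelSpace Y] (μ : Measure Y) [μ.IsAddHaarMeasure]

lemma temperate_bound {V W : Type*} [NormedAddCommGroup V] [NormedSpace ℝ V]
    [NormedAddCommGroup W] [NormedSpace ℝ W] {f : V → W} (hf : f.HasTemperateGrowth) :
    ∃ (m : ℕ) (C : ℝ), 0 ≤ C ∧ ∀ x, ‖f x‖ ≤ C * (1 + ‖x‖) ^ m := by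
  obtain ⟨m, C, h0, h⟩ := hf.norm_iteratedFDeriv_le_uniform 0
  exact ⟨m, C, h0, fun x => by simpa using h 0 le_rfl x⟩

lemma temperate_fderiv {V W : Type*} [NormedAddCommGroup V] [NormedSpace ℝ V]
    [NormedAddCommGroup W] [NormedSpace ℝ W] {f : V → W} (hf : f.HasTemperateGrowth) :
    (fderiv ℝ f).HasTemperateGrowth := by
  refine ⟨hf.1.fderiv_right (by simp), fun n => ?_⟩
  obtain ⟨m, C, h⟩ := hf.2 (n + 1)
  exact ⟨m, C, fun x => by rw [norm_iteratedFDeriv_fderiv]; exact h x⟩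

lemma temperate_fderiv_apply {V W : Type*} [NormedAddCommGroup V] [NormedSpace ℝ V]
    [NormedAddCommGroup W] [NormedSpace ℝ W] {f : V → W} (hf : f.HasTemperateGrowth) (v : V) :
    (fun x => fderiv ℝ f x v).HasTemperateGrowth :=
  (ContinuousLinearMap.apply ℝ W v).hasTemperateGrowth.comp (temperate_fderiv hf)

lemma temperate_continuous {V W : Type*} [NormedAddCommGroup V] [NormedSpace ℝ V]
    [NormedAddCommGroup W] [NormedSpace ℝ W] {f : V → W} (hf : f.HasTemperateGrowth) :
    Continuous f := hf.1.continuous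

lemma temperate_differentiable {V W : Type*} [NormedAddCommGroup V] [NormedSpace ℝ V]
    [NormedAddCommGroup W] [NormedSpace ℝ W] {f : V → W} (hf : f.HasTemperateGrowth) :
    Differentiable ℝ f := hf.1.differentiable (by simp)

/-- Differentiation under the integral sign for integrands `p exp(q) M`, where `p` and `q` have
temperate growth and `exp(q) M` is dominated by a Gaussian. -/
theorem hasFDerivAt_integral_gauss {p q : X × Y → ℂ} (hp : p.HasTemperateGrowth)
    (hq : q.HasTemperateGrowth) {M : Y → ℂ} (hM : AEStronglyMeasurable M μ) {A c : ℝ} {m : ℕ}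
    (hc : 0 < c) {x₀ : X} {U : Set X} (hU : U ∈ nhds x₀)
    (hb : ∀ x ∈ U, ∀ y, ‖Complex.exp (q (x, y)) * M y‖ ≤ A * gaussWeight m c y) :
    ∃ L : X →L[ℝ] ℂ, HasFDerivAt (fun x => ∫ y, p (x, y) * (Complex.exp (q (x, y)) * M y) ∂μ) L x₀ ∧
      ∀ h, L h = ∫ y, (fderiv ℝ p (x₀, y) (h, 0) + p (x₀, y) * fderiv ℝ q (x₀, y) (h, 0)) *
        (Complex.exp (q (x₀, y)) * M y) ∂μ := by
  let D : X × Y → X →L[ℝ] ℂ := fun x =>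
    (fderiv ℝ p x + p x • fderiv ℝ q x).comp (ContinuousLinearMap.inl ℝ X Y)
  have hDt : (fun x => fderiv ℝ p x + p x • fderiv ℝ q x).HasTemperateGrowth :=
    (temperate_fderiv hp).add (hp.smul (temperate_fderiv hq))
  have hDc : Continuous D := by
    have := hDt.1.continuous
    exact this.clm_comp continuous_const
  obtain ⟨n, C, hC, hn⟩ := temperate_bound hDt
  obtain ⟨n', C', hC', hn'⟩ := temperate_bound hp
  have hpc := temperate_continuous hp
  have hqc := temperate_continuous hq
  have hmeas : ∀ x, AEStronglyMeasurable (fun y => Complex.exp (q (x, y)) * M y) μ := fun x =>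
    (Continuous.aestronglyMeasurable (by fun_prop)).mul hM
  have hx1 : ∀ (x : X) (y : Y), 1 + ‖(x, y)‖ ≤ (1 + ‖x‖) * (1 + ‖y‖) := fun x y => by
    have : ‖(x, y)‖ ≤ ‖x‖ + ‖y‖ := max_le_add_of_nonneg (norm_nonneg _) (norm_nonneg _)
    nlinarith [norm_nonneg x, norm_nonneg y]
  have hA : ∀ y : Y, 0 ≤ A * gaussWeight m c y := fun y =>
    (norm_nonneg _).trans (hb x₀ (mem_of_mem_nhds hU) y)
  have hDb : ∀ x y, ‖D (x, y)‖ ≤ C * ((1 + ‖x‖) * (1 + ‖y‖)) ^ n := fun x y => by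
    refine (ContinuousLinearMap.opNorm_comp_le _ _).trans ?_
    refine (mul_le_of_le_one_right (norm_nonneg _)
      (ContinuousLinearMap.norm_inl_le_one ℝ X Y)).trans ((hn _).trans ?_)
    gcongr
    exact hx1 x y
  let F' : X → Y → X →L[ℝ] ℂ := fun x y => (Complex.exp (q (x, y)) * M y) • D (x, y)
  have hF'm : AEStronglyMeasurable (F' x₀) μ :=
    (hmeas x₀).smul (Continuous.aestronglyMeasurable (by fun_prop))
  have key : ∀ x ∈ U ∩ Metric.ball x₀ 1, ∀ y, ‖F' x y‖
      ≤ C * (2 + ‖x₀‖) ^ n * A * gaussWeight (n + m) c (y - 0) := by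
    rintro x ⟨hxU, hxb⟩ y
    have hxn : 1 + ‖x‖ ≤ 2 + ‖x₀‖ := by
      have := norm_le_norm_add_norm_sub' x x₀
      rw [Metric.mem_ball, dist_eq_norm] at hxb
      linarith
    calc ‖F' x y‖ ≤ ‖Complex.exp (q (x, y)) * M y‖ * ‖D (x, y)‖ := by
          exact norm_smul_le (Complex.exp (q (x, y)) * M y) (D (x, y))
      _ ≤ (A * gaussWeight m c y) * (C * ((2 + ‖x₀‖) * (1 + ‖y‖)) ^ n) := by
          refine mul_le_mul (hb x hxU y) ((hDb x y).trans ?_) (norm_nonneg _) (hA y)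
          gcongr
      _ = _ := by
          simp only [gaussWeight, mul_pow, pow_add, sub_zero]; ring
  have hint' : Integrable (F' x₀) μ :=
    integrable_of_le_gaussWeight μ hF'm hc (key x₀ ⟨mem_of_mem_nhds hU, by simp⟩)
  have hU' : U ∩ Metric.ball x₀ 1 ∈ nhds x₀ :=
    Filter.inter_mem hU (Metric.ball_mem_nhds _ zero_lt_one)
  refine ⟨∫ y, F' x₀ y ∂μ, ?_, fun h => ?_⟩
  · refine hasFDerivAt_integral_of_dominated_of_fderiv_le (F' := F') hU'
      (.of_forall fun x => ?_) ?_ hF'm (.of_forall fun y x hx => key x hx y) ?_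
      (.of_forall fun y x hx => ?_)
    · exact (Continuous.aestronglyMeasurable (by fun_prop)).mul (hmeas x)
    · refine integrable_of_le_gaussWeight μ (A := C' * (1 + ‖x₀‖) ^ n' * A) (n := n' + m) (x := 0)
        ((Continuous.aestronglyMeasurable (by fun_prop)).mul (hmeas x₀)) hc fun y => ?_
      rw [norm_mul]
      calc _ ≤ (C' * ((1 + ‖x₀‖) * (1 + ‖y‖)) ^ n') * (A * gaussWeight m c y) := by
            refine mul_le_mul ((hn' _).trans ?_) (hb x₀ (mem_of_mem_nhds hU) y) (norm_nonneg _)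
              (by positivity)
            gcongr
            exact hx1 x₀ y
        _ = _ := by
          simp only [gaussWeight, mul_pow, pow_add, sub_zero]; ring
    · exact ((integrable_gaussWeight μ (n + m) hc).comp_sub_right 0).const_mul _
    · have hl : HasFDerivAt (fun x : X => (x, y)) (ContinuousLinearMap.inl ℝ X Y) x :=
        hasFDerivAt_prodMk_left x y
      have h1 := ((temperate_differentiable hp (x, y)).hasFDerivAt).comp x hl
      have h2 := ((temperate_differentiable hq (x, y)).hasFDerivAt).comp x hl
      have h3 := h1.mul ((h2.cexp).mul_const (M y))
      have h4 : F' x y = (p ∘ fun x => (x, y)) x •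
          M y • Complex.exp ((q ∘ fun x => (x, y)) x) •
            (fderiv ℝ q (x, y)).comp (ContinuousLinearMap.inl ℝ X Y) +
          (Complex.exp ((q ∘ fun x => (x, y)) x) * M y) •
            (fderiv ℝ p (x, y)).comp (ContinuousLinearMap.inl ℝ X Y) := by
        ext h
        simp [F', D]
        ring
      rw [h4]
      exact h3
  · rw [ContinuousLinearMap.integral_apply hint']
    congr 1
    ext y
    simp [F', D]
    ring

end Parametric

section Stokes

variable {Y : Type*} [NormedAddCommGroup Y] [NormedSpace ℝ Y] [FiniteDimensional ℝ Y]
  [MeasurableSpace Y] [BorelSpace Y] (μ : Measure Y) [μ.IsAddHaarMeasure]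

lemma integrable_temperate_mul_exp {p q : Y → ℂ} (hp : p.HasTemperateGrowth)
    (hq : Continuous q) {A c : ℝ} (hc : 0 < c)
    (hb : ∀ y, ‖Complex.exp (q y)‖ ≤ A * gaussWeight 0 c y) :
    Integrable (fun y => p y * Complex.exp (q y)) μ := by
  obtain ⟨n, C, hC, hn⟩ := temperate_bound hp
  have := temperate_continuous hp
  refine integrable_of_le_gaussWeight μ (A := C * A) (n := n) (x := 0)
    (Continuous.aestronglyMeasurable (by fun_prop)) hc fun y => ?_
  rw [norm_mul]
  calc _ ≤ (C * (1 + ‖y‖) ^ n) * (A * gaussWeight 0 c y) :=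
        mul_le_mul (hn y) (hb y) (norm_nonneg _) (by positivity)
    _ = _ := by simp only [gaussWeight, sub_zero]; ring

/-- The total derivative of an integrable function with integrable derivative has integral zero. -/
theorem integral_fderiv_gauss {p q : Y → ℂ} (hp : p.HasTemperateGrowth)
    (hq : q.HasTemperateGrowth) {A c : ℝ} (hc : 0 < c)
    (hb : ∀ y, ‖Complex.exp (q y)‖ ≤ A * gaussWeight 0 c y) (v : Y) :
    ∫ y, (fderiv ℝ p y v + p y * fderiv ℝ q y v) * Complex.exp (q y) ∂μ = 0 := by
  have hint : ∀ r : Y → ℂ, r.HasTemperateGrowth →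
      Integrable (fun y => r y * Complex.exp (q y)) μ := fun r hr =>
    integrable_temperate_mul_exp μ hr (temperate_continuous hq) hc hb
  have hd : ∀ y, HasFDerivAt (fun y => p y * Complex.exp (q y))
      (p y • (Complex.exp (q y) • fderiv ℝ q y) + Complex.exp (q y) • fderiv ℝ p y) y := fun y =>
    (temperate_differentiable hp y).hasFDerivAt.mul
      (temperate_differentiable hq y).hasFDerivAt.cexp
  have hder : ∀ y, (fderiv ℝ p y v + p y * fderiv ℝ q y v) * Complex.exp (q y)
      = fderiv ℝ (fun y => p y * Complex.exp (q y)) y v := fun y => by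
    rw [(hd y).fderiv]
    simp
    ring
  have h := integral_bilinear_hasLineDerivAt_right_eq_neg_left_of_integrable (μ := μ) (v := v)
    (f := fun _ : Y => (1 : ℂ)) (f' := fun _ => 0) (g := fun y => p y * Complex.exp (q y))
    (g' := fun y => (fderiv ℝ p y v + p y * fderiv ℝ q y v) * Complex.exp (q y))
    (B := ContinuousLinearMap.mul ℝ ℂ) (by simp) ?_ ?_ (fun y => ?_) (fun y => ?_)
  · simpa using h
  · simpa using hint _ ((temperate_fderiv_apply hp v).add (hp.mul (temperate_fderiv_apply hq v)))
  · simpa using hint p hp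
  · exact fun _ => by simpa using (hasFDerivAt_const (𝕜 := ℝ) (1 : ℂ) y).hasLineDerivAt v
  · intro _
    rw [hder, (hd y).fderiv]
    exact (hd y).hasLineDerivAt v

end Stokes

section Components

variable {X : Type*} [NormedAddCommGroup X] [NormedSpace ℝ X] [FiniteDimensional ℝ X]

/-- The derivatives of order `n + 1` are controlled by the derivatives of order `n` of the partial
derivatives along a basis. -/
lemma exists_norm_iteratedFDeriv_succ_le {ι : Type*} [Fintype ι] (b : Module.Basis ι ℝ X) :
    ∃ C : ℝ, 0 ≤ C ∧ ∀ (f : X → ℂ), ContDiff ℝ ∞ f → ∀ (n : ℕ) (x : X),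
      ‖iteratedFDeriv ℝ (n + 1) f x‖ ≤
        C * ∑ i, ‖iteratedFDeriv ℝ n (fun x => fderiv ℝ f x (b i)) x‖ := by
  let e : ι → X →L[ℝ] ℝ := fun i => (b.coord i).toContinuousLinearMap
  let T : ι → ℂ →L[ℝ] X →L[ℝ] ℂ := fun i =>
    ContinuousLinearMap.smulRightL ℝ X ℂ (e i)
  refine ⟨∑ i, ‖T i‖, by positivity, fun f hf n x => ?_⟩
  have hg : ∀ i, ContDiff ℝ ∞ (fun x => fderiv ℝ f x (b i)) := fun i =>
    (hf.fderiv_right (by simp)).clm_apply contDiff_const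
  have h : fderiv ℝ f = fun x => ∑ i, T i (fderiv ℝ f x (b i)) := by
    ext x v
    conv_lhs => rw [← b.sum_repr v, map_sum]
    simp [T, e]
  have h' : iteratedFDeriv ℝ n (fderiv ℝ f) x
      = ∑ i, iteratedFDeriv ℝ n (T i ∘ fun x => fderiv ℝ f x (b i)) x := by
    conv_lhs => rw [h]
    exact iteratedFDeriv_fun_sum_apply (fun i _ =>
      (((T i).contDiff.comp (hg i)).of_le (mod_cast le_top)).contDiffAt)
  rw [← norm_iteratedFDeriv_fderiv, h']
  refine (norm_sum_le _ _).trans ?_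
  rw [Finset.sum_mul]
  refine Finset.sum_le_sum fun i _ => ?_
  refine ((T i).norm_iteratedFDeriv_comp_left (f := fun x => fderiv ℝ f x (b i)) (x := x)
    (N := ∞) (n := n) (hg i).contDiffAt (mod_cast le_top)).trans ?_
  gcongr
  exact Finset.single_le_sum (f := fun i => ‖iteratedFDeriv ℝ n (fun x => fderiv ℝ f x (b i)) x‖)
    (fun i _ => norm_nonneg _) (Finset.mem_univ i)

end Components

/-! ### The reproducing kernel of the Bargmann space -/

instance : lam.IsAddHaarMeasure :=
  Measure.IsAddHaarMeasure.smul volume (by norm_num) (by norm_num)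

lemma measurePreserving_mul_left_lam {c : ℂ} (hc : ‖c‖ = 1) :
    MeasurePreserving (fun z => c * z) lam lam := by
  let C : Circle := ⟨c, by simp [Submonoid.unitSphere, hc]⟩
  have h := (rotation C).measurePreserving
  have h' : MeasurePreserving (fun z => c * z) volume volume := h
  exact h'.smul_measure 2

lemma integral_exp_neg_mul_sq_lam {b : ℝ} (hb : 0 < b) :
    ∫ z : ℂ, Real.exp (-b * ‖z‖ ^ 2) ∂lam = 2 * Real.pi / b := by
  rw [lam, integral_smul_measure, GaussianFourier.integral_rexp_neg_mul_sq_norm hb]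
  simp
  ring

/-- The mean value property, integrated against a Gaussian: rotations preserve the measure and the
weight, and the average of `g` over the rotations of a point is `g 0`. -/
theorem integral_entire_mul_gaussian {g : ℂ → ℂ} (hg : Differentiable ℂ g) {b : ℝ}
    (hi : Integrable (fun z => g z * (Real.exp (-b * ‖z‖ ^ 2) : ℂ)) lam) :
    ∫ z, g z * (Real.exp (-b * ‖z‖ ^ 2) : ℂ) ∂lam
      = g 0 * ∫ z : ℂ, (Real.exp (-b * ‖z‖ ^ 2) : ℂ) ∂lam := by
  set G : ℂ → ℂ := fun z => g z * (Real.exp (-b * ‖z‖ ^ 2) : ℂ) with hG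
  let ν : Measure ℝ := volume.restrict (Set.Ioc 0 (2 * Real.pi))
  have hS : MeasurePreserving (fun p : ℝ × ℂ => (p.1, circleMap 0 1 p.1 * p.2))
      (ν.prod lam) (ν.prod lam) := by
    refine (MeasurePreserving.id ν).skew_product (g := fun θ z => circleMap 0 1 θ * z) ?_ ?_
    · exact Continuous.measurable (by fun_prop)
    · exact .of_forall fun θ => (measurePreserving_mul_left_lam (by simp)).map_eq
  have hint : Integrable (fun p : ℝ × ℂ => G (circleMap 0 1 p.1 * p.2)) (ν.prod lam) :=
    hS.integrable_comp_of_integrable (hi.comp_snd ν)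
  have h1 : ∫ θ, (∫ z, G (circleMap 0 1 θ * z) ∂lam) ∂ν = (2 * Real.pi : ℝ) • ∫ z, G z ∂lam := by
    have : ∀ θ : ℝ, ∫ z, G (circleMap 0 1 θ * z) ∂lam = ∫ z, G z ∂lam := fun θ =>
      (measurePreserving_mul_left_lam (c := circleMap 0 1 θ) (by simp)).integral_comp
        (Homeomorph.mulLeft₀ (circleMap 0 1 θ) (by simp)).measurableEmbedding G
    simp only [this, integral_const]
    congr 1
    simp [ν, Measure.real, Real.pi_pos.le]
  have h2 : ∀ z, ∫ θ, G (circleMap 0 1 θ * z) ∂ν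
      = (2 * Real.pi : ℝ) • (g 0 * (Real.exp (-b * ‖z‖ ^ 2) : ℂ)) := fun z => by
    have hd : Differentiable ℂ (fun t => g (t * z)) := hg.comp (differentiable_id.mul_const z)
    have hc := (hd.diffContOnCl (s := Metric.ball 0 |1|)).circleAverage
    rw [Real.circleAverage, intervalIntegral.integral_of_le (by positivity), inv_smul_eq_iff₀
      (by positivity)] at hc
    calc ∫ θ, G (circleMap 0 1 θ * z) ∂ν
        = (∫ θ in Set.Ioc 0 (2 * Real.pi), g (circleMap 0 1 θ * z)) *
            (Real.exp (-b * ‖z‖ ^ 2) : ℂ) := by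
          rw [← integral_mul_const]
          congr 1
          ext θ
          simp [hG]
      _ = _ := by
          rw [hc]; simp; ring
  have h3 := integral_integral_swap (f := fun θ z => G (circleMap 0 1 θ * z)) hint
  rw [h1] at h3
  simp only [h2] at h3
  rw [integral_smul, integral_const_mul] at h3
  exact smul_right_injective ℂ (by positivity : (2 * Real.pi : ℝ) ≠ 0) h3

/-- The reproducing kernel `(k/2π) exp(k z w̄ - k|z|²/2 - k|w|²/2)` of `𝓑_k` with respect to
`lam`. -/
def repKernel (k : ℕ) (x : ℂ × ℂ) : ℂ :=
  (k / (2 * Real.pi) : ℂ) *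
    Complex.exp (k * (x.1 * conj x.2 - x.1 * conj x.1 / 2 - x.2 * conj x.2 / 2))

lemma ofReal_exp_neg_sq (b : ℝ) (z : ℂ) :
    (Real.exp (b * ‖z‖ ^ 2) : ℂ) = Complex.exp (b * (z * conj z)) := by
  rw [Complex.mul_conj']; push_cast; rfl

lemma norm_repKernel (k : ℕ) (x : ℂ × ℂ) :
    ‖repKernel k x‖ = k / (2 * Real.pi) * Real.exp (-(k / 2 : ℝ) * ‖x.1 - x.2‖ ^ 2) := by
  rw [repKernel, norm_mul, Complex.norm_exp]
  congr 1
  · simp [abs_of_pos Real.pi_pos]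
  · congr 1
    simp [Complex.sq_norm, Complex.normSq_apply]
    ring

lemma conj_repKernel (k : ℕ) (z w : ℂ) : conj (repKernel k (z, w)) = repKernel k (w, z) := by
  simp only [repKernel, map_mul, ← Complex.exp_conj, map_sub, map_div₀, Complex.conj_conj,
    Complex.conj_ofReal, map_natCast, map_ofNat]
  congr 2
  ring

lemma continuous_repKernel (k : ℕ) : Continuous (repKernel k) := by
  unfold repKernel; fun_prop

lemma wt_le (z : ℂ) : wt z ≤ 1 + ‖z‖ := by
  rw [wt]; refine Real.sqrt_le_iff.2 ⟨by positivity, by nlinarith [norm_nonneg z]⟩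

lemma le_wt (z : ℂ) : 1 + ‖z‖ ≤ 2 * wt z := by
  have h1 : 1 ≤ wt z := by rw [wt]; exact Real.one_le_sqrt.2 (by nlinarith [norm_nonneg z])
  have h2 : ‖z‖ ≤ wt z := by rw [wt]; exact Real.le_sqrt_of_sq_le (by linarith)
  linarith

lemma one_le_wt (z : ℂ) : 1 ≤ wt z := by
  rw [wt]; exact Real.one_le_sqrt.2 (by nlinarith [norm_nonneg z])

lemma wt_pow (z : ℂ) (j : ℕ) : (1 + ‖z‖ ^ 2) ^ ((j : ℝ) / 2) = wt z ^ j := by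
  rw [wt, Real.sqrt_eq_rpow, ← Real.rpow_mul_natCast (by positivity)]
  congr 1; ring

/-- Decay faster than any power. -/
def RapidDecay (g : ℂ → ℂ) : Prop := ∀ j : ℕ, ∃ M : ℝ, ∀ z, ‖g z‖ * (1 + ‖z‖) ^ j ≤ M

lemma rapidDecay_of_mem {k : ℕ} {φ : ℂ → ℂ} (h : φ ∈ schwartzSpace k) : RapidDecay φ := fun j => by
  obtain ⟨M, hM⟩ := h.2 j
  refine ⟨2 ^ j * M, fun z => ?_⟩
  calc ‖φ z‖ * (1 + ‖z‖) ^ j ≤ ‖φ z‖ * (2 * wt z) ^ j := by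
        gcongr; exact le_wt z
    _ = 2 ^ j * (‖φ z‖ * wt z ^ j) := by ring
    _ ≤ _ := by
      gcongr; rw [← wt_pow]; exact hM z

lemma RapidDecay.bound {g : ℂ → ℂ} (h : RapidDecay g) (j : ℕ) :
    ∃ M : ℝ, 0 ≤ M ∧ ∀ z, ‖g z‖ * (1 + ‖z‖) ^ j ≤ M := by
  obtain ⟨M, hM⟩ := h j
  exact ⟨M, (by positivity : (0 : ℝ) ≤ ‖g 0‖ * (1 + ‖(0 : ℂ)‖) ^ j).trans (hM 0), hM⟩

lemma RapidDecay.mul {g a : ℂ → ℂ} (h : RapidDecay g) {C : ℝ} {m : ℕ}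
    (ha : ∀ z, ‖a z‖ ≤ C * (1 + ‖z‖) ^ m) : RapidDecay (fun z => a z * g z) := fun j => by
  obtain ⟨M, hM⟩ := h (m + j)
  have hC : 0 ≤ C := by simpa using (norm_nonneg _).trans (ha 0)
  refine ⟨C * M, fun z => ?_⟩
  rw [norm_mul]
  calc ‖a z‖ * ‖g z‖ * (1 + ‖z‖) ^ j ≤ C * (1 + ‖z‖) ^ m * ‖g z‖ * (1 + ‖z‖) ^ j := by
        gcongr; exact ha z
    _ = C * (‖g z‖ * (1 + ‖z‖) ^ (m + j)) := by ring
    _ ≤ _ := by gcongr; exact hM z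

lemma RapidDecay.norm_le {g : ℂ → ℂ} (h : RapidDecay g) :
    ∃ M : ℝ, 0 ≤ M ∧ ∀ z, ‖g z‖ ≤ M := by
  simpa using h.bound 0

lemma integrable_one_add_norm_pow_inv :
    Integrable (fun z : ℂ => ((1 + ‖z‖) ^ 4)⁻¹) lam := by
  have h := integrable_one_add_norm (E := ℂ) (μ := lam) (r := 4) (by simp; norm_num)
  refine h.congr (.of_forall fun z => ?_)
  simp only
  rw [Real.rpow_neg (by positivity)]
  norm_cast

lemma RapidDecay.integrable {g : ℂ → ℂ} (h : RapidDecay g) (hc : Continuous g) :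
    Integrable g lam := by
  obtain ⟨M, hM⟩ := h 4
  refine (integrable_one_add_norm_pow_inv.const_mul M).mono' hc.aestronglyMeasurable
    (.of_forall fun z => ?_)
  rw [← div_eq_mul_inv, le_div_iff₀ (by positivity)]
  exact hM z

lemma RapidDecay.memLp {g : ℂ → ℂ} (h : RapidDecay g) (hc : Continuous g) : MemLp g 2 lam := by
  rw [memLp_two_iff_integrable_sq_norm hc.aestronglyMeasurable]
  obtain ⟨M, hM0, hM⟩ := h.norm_le
  refine ((h.integrable hc).norm.const_mul M).mono' (by fun_prop) (.of_forall fun z => ?_)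
  rw [Real.norm_of_nonneg (by positivity), sq]
  gcongr
  exact hM z

lemma continuous_of_mem_bargmannSpace {k : ℕ} {φ : ℂ → ℂ} (h : φ ∈ bargmannSpace k) :
    Continuous φ := by
  obtain ⟨⟨f, hf, hφ⟩, -⟩ := h
  have := hf.continuous
  rw [show φ = fun z => f z * (Real.exp (-(k : ℝ) / 2 * ‖z‖ ^ 2) : ℂ) from funext hφ]
  fun_prop

lemma mem_schwartzSpace {k : ℕ} {φ f : ℂ → ℂ} (hf : Differentiable ℂ f)
    (hφ : ∀ z, φ z = f z * (Real.exp (-(k : ℝ) / 2 * ‖z‖ ^ 2) : ℂ)) (hd : RapidDecay φ) :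
    φ ∈ schwartzSpace k := by
  have hc : Continuous φ := by
    have := hf.continuous
    rw [show φ = fun z => f z * (Real.exp (-(k : ℝ) / 2 * ‖z‖ ^ 2) : ℂ) from funext hφ]
    fun_prop
  refine ⟨⟨⟨f, hf, hφ⟩, hd.memLp hc⟩, fun j => ?_⟩
  obtain ⟨M, hM⟩ := hd j
  refine ⟨M, fun z => (le_trans ?_ (hM z))⟩
  rw [wt_pow]
  gcongr
  · exact (one_le_wt z).trans' zero_le_one
  · exact wt_le z

lemma one_add_norm_le_mul (z w : ℂ) : 1 + ‖z‖ ≤ (1 + ‖w‖) * (1 + ‖z - w‖) := by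
  have := norm_le_norm_add_norm_sub' z w
  nlinarith [norm_nonneg w, norm_nonneg (z - w)]

/-- The coherent states belong to `𝔖_k`. They serve as test functions. -/
lemma repKernel_mem {k : ℕ} (hk : 1 ≤ k) (w : ℂ) :
    (fun z => repKernel k (z, w)) ∈ schwartzSpace k := by
  refine mem_schwartzSpace (f := fun z => (k / (2 * Real.pi) : ℂ) *
    Complex.exp (k * (z * conj w - w * conj w / 2))) (by fun_prop) (fun z => ?_) fun j => ?_
  · rw [ofReal_exp_neg_sq, repKernel, mul_assoc, ← Complex.exp_add]
    congr 2
    push_cast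
    ring
  · have hk' : (0 : ℝ) < k / 2 := by
      have : (0 : ℝ) < k := by exact_mod_cast hk
      positivity
    obtain ⟨C, hC0, hC⟩ := exists_pow_mul_exp_le j hk'
    refine ⟨k / (2 * Real.pi) * (1 + ‖w‖) ^ j * C, fun z => ?_⟩
    rw [norm_repKernel]
    calc _ ≤ k / (2 * Real.pi) * Real.exp (-(k / 2 : ℝ) * ‖z - w‖ ^ 2)
          * ((1 + ‖w‖) * (1 + ‖z - w‖)) ^ j := by
          gcongr; exact one_add_norm_le_mul z w
      _ = k / (2 * Real.pi) * (1 + ‖w‖) ^ j *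
          ((1 + ‖z - w‖) ^ j * Real.exp (-(k / 2 : ℝ) * ‖z - w‖ ^ 2)) := by
          rw [mul_pow]; ring
      _ ≤ _ := by gcongr; exact hC _ (norm_nonneg _)

lemma memLp_repKernel_right {k : ℕ} (hk : 1 ≤ k) (z : ℂ) :
    MemLp (fun w => repKernel k (z, w)) 2 lam := by
  have h := (repKernel_mem hk z).1.2.star
  refine h.congr_norm ((continuous_repKernel k).comp (by fun_prop)).aestronglyMeasurable ?_
  exact .of_forall fun w => by simp [← conj_repKernel k w z]

lemma integrable_repKernel_mul {k : ℕ} (hk : 1 ≤ k) {g : ℂ → ℂ} (hg : MemLp g 2 lam) (z : ℂ) :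
    Integrable (fun w => repKernel k (z, w) * g w) lam :=
  (memLp_repKernel_right hk z).integrable_mul hg

/-- The reproducing property of `repKernel`. -/
theorem integral_repKernel_mul {k : ℕ} (hk : 1 ≤ k) {φ : ℂ → ℂ} (hφ : φ ∈ bargmannSpace k) (z : ℂ) :
    ∫ w, repKernel k (z, w) * φ w ∂lam = φ z := by
  have hk0 : (0 : ℝ) < k := by exact_mod_cast hk
  have hint := integrable_repKernel_mul hk hφ.2 z
  obtain ⟨⟨f, hf, hf'⟩, -⟩ := hφ
  set c : ℂ := (k / (2 * Real.pi) : ℂ) * (Real.exp (-(k : ℝ) / 2 * ‖z‖ ^ 2) : ℂ) with hc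
  have hc0 : c ≠ 0 := by
    rw [hc]
    exact mul_ne_zero (by exact_mod_cast (by positivity : (k : ℝ) / (2 * Real.pi) ≠ 0))
      (by exact_mod_cast (Real.exp_pos _).ne')
  -- Translating by `z` turns the kernel into a centred Gaussian times an entire function.
  have h1 : ∀ ζ, repKernel k (z, ζ + z) * φ (ζ + z)
      = c * (f (ζ + z) * Complex.exp (-k * conj z * ζ) * (Real.exp (-(k : ℝ) * ‖ζ‖ ^ 2) : ℂ)) := by
    intro ζ
    rw [hf', hc, ofReal_exp_neg_sq, ofReal_exp_neg_sq, ofReal_exp_neg_sq, repKernel]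
    have : ∀ a b c d e f g : ℂ, b + d = e + f + g →
        (a * Complex.exp b) * (c * Complex.exp d)
        = a * Complex.exp e * (c * Complex.exp f * Complex.exp g) := fun a b c d e f g h => by
      calc _ = a * c * Complex.exp (b + d) := by rw [Complex.exp_add]; ring
        _ = _ := by rw [h, Complex.exp_add, Complex.exp_add]; ring
    apply this
    simp only [map_add]
    push_cast
    ring
  have h2 := hint.comp_add_right z
  simp only [h1] at h2
  rw [integrable_const_mul_iff (Ne.isUnit hc0)] at h2
  rw [← integral_add_right_eq_self _ z]
  simp only [h1]
  rw [integral_const_mul, integral_entire_mul_gaussian (by fun_prop) h2, integral_complex_ofReal,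
    integral_exp_neg_mul_sq_lam hk0, hf' z, hc]
  have hpi : (Real.pi : ℂ) ≠ 0 := by exact_mod_cast Real.pi_pos.ne'
  have hk1 : (k : ℂ) ≠ 0 := by exact_mod_cast hk0.ne'
  push_cast
  simp
  field_simp

/-- The orthogonal projection onto `𝓑_k` is given by the reproducing kernel. -/
lemma IsProjection.eq_integral {k : ℕ} (hk : 1 ≤ k) {g p : ℂ → ℂ} (h : IsProjection k g p)
    (z : ℂ) : p z = ∫ w, repKernel k (z, w) * g w ∂lam := by
  obtain ⟨hg, hp, ho⟩ := h
  have h1 := ho _ (repKernel_mem hk z).1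
  simp only [conj_repKernel, mul_sub] at h1
  rw [integral_sub (integrable_repKernel_mul hk hg z) (integrable_repKernel_mul hk hp.2 z),
    integral_repKernel_mul hk hp, sub_eq_zero] at h1
  exact h1.symm

lemma IsOp.hasKernel {k : ℕ} (hk : 1 ≤ k) {a : ℂ → ℂ} {T : schwartzSpace k →ₗ[ℂ] schwartzSpace k}
    (h : IsOp k a T) : HasKernel k (fun x => repKernel k x * a x.2) T := fun φ z => by
  have h1 := (h φ).eq_integral hk z
  have h2 := integrable_repKernel_mul hk (h φ).1 z
  simp only [mul_assoc]
  exact ⟨h2, h1⟩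

/-! ### Toeplitz operators with continuous symbols -/

/-- The entire factor of the projection of `g`. -/
lemma differentiable_integral_exp_mul {k : ℕ} (hk : 1 ≤ k) {g : ℂ → ℂ} (hc : Continuous g)
    (hd : RapidDecay g) :
    Differentiable ℂ (fun z => ∫ w, (k / (2 * Real.pi) : ℂ) *
      Complex.exp (k * (z * conj w - w * conj w / 2)) * g w ∂lam) := by
  intro z₀
  have hk0 : (0 : ℝ) < k := by exact_mod_cast hk
  obtain ⟨M, hM0, hM⟩ := hd.norm_le
  set R : ℝ := ‖z₀‖ + 1 with hR
  have hR0 : 0 ≤ R := by positivity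
  have key : ∀ z ∈ Metric.ball z₀ 1, ∀ w : ℂ,
      ‖(k / (2 * Real.pi) : ℂ) * Complex.exp (k * (z * conj w - w * conj w / 2)) * g w‖
        ≤ k / (2 * Real.pi) * Real.exp (k * R ^ 2) * M * Real.exp (-(k / 4 : ℝ) * ‖w‖ ^ 2) := by
    intro z hz w
    have hzR : ‖z‖ ≤ R := by
      have := norm_le_norm_add_norm_sub' z z₀
      rw [Metric.mem_ball, dist_eq_norm] at hz
      linarith
    rw [norm_mul, norm_mul, Complex.norm_exp]
    have h1 : ‖(k / (2 * Real.pi) : ℂ)‖ = k / (2 * Real.pi) := by simp [abs_of_pos Real.pi_pos]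
    have h2 : ((k : ℂ) * (z * conj w - w * conj w / 2)).re ≤
        k * R ^ 2 + -(k / 4 : ℝ) * ‖w‖ ^ 2 := by
      have h3 : (z * conj w).re ≤ R * ‖w‖ := by
        refine (Complex.re_le_norm _).trans ?_
        rw [norm_mul, RCLike.norm_conj]
        gcongr
      have h4 : (w * conj w / 2).re = ‖w‖ ^ 2 / 2 := by
        rw [Complex.mul_conj']; norm_cast
      rw [← Complex.ofReal_natCast, Complex.re_ofReal_mul, Complex.sub_re, h4]
      have : R * ‖w‖ ≤ R ^ 2 + ‖w‖ ^ 2 / 4 := by nlinarith [sq_nonneg (R - ‖w‖ / 2)]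
      nlinarith
    rw [h1, mul_assoc _ (Real.exp (k * R ^ 2)), mul_assoc, mul_assoc]
    refine mul_le_mul_of_nonneg_left ?_ (by positivity)
    rw [mul_assoc, mul_comm M, ← mul_assoc, ← Real.exp_add]
    exact mul_le_mul (Real.exp_le_exp.2 h2) (hM w) (norm_nonneg _) (Real.exp_pos _).le
  have hcont : ∀ z : ℂ, Continuous fun w : ℂ =>
      (k / (2 * Real.pi) : ℂ) * Complex.exp (k * (z * conj w - w * conj w / 2)) * g w := fun z => by
    fun_prop
  refine (hasDerivAt_integral_of_dominated_loc_of_deriv_le (μ := lam)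
    (F' := fun z w => (k * conj w) * ((k / (2 * Real.pi) : ℂ) *
      Complex.exp (k * (z * conj w - w * conj w / 2)) * g w))
    (bound := fun w => k * (k / (2 * Real.pi) * Real.exp (k * R ^ 2) * M) *
      gaussWeight 1 (k / 4) (w - 0))
    (Metric.ball_mem_nhds z₀ zero_lt_one) (.of_forall fun z => (hcont z).aestronglyMeasurable)
    ?_ ?_ ?_ ?_ ?_).2.differentiableAt
  · refine integrable_of_le_gaussWeight lam (hcont z₀).aestronglyMeasurable
      (A := k / (2 * Real.pi) * Real.exp (k * R ^ 2) * M) (n := 0) (c := k / 4) (x := 0)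
      (by positivity) fun w => ?_
    simpa [gaussWeight] using key z₀ (by simp) w
  · have := hcont z₀
    exact Continuous.aestronglyMeasurable (by fun_prop)
  · refine .of_forall fun w z hz => ?_
    rw [norm_mul, norm_mul, RCLike.norm_conj, Complex.norm_natCast]
    have h5 : ‖w‖ ≤ 1 + ‖w‖ := by linarith
    calc _ ≤ k * (1 + ‖w‖) * (k / (2 * Real.pi) * Real.exp (k * R ^ 2) * M *
          Real.exp (-(k / 4 : ℝ) * ‖w‖ ^ 2)) := by
          gcongr
          exact key z hz w
      _ = _ := by simp only [gaussWeight, sub_zero]; ring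
  · exact (((integrable_gaussWeight lam 1 (by positivity)).comp_sub_right 0).const_mul _)
  · refine .of_forall fun w z hz => ?_
    have h6 : HasDerivAt (fun z : ℂ => (k : ℂ) * (z * conj w - w * conj w / 2)) (k * conj w) z := by
      simpa using (((hasDerivAt_id z).mul_const (conj w)).sub_const (w * conj w / 2)).const_mul
        (k : ℂ)
    have h7 := (h6.cexp.const_mul (k / (2 * Real.pi) : ℂ)).mul_const (g w)
    refine h7.congr_deriv ?_
    ring

lemma integral_repKernel_mul_mem {k : ℕ} (hk : 1 ≤ k) {g : ℂ → ℂ} (hc : Continuous g)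
    (hd : RapidDecay g) : (fun z => ∫ w, repKernel k (z, w) * g w ∂lam) ∈ schwartzSpace k := by
  have hk0 : (0 : ℝ) < k := by exact_mod_cast hk
  refine mem_schwartzSpace (differentiable_integral_exp_mul hk hc hd) (fun z => ?_) fun j => ?_
  · rw [← integral_mul_const]
    congr 1
    ext w
    rw [ofReal_exp_neg_sq, repKernel]
    have : ∀ a b c d e : ℂ, b = c + e → a * Complex.exp b * d
        = a * Complex.exp c * d * Complex.exp e := fun a b c d e h => by
      rw [h, Complex.exp_add]; ring
    apply this
    push_cast
    ring
  · obtain ⟨M, hM0, hM⟩ := hd.bound j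
    refine ⟨k / (2 * Real.pi) * M * ∫ y : ℂ, gaussWeight j (k / 2) y ∂lam, fun z => ?_⟩
    have h1 := norm_integral_le_gaussWeight lam (x := z) (c := k / 2) (n := j)
      (A := k / (2 * Real.pi) * M)
      (f := fun w => ((1 + ‖z‖ : ℝ) ^ j : ℝ) • (repKernel k (z, w) * g w)) (by positivity)
      fun w => ?_
    · rw [integral_smul, norm_smul, Real.norm_of_nonneg (by positivity)] at h1
      rwa [mul_comm]
    · rw [norm_smul, Real.norm_of_nonneg (by positivity), norm_mul, norm_repKernel, gaussWeight,
        norm_sub_rev w z]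
      simp only
      calc (1 + ‖z‖) ^ j * (k / (2 * Real.pi) * Real.exp (-(k / 2 : ℝ) * ‖z - w‖ ^ 2) * ‖g w‖)
          ≤ ((1 + ‖w‖) * (1 + ‖z - w‖)) ^ j *
            (k / (2 * Real.pi) * Real.exp (-(k / 2 : ℝ) * ‖z - w‖ ^ 2) * ‖g w‖) := by
            gcongr; exact one_add_norm_le_mul z w
        _ = k / (2 * Real.pi) * (‖g w‖ * (1 + ‖w‖) ^ j) * ((1 + ‖z - w‖) ^ j *
            Real.exp (-(k / 2 : ℝ) * ‖z - w‖ ^ 2)) := by rw [mul_pow]; ring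
        _ ≤ _ := by gcongr; exact hM w

lemma isProjection_integral_repKernel {k : ℕ} (hk : 1 ≤ k) {g : ℂ → ℂ} (hc : Continuous g)
    (hd : RapidDecay g) : IsProjection k g (fun z => ∫ w, repKernel k (z, w) * g w ∂lam) := by
  have hk0 : (0 : ℝ) < k := by exact_mod_cast hk
  have hg2 := hd.memLp hc
  have hg1 := hd.integrable hc
  have hp := (integral_repKernel_mul_mem hk hc hd).1
  refine ⟨hg2, hp, fun χ hχ => ?_⟩
  have hχc := continuous_of_mem_bargmannSpace hχ
  have hPc := continuous_repKernel k
  have hint : Integrable (Function.uncurry fun z w => conj (χ z) * (repKernel k (z, w) * g w))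
      (lam.prod lam) := by
    have h1 : Integrable (fun x : ℂ × ℂ => ‖χ x.1‖ ^ 2 * ‖g x.2‖) (lam.prod lam) :=
      ((memLp_two_iff_integrable_sq_norm hχc.aestronglyMeasurable).1 hχ.2).mul_prod hg1.norm
    have h2 : Integrable (fun x : ℂ × ℂ => ‖g x.2‖ * gaussWeight 0 (k : ℝ) (x.1 - x.2))
        (lam.prod lam) :=
      Integrable.convolution_integrand (ContinuousLinearMap.mul ℝ ℝ) hg1.norm
        (integrable_gaussWeight lam 0 hk0)
    refine ((h1.add h2).const_mul (k / (2 * Real.pi))).mono'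
      (Continuous.aestronglyMeasurable (by fun_prop)) (.of_forall fun x => ?_)
    simp only [Function.uncurry, norm_mul, RCLike.norm_conj, norm_repKernel, Pi.add_apply,
      gaussWeight, pow_zero, one_mul]
    set b := Real.exp (-(k / 2 : ℝ) * ‖x.1 - x.2‖ ^ 2) with hb
    have hb2 : Real.exp (-(k : ℝ) * ‖x.1 - x.2‖ ^ 2) = b ^ 2 := by
      rw [hb, ← Real.exp_nat_mul]; congr 1; push_cast; ring
    rw [hb2]
    have h3 : ‖χ x.1‖ * b ≤ ‖χ x.1‖ ^ 2 + b ^ 2 := by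
      nlinarith [sq_nonneg (‖χ x.1‖ - b), sq_nonneg ‖χ x.1‖, sq_nonneg b]
    calc _ = k / (2 * Real.pi) * ((‖χ x.1‖ * b) * ‖g x.2‖) := by ring
      _ ≤ k / (2 * Real.pi) * ((‖χ x.1‖ ^ 2 + b ^ 2) * ‖g x.2‖) := by gcongr
      _ = _ := by ring
  have hχg : Integrable (fun z => conj (χ z) * g z) lam := hχ.2.star.integrable_mul hg2
  have hχp : Integrable (fun z => conj (χ z) * ∫ w, repKernel k (z, w) * g w ∂lam) lam :=
    hχ.2.star.integrable_mul hp.2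
  simp only [mul_sub]
  rw [integral_sub hχg hχp, sub_eq_zero]
  symm
  calc ∫ z, conj (χ z) * ∫ w, repKernel k (z, w) * g w ∂lam ∂lam
      = ∫ z, ∫ w, conj (χ z) * (repKernel k (z, w) * g w) ∂lam ∂lam := by
        simp only [integral_const_mul]
    _ = ∫ w, ∫ z, conj (χ z) * (repKernel k (z, w) * g w) ∂lam ∂lam :=
        integral_integral_swap hint
    _ = ∫ w, conj (χ w) * g w ∂lam := by
        congr 1
        ext w
        rw [← integral_repKernel_mul hk hχ w, ← integral_conj, ← integral_mul_const]
        congr 1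
        ext z
        rw [map_mul, conj_repKernel]
        ring

/-- Multiplication by a continuous function of polynomial growth, followed by the projector, is an
operator on `𝔖_k`. -/
theorem exists_isOp {k : ℕ} (hk : 1 ≤ k) {a : ℂ → ℂ} (ha : Continuous a) {C : ℝ} {m : ℕ}
    (hb : ∀ z, ‖a z‖ ≤ C * (1 + ‖z‖) ^ m) :
    ∃ T : schwartzSpace k →ₗ[ℂ] schwartzSpace k, IsOp k a T := by
  have hc : ∀ φ : schwartzSpace k, Continuous (fun w => a w * φ.1 w) := fun φ =>
    ha.mul (continuous_of_mem_bargmannSpace φ.2.1)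
  have hd : ∀ φ : schwartzSpace k, RapidDecay (fun w => a w * φ.1 w) := fun φ =>
    (rapidDecay_of_mem φ.2).mul hb
  have hi : ∀ (φ : schwartzSpace k) z,
      Integrable (fun w => repKernel k (z, w) * (a w * φ.1 w)) lam := fun φ z =>
    integrable_repKernel_mul hk ((hd φ).memLp (hc φ)) z
  refine ⟨{ toFun := fun φ => ⟨_, integral_repKernel_mul_mem hk (hc φ) (hd φ)⟩
            map_add' := fun φ ψ => ?_
            map_smul' := fun t φ => ?_ },
    fun φ => isProjection_integral_repKernel hk (hc φ) (hd φ)⟩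
  · ext z
    simp only [Submodule.coe_add, Pi.add_apply, mul_add]
    exact integral_add (hi φ z) (hi ψ z)
  · ext z
    simp only [Submodule.coe_smul, Pi.smul_apply, RingHom.id_apply, smul_eq_mul]
    rw [← integral_const_mul]
    congr 1
    ext w
    ring

/-! ### Kernels with Gaussian decay -/

/-- A sequence of kernels with Gaussian decay `exp(-ck|z-w|²)` off the diagonal and polynomial
growth in `k` and in the point. -/
def IsGaussKernel (K : ℕ → ℂ × ℂ → ℂ) : Prop :=
  (∀ k, 1 ≤ k → StronglyMeasurable (K k)) ∧
  ∃ (c C : ℝ) (M p : ℕ), 0 < c ∧ ∀ k, 1 ≤ k → ∀ x : ℂ × ℂ,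
    ‖K k x‖ ≤ C * (k : ℝ) ^ M * (1 + ‖x‖) ^ p * Real.exp (-c * k * ‖x.1 - x.2‖ ^ 2)

/-- A sequence of functions on `ℂ²` which is `O(k^{-N})` on bounded sets, for every `N`. -/
def IsLocNegl (K : ℕ → ℂ × ℂ → ℂ) : Prop :=
  ∀ (N : ℕ) (ρ : ℝ), ∃ C : ℝ, ∀ k : ℕ, 1 ≤ k → ∀ x : ℂ × ℂ, ‖x‖ ≤ ρ →
    ‖K k x‖ ≤ C * ((k : ℝ) ^ N)⁻¹

/-- Composition of kernels. -/
def kcomp (K L : ℕ → ℂ × ℂ → ℂ) (k : ℕ) (x : ℂ × ℂ) : ℂ :=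
  ∫ u, K k (x.1, u) * L k (u, x.2) ∂lam

lemma exists_natCast_pow_mul_exp_le (n : ℕ) {c : ℝ} (hc : 0 < c) :
    ∃ C : ℝ, 0 ≤ C ∧ ∀ k : ℕ, (k : ℝ) ^ n * Real.exp (-c * k) ≤ C := by
  obtain ⟨C, h0, h⟩ := exists_pow_mul_exp_le (2 * n) hc
  refine ⟨C, h0, fun k => (le_trans ?_ (h (Real.sqrt k) (Real.sqrt_nonneg _)))⟩
  rw [Real.sq_sqrt (by positivity), pow_mul]
  gcongr
  nlinarith [Real.sqrt_nonneg k, Real.sq_sqrt (Nat.cast_nonneg (α := ℝ) k)]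

lemma IsGaussKernel.bound {K : ℕ → ℂ × ℂ → ℂ} (hK : IsGaussKernel K) :
    ∃ (c C : ℝ) (M p : ℕ), 0 < c ∧ 0 ≤ C ∧ ∀ k, 1 ≤ k → ∀ x : ℂ × ℂ,
      ‖K k x‖ ≤ C * (k : ℝ) ^ M * (1 + ‖x‖) ^ p * Real.exp (-c * k * ‖x.1 - x.2‖ ^ 2) := by
  obtain ⟨-, c, C, M, p, hc, h⟩ := hK
  refine ⟨c, C, M, p, hc, ?_, h⟩
  simpa using (norm_nonneg _).trans (h 1 le_rfl 0)

lemma one_add_norm_prod_left_le (z w u : ℂ) :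
    1 + ‖(z, u)‖ ≤ (1 + ‖(z, w)‖) * (1 + ‖u - z‖) := by
  have h1 : ‖z‖ ≤ ‖(z, w)‖ := le_max_left _ _
  have h2 := norm_le_norm_add_norm_sub' u z
  have h3 : ‖(z, u)‖ ≤ ‖(z, w)‖ + ‖u - z‖ :=
    max_le (by simpa using h1.trans (le_add_of_nonneg_right (norm_nonneg (u - z))))
      (by simp only; linarith)
  nlinarith [norm_nonneg (z, w), norm_nonneg (u - z)]

lemma one_add_norm_prod_right_le (z w u : ℂ) :
    1 + ‖(u, w)‖ ≤ (1 + ‖(z, w)‖) * (1 + ‖u - z‖) := by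
  have h1 : ‖z‖ ≤ ‖(z, w)‖ := le_max_left _ _
  have h1' : ‖w‖ ≤ ‖(z, w)‖ := le_max_right _ _
  have h2 := norm_le_norm_add_norm_sub' u z
  have h3 : ‖(u, w)‖ ≤ ‖(z, w)‖ + ‖u - z‖ :=
    max_le (by simp only; linarith)
      (by simpa using h1'.trans (le_add_of_nonneg_right (norm_nonneg (u - z))))
  nlinarith [norm_nonneg (z, w), norm_nonneg (u - z)]

/-- The integrand of a composition of kernels: one part of the Gaussian decay is kept in `z - w`,
another makes the integral over `u` converge. -/
lemma IsGaussKernel.mul_bound {K L : ℕ → ℂ × ℂ → ℂ} (hK : IsGaussKernel K) (hL : IsGaussKernel L) :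
    ∃ (c C : ℝ) (M p : ℕ), 0 < c ∧ 0 ≤ C ∧ ∀ k, 1 ≤ k → ∀ z w u : ℂ,
      ‖K k (z, u) * L k (u, w)‖ ≤ C * (k : ℝ) ^ M * (1 + ‖(z, w)‖) ^ p *
        Real.exp (-c * k * ‖z - w‖ ^ 2) * gaussWeight p c (u - z) := by
  obtain ⟨c₁, C₁, M₁, p₁, hc₁, hC₁, h₁⟩ := hK.bound
  obtain ⟨c₂, C₂, M₂, p₂, hc₂, hC₂, h₂⟩ := hL.bound
  set c₀ := min c₁ c₂ with hc₀
  have hc0 : 0 < c₀ := lt_min hc₁ hc₂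
  refine ⟨c₀ / 4, C₁ * C₂, M₁ + M₂, p₁ + p₂, by positivity, by positivity,
    fun k hk z w u => ?_⟩
  have hk1 : (1 : ℝ) ≤ k := by exact_mod_cast hk
  have hexp : -c₁ * k * ‖z - u‖ ^ 2 + -c₂ * k * ‖u - w‖ ^ 2
      ≤ -(c₀ / 4) * k * ‖z - w‖ ^ 2 + -(c₀ / 4) * ‖u - z‖ ^ 2 := by
    have ht := norm_sub_le_norm_sub_add_norm_sub z u w
    rw [norm_sub_rev u z]
    generalize ‖z - u‖ = a at *
    generalize hb : ‖u - w‖ = b at *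
    generalize hd : ‖z - w‖ = d at *
    have hd0 : 0 ≤ d := hd ▸ norm_nonneg _
    have e1 : d ^ 2 ≤ 2 * a ^ 2 + 2 * b ^ 2 := by nlinarith [sq_nonneg (a - b)]
    have e2 : c₀ * (k * a ^ 2) ≤ c₁ * (k * a ^ 2) := by gcongr; exact min_le_left _ _
    have e3 : c₀ * (k * b ^ 2) ≤ c₂ * (k * b ^ 2) := by gcongr; exact min_le_right _ _
    have e4 : c₀ * (k * d ^ 2) ≤ c₀ * (k * (2 * a ^ 2 + 2 * b ^ 2)) := by gcongr
    have e5 : c₀ * (1 * a ^ 2) ≤ c₀ * (k * a ^ 2) := by gcongr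
    have e6 : 0 ≤ c₀ * (k * a ^ 2) := by positivity
    have e7 : 0 ≤ c₀ * (k * b ^ 2) := by positivity
    linarith
  rw [norm_mul]
  calc ‖K k (z, u)‖ * ‖L k (u, w)‖
      ≤ (C₁ * (k : ℝ) ^ M₁ * ((1 + ‖(z, w)‖) * (1 + ‖u - z‖)) ^ p₁ *
          Real.exp (-c₁ * k * ‖z - u‖ ^ 2)) *
        (C₂ * (k : ℝ) ^ M₂ * ((1 + ‖(z, w)‖) * (1 + ‖u - z‖)) ^ p₂ *
          Real.exp (-c₂ * k * ‖u - w‖ ^ 2)) := by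
        gcongr
        · refine (h₁ k hk (z, u)).trans ?_
          gcongr
          exact one_add_norm_prod_left_le z w u
        · refine (h₂ k hk (u, w)).trans ?_
          gcongr
          exact one_add_norm_prod_right_le z w u
    _ = C₁ * C₂ * (k : ℝ) ^ (M₁ + M₂) * (1 + ‖(z, w)‖) ^ (p₁ + p₂) *
        (1 + ‖u - z‖) ^ (p₁ + p₂) *
        Real.exp (-c₁ * k * ‖z - u‖ ^ 2 + -c₂ * k * ‖u - w‖ ^ 2) := by
        rw [Real.exp_add, mul_pow, mul_pow]; ring
    _ ≤ C₁ * C₂ * (k : ℝ) ^ (M₁ + M₂) * (1 + ‖(z, w)‖) ^ (p₁ + p₂) *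
        (1 + ‖u - z‖) ^ (p₁ + p₂) *
        Real.exp (-(c₀ / 4) * k * ‖z - w‖ ^ 2 + -(c₀ / 4) * ‖u - z‖ ^ 2) := by gcongr
    _ = _ := by rw [Real.exp_add, gaussWeight]; ring

lemma IsGaussKernel.stronglyMeasurable_mul {K L : ℕ → ℂ × ℂ → ℂ} (hK : IsGaussKernel K)
    (hL : IsGaussKernel L) {k : ℕ} (hk : 1 ≤ k) :
    StronglyMeasurable (fun y : (ℂ × ℂ) × ℂ => K k (y.1.1, y.2) * L k (y.2, y.1.2)) :=
  ((hK.1 k hk).comp_measurable (by fun_prop)).mul ((hL.1 k hk).comp_measurable (by fun_prop))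

lemma IsGaussKernel.kcomp {K L : ℕ → ℂ × ℂ → ℂ} (hK : IsGaussKernel K) (hL : IsGaussKernel L) :
    IsGaussKernel (kcomp K L) := by
  obtain ⟨c, C, M, p, hc, hC, h⟩ := hK.mul_bound hL
  refine ⟨fun k hk => (hK.stronglyMeasurable_mul hL hk).integral_prod_right', c,
    C * ∫ y : ℂ, gaussWeight p c y ∂lam, M, p, hc, fun k hk x => ?_⟩
  refine (norm_integral_le_gaussWeight lam hc fun u => h k hk x.1 x.2 u).trans (le_of_eq ?_)
  ring

lemma IsGaussKernel.integrable_mul {K L : ℕ → ℂ × ℂ → ℂ} (hK : IsGaussKernel K)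
    (hL : IsGaussKernel L) {k : ℕ} (hk : 1 ≤ k) (z w : ℂ) :
    Integrable (fun u => K k (z, u) * L k (u, w)) lam := by
  obtain ⟨c, C, M, p, hc, hC, h⟩ := hK.mul_bound hL
  exact integrable_of_le_gaussWeight lam ((hK.stronglyMeasurable_mul hL hk).comp_measurable
    (measurable_prodMk_left (x := (z, w)))).aestronglyMeasurable hc fun u => h k hk z w u

lemma IsGaussKernel.swap {K : ℕ → ℂ × ℂ → ℂ} (hK : IsGaussKernel K) :
    IsGaussKernel (fun k x => K k x.swap) := by
  obtain ⟨hm, c, C, M, p, hc, h⟩ := hK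
  refine ⟨fun k hk => (hm k hk).comp_measurable measurable_swap, c, C, M, p, hc,
    fun k hk x => (h k hk x.swap).trans (le_of_eq ?_)⟩
  simp [Prod.norm_def, max_comm, norm_sub_rev]

lemma IsLocNegl.swap {K : ℕ → ℂ × ℂ → ℂ} (hK : IsLocNegl K) :
    IsLocNegl (fun k x => K k x.swap) := fun N ρ => by
  obtain ⟨C, h⟩ := hK N ρ
  exact ⟨C, fun k hk x hx => h k hk x.swap (by simpa [Prod.norm_def, max_comm] using hx)⟩

lemma IsGaussKernel.add {K L : ℕ → ℂ × ℂ → ℂ} (hK : IsGaussKernel K) (hL : IsGaussKernel L) :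
    IsGaussKernel (fun k x => K k x + L k x) := by
  obtain ⟨c₁, C₁, M₁, p₁, hc₁, hC₁, h₁⟩ := hK.bound
  obtain ⟨c₂, C₂, M₂, p₂, hc₂, hC₂, h₂⟩ := hL.bound
  refine ⟨fun k hk => (hK.1 k hk).add (hL.1 k hk), min c₁ c₂, C₁ + C₂, max M₁ M₂, max p₁ p₂,
    lt_min hc₁ hc₂, fun k hk x => ?_⟩
  have hk1 : (1 : ℝ) ≤ k := by exact_mod_cast hk
  have hx1 : 1 ≤ 1 + ‖x‖ := by linarith [norm_nonneg x]
  refine (norm_add_le _ _).trans ?_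
  rw [add_mul, add_mul, add_mul]
  gcongr
  · refine (h₁ k hk x).trans ?_
    gcongr
    · exact le_max_left _ _
    · exact le_max_left _ _
    · exact min_le_left _ _
  · refine (h₂ k hk x).trans ?_
    gcongr
    · exact le_max_right _ _
    · exact le_max_right _ _
    · exact min_le_right _ _

lemma IsGaussKernel.neg {K : ℕ → ℂ × ℂ → ℂ} (hK : IsGaussKernel K) :
    IsGaussKernel (fun k x => -K k x) := by
  obtain ⟨hm, c, C, M, p, hc, h⟩ := hK
  exact ⟨fun k hk => (hm k hk).neg, c, C, M, p, hc, fun k hk x => by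
    rw [norm_neg]; exact h k hk x⟩

lemma IsLocNegl.add {K L : ℕ → ℂ × ℂ → ℂ} (hK : IsLocNegl K) (hL : IsLocNegl L) :
    IsLocNegl (fun k x => K k x + L k x) := fun N ρ => by
  obtain ⟨C, h⟩ := hK N ρ
  obtain ⟨C', h'⟩ := hL N ρ
  refine ⟨C + C', fun k hk x hx => (norm_add_le _ _).trans ?_⟩
  rw [add_mul]
  exact add_le_add (h k hk x hx) (h' k hk x hx)

/-- A kernel which is negligible on bounded sets is negligible, with its Gaussian decay, for
`z` bounded and `w` arbitrary: away from the diagonal the Gaussian is itself negligible. -/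
lemma IsLocNegl.row_bound {K : ℕ → ℂ × ℂ → ℂ} (hK : IsGaussKernel K) (hN : IsLocNegl K) :
    ∃ (c : ℝ) (p : ℕ), 0 < c ∧ ∀ (N : ℕ) (ρ : ℝ), ∃ C : ℝ, 0 ≤ C ∧ ∀ k : ℕ, 1 ≤ k → ∀ z u : ℂ,
      ‖z‖ ≤ ρ → ‖K k (z, u)‖ ≤ C * ((k : ℝ) ^ N)⁻¹ * gaussWeight p c (u - z) := by
  obtain ⟨c, C, M, p, hc, hC, h⟩ := hK.bound
  refine ⟨c / 2, p, by positivity, fun N ρ => ?_⟩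
  obtain ⟨C₁, h₁⟩ := hN N (ρ + 1)
  obtain ⟨C₂, hC₂, h₂⟩ := exists_natCast_pow_mul_exp_le (M + N) (half_pos hc)
  refine ⟨|C₁| * Real.exp (c / 2 * (2 * ρ + 1) ^ 2) + C * (1 + |ρ|) ^ p * C₂, by positivity,
    fun k hk z u hz => ?_⟩
  have hk1 : (1 : ℝ) ≤ k := by exact_mod_cast hk
  have hρ : 0 ≤ ρ := (norm_nonneg z).trans hz
  have hg : gaussWeight p (c / 2) (u - z) = (1 + ‖u - z‖) ^ p *
    Real.exp (-(c / 2) * ‖u - z‖ ^ 2) := rfl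
  rw [add_mul, add_mul]
  by_cases hu : ‖u‖ ≤ ρ + 1
  · refine le_add_of_le_of_nonneg ?_ (by rw [hg]; positivity)
    have h3 : ‖((z, u) : ℂ × ℂ)‖ ≤ ρ + 1 := max_le (by simp only; linarith) hu
    refine (h₁ k hk _ h3).trans ?_
    have h4 : 1 ≤ Real.exp (c / 2 * (2 * ρ + 1) ^ 2) * gaussWeight p (c / 2) (u - z) := by
      rw [hg, mul_left_comm, ← Real.exp_add]
      refine one_le_mul_of_one_le_of_one_le (one_le_pow₀ (by linarith [norm_nonneg (u - z)])) ?_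
      apply Real.one_le_exp
      have : ‖u - z‖ ≤ 2 * ρ + 1 := (norm_sub_le _ _).trans (by linarith)
      have : ‖u - z‖ ^ 2 ≤ (2 * ρ + 1) ^ 2 := by gcongr
      nlinarith
    calc C₁ * ((k : ℝ) ^ N)⁻¹ ≤ |C₁| * ((k : ℝ) ^ N)⁻¹ * 1 := by
          rw [mul_one]; gcongr; exact le_abs_self _
      _ ≤ |C₁| * ((k : ℝ) ^ N)⁻¹ *
          (Real.exp (c / 2 * (2 * ρ + 1) ^ 2) * gaussWeight p (c / 2) (u - z)) := by gcongr
      _ = _ := by ring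
  · refine le_add_of_nonneg_of_le (by rw [hg]; positivity) ?_
    have ht : 1 ≤ ‖u - z‖ := by
      have := norm_le_norm_add_norm_sub' u z
      linarith
    have h3 : 1 + ‖((z, u) : ℂ × ℂ)‖ ≤ (1 + |ρ|) * (1 + ‖u - z‖) := by
      refine (one_add_norm_prod_left_le z 0 u).trans ?_
      gcongr
      rw [abs_of_nonneg hρ]
      exact max_le hz (by simpa using hρ)
    have h5 : -c * k * ‖z - u‖ ^ 2 ≤ -(c / 2) * k + -(c / 2) * ‖u - z‖ ^ 2 := by
      rw [norm_sub_rev z u]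
      have e1 : 1 ≤ ‖u - z‖ ^ 2 := one_le_pow₀ ht
      have e2 : c * (k * 1) ≤ c * (k * ‖u - z‖ ^ 2) := by gcongr
      have e3 : c * (1 * ‖u - z‖ ^ 2) ≤ c * (k * ‖u - z‖ ^ 2) := by gcongr
      linarith
    calc ‖K k (z, u)‖ ≤ C * (k : ℝ) ^ M * ((1 + |ρ|) * (1 + ‖u - z‖)) ^ p *
          Real.exp (-(c / 2) * k + -(c / 2) * ‖u - z‖ ^ 2) := by
          refine (h k hk _).trans ?_
          gcongr
      _ = C * (1 + |ρ|) ^ p * ((k : ℝ) ^ (M + N) * Real.exp (-(c / 2) * k)) * ((k : ℝ) ^ N)⁻¹ *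
          gaussWeight p (c / 2) (u - z) := by
          rw [hg, Real.exp_add, pow_add, mul_pow]
          field_simp
      _ ≤ _ := by
          have := h₂ k
          have := gaussWeight_nonneg p (c / 2) (u - z)
          gcongr

lemma IsLocNegl.kcomp_left {K L : ℕ → ℂ × ℂ → ℂ} (hK : IsGaussKernel K) (hN : IsLocNegl K)
    (hL : IsGaussKernel L) : IsLocNegl (kcomp K L) := fun N ρ => by
  obtain ⟨c₂, C₂, M₂, p₂, hc₂, hC₂, h₂⟩ := hL.bound
  obtain ⟨c, p, hc, h⟩ := hN.row_bound hK
  obtain ⟨C, hC, hb⟩ := h (N + M₂) ρ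
  refine ⟨C * C₂ * (1 + ρ) ^ p₂ * ∫ y : ℂ, gaussWeight (p + p₂) c y ∂lam, fun k hk x hx => ?_⟩
  have hk1 : (1 : ℝ) ≤ k := by exact_mod_cast hk
  have hρ : 0 ≤ ρ := (norm_nonneg x).trans hx
  refine (norm_integral_le_gaussWeight lam (A := C * C₂ * (1 + ρ) ^ p₂ * ((k : ℝ) ^ N)⁻¹)
    (n := p + p₂) (x := x.1) hc fun u => ?_).trans (le_of_eq (by ring))
  rw [norm_mul]
  calc ‖K k (x.1, u)‖ * ‖L k (u, x.2)‖
      ≤ (C * ((k : ℝ) ^ (N + M₂))⁻¹ * gaussWeight p c (u - x.1)) *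
        (C₂ * (k : ℝ) ^ M₂ * ((1 + ρ) * (1 + ‖u - x.1‖)) ^ p₂ * 1) := by
        refine mul_le_mul (hb k hk _ _ ((norm_fst_le x).trans hx)) ((h₂ k hk _).trans ?_)
          (norm_nonneg _) (mul_nonneg (by positivity) (gaussWeight_nonneg _ _ _))
        gcongr
        · refine (one_add_norm_prod_right_le x.1 x.2 u).trans ?_
          gcongr
        · apply Real.exp_le_one_iff.2
          have : 0 ≤ c₂ * k * ‖u - x.2‖ ^ 2 := by positivity
          simp only
          linarith
    _ = _ := by
        simp only [gaussWeight, pow_add, mul_pow]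
        field_simp

lemma IsLocNegl.kcomp_right {K L : ℕ → ℂ × ℂ → ℂ} (hK : IsGaussKernel K)
    (hL : IsGaussKernel L) (hN : IsLocNegl L) : IsLocNegl (kcomp K L) := by
  have h := (hN.swap.kcomp_left hL.swap hK.swap).swap
  refine fun N ρ => ?_
  obtain ⟨C, hC⟩ := h N ρ
  refine ⟨C, fun k hk x hx => ?_⟩
  convert hC k hk x hx using 2
  simp only [kcomp]
  congr 1
  ext u
  simp [mul_comm]

/-- The kernel of a composition of operators is the composition of the kernels. -/
lemma HasKernel.comp {K L : ℕ → ℂ × ℂ → ℂ} (hK : IsGaussKernel K) (hL : IsGaussKernel L) {k : ℕ}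
    (hk : 1 ≤ k) {A B : schwartzSpace k →ₗ[ℂ] schwartzSpace k} (hA : HasKernel k (K k) A)
    (hB : HasKernel k (L k) B) : HasKernel k (kcomp K L k) (A ∘ₗ B) := fun φ z => by
  obtain ⟨c, C, M, p, hc, hC, h⟩ := hK.mul_bound hL
  have hφc := continuous_of_mem_bargmannSpace φ.2.1
  have hφd : RapidDecay (fun w => ((1 + ‖w‖ : ℝ) : ℂ) ^ p * φ.1 w) :=
    (rapidDecay_of_mem φ.2).mul (C := 1) (m := p) fun w => by
      rw [norm_pow, Complex.norm_real, Real.norm_of_nonneg (by positivity), one_mul]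
  have hφi := (hφd.integrable (by fun_prop)).norm
  have hint : Integrable (Function.uncurry fun u w => K k (z, u) * L k (u, w) * φ.1 w)
      (lam.prod lam) := by
    refine ((((integrable_gaussWeight lam p hc).comp_sub_right z).mul_prod hφi).const_mul
      (C * (k : ℝ) ^ M * (1 + ‖z‖) ^ p)).mono' ?_ (.of_forall fun x => ?_)
    · exact ((((hK.1 k hk).comp_measurable (by fun_prop)).mul
        ((hL.1 k hk).comp_measurable (by fun_prop))).mul
        (hφc.stronglyMeasurable.comp_measurable measurable_snd)).aestronglyMeasurable
    · simp only [Function.uncurry]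
      rw [norm_mul, norm_mul (_ ^ p), norm_pow, Complex.norm_real,
        Real.norm_of_nonneg (by positivity)]
      have h1 : 1 + ‖(z, x.2)‖ ≤ (1 + ‖z‖) * (1 + ‖x.2‖) := by
        have : ‖(z, x.2)‖ ≤ ‖z‖ + ‖x.2‖ := max_le_add_of_nonneg (norm_nonneg _) (norm_nonneg _)
        nlinarith [norm_nonneg z, norm_nonneg x.2]
      have h2 : Real.exp (-c * k * ‖z - x.2‖ ^ 2) ≤ 1 := by
        apply Real.exp_le_one_iff.2
        have : 0 ≤ c * k * ‖z - x.2‖ ^ 2 := by positivity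
        linarith
      have h3 := gaussWeight_nonneg p c (x.1 - z)
      calc _ ≤ C * (k : ℝ) ^ M * ((1 + ‖z‖) * (1 + ‖x.2‖)) ^ p * 1 * gaussWeight p c (x.1 - z) *
            ‖φ.1 x.2‖ := by
            gcongr
            refine (h k hk z x.2 x.1).trans ?_
            gcongr
        _ = _ := by rw [mul_pow]; ring
  have hcomp : ∀ w, kcomp K L k (z, w) * φ.1 w = ∫ u, K k (z, u) * L k (u, w) * φ.1 w ∂lam :=
    fun w => by rw [integral_mul_const]; rfl
  simp only [hcomp]
  refine ⟨hint.integral_prod_right, ?_⟩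
  rw [LinearMap.comp_apply, (hA (B φ) z).2, ← integral_integral_swap hint]
  congr 1
  ext u
  rw [(hB φ u).2, ← integral_const_mul]
  congr 1
  ext w
  ring

lemma HasKernel.add {k : ℕ} {K L : ℂ × ℂ → ℂ} {A B : schwartzSpace k →ₗ[ℂ] schwartzSpace k}
    (hA : HasKernel k K A) (hB : HasKernel k L B) :
    HasKernel k (fun x => K x + L x) (A + B) := fun φ z => by
  simp only [add_mul]
  refine ⟨(hA φ z).1.add (hB φ z).1, ?_⟩
  rw [integral_add (hA φ z).1 (hB φ z).1, ← (hA φ z).2, ← (hB φ z).2]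
  rfl

lemma HasKernel.neg {k : ℕ} {K : ℂ × ℂ → ℂ} {A : schwartzSpace k →ₗ[ℂ] schwartzSpace k}
    (hA : HasKernel k K A) : HasKernel k (fun x => -K x) (-A) := fun φ z => by
  simp only [neg_mul]
  refine ⟨(hA φ z).1.neg, ?_⟩
  rw [integral_neg, ← (hA φ z).2]
  rfl

lemma hasKernel_id {k : ℕ} (hk : 1 ≤ k) : HasKernel k (repKernel k) LinearMap.id := fun φ z =>
  ⟨integrable_repKernel_mul hk φ.2.1.2 z, (integral_repKernel_mul hk φ.2.1 z).symm⟩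

lemma isGaussKernel_repKernel_mul {a : ℕ → ℂ → ℂ} (ha : ∀ k, 1 ≤ k → Continuous (a k)) {C : ℝ}
    {m : ℕ} (hb : ∀ k, 1 ≤ k → ∀ z, ‖a k z‖ ≤ C * (1 + ‖z‖) ^ m) :
    IsGaussKernel (fun k x => repKernel k x * a k x.2) := by
  have hC : 0 ≤ C := by simpa using (norm_nonneg _).trans (hb 1 le_rfl 0)
  refine ⟨fun k hk => ?_, 1 / 2, C, 1, m, by norm_num, fun k hk x => ?_⟩
  · have := ha k hk
    have := continuous_repKernel k
    exact Continuous.stronglyMeasurable (by fun_prop)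
  · rw [norm_mul, norm_repKernel]
    have h1 : (k : ℝ) / (2 * Real.pi) ≤ k :=
      div_le_self (by positivity) (by linarith [Real.pi_gt_three])
    have h2 : ‖x.2‖ ≤ ‖x‖ := norm_snd_le x
    calc _ ≤ k * Real.exp (-(k / 2 : ℝ) * ‖x.1 - x.2‖ ^ 2) * (C * (1 + ‖x‖) ^ m) := by
          gcongr
          exact (hb k hk x.2).trans (by gcongr)
      _ = _ := by
        rw [show (-(k / 2 : ℝ)) = -(1 / 2) * k by ring]
        ring

lemma isGaussKernel_repKernel : IsGaussKernel repKernel := by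
  simpa using isGaussKernel_repKernel_mul (a := fun _ _ => 1) (C := 1) (m := 0)
    (fun _ _ => continuous_const) (by simp)

/-- Residual sequences have locally negligible kernels with Gaussian decay. -/
lemma IsResidual.exists_kernel {S : (k : ℕ) → schwartzSpace k →ₗ[ℂ] schwartzSpace k}
    (hS : IsResidual S) : ∃ K : ℕ → ℂ × ℂ → ℂ, IsGaussKernel K ∧ IsLocNegl K ∧
      ∀ k, 1 ≤ k → HasKernel k (K k) (S k) := by
  obtain ⟨R, C, hC, hN, hT, hK⟩ := hS
  refine ⟨_, ⟨fun k hk => ?_, ?_⟩, fun N ρ => ?_, hK⟩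
  · have := (hN.1 k hk).continuous
    exact Continuous.stronglyMeasurable (by fun_prop)
  · obtain ⟨c, M, p, h⟩ := hT 0
    refine ⟨C, c, M, p, hC, fun k hk x => ?_⟩
    rw [norm_mul, Complex.norm_real, Real.norm_of_nonneg (Real.exp_pos _).le]
    gcongr
    simpa using h k hk x
  · obtain ⟨c, h⟩ := hN.2 0 N _ (isCompact_closedBall (0 : ℂ × ℂ) ρ)
    refine ⟨c, fun k hk x hx => ?_⟩
    rw [norm_mul, Complex.norm_real, Real.norm_of_nonneg (Real.exp_pos _).le]
    have h1 : ‖R k x‖ ≤ c * ((k : ℝ) ^ N)⁻¹ := by simpa using h k hk x (by simpa using hx)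
    refine (mul_le_of_le_one_right (norm_nonneg _) (Real.exp_le_one_iff.2 ?_)).trans h1
    have : 0 ≤ C * k * ‖x.1 - x.2‖ ^ 2 := by positivity
    linarith

/-! ### Smoothing and residual operators -/

/-- Negligibility and temperateness can be checked on the functions themselves, for a class of
sequences which is stable under directional derivatives. -/
theorem isNegligible_and_isTempered_of_class (Q : (ℕ → ℂ × ℂ → ℂ) → Prop)
    (hd : ∀ f, Q f → ∀ k, 1 ≤ k → Differentiable ℝ (f k))
    (hD : ∀ f, Q f → ∀ v : ℂ × ℂ, Q (fun k x => fderiv ℝ (f k) x v))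
    (hT : ∀ f, Q f → ∃ (c : ℝ) (M p : ℕ), ∀ k : ℕ, 1 ≤ k → ∀ x : ℂ × ℂ,
      ‖f k x‖ ≤ c * (k : ℝ) ^ M * (1 + ‖x‖) ^ p)
    (hN : ∀ f, Q f → IsLocNegl f) {f : ℕ → ℂ × ℂ → ℂ} (hf : Q f) :
    IsNegligible f ∧ IsTempered f := by
  have hcn : ∀ n : ℕ, ∀ f, Q f → ∀ k, 1 ≤ k → ContDiff ℝ n (f k) := by
    intro n
    induction n with
    | zero => exact fun f hf k hk => contDiff_zero.2 (hd f hf k hk).continuous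
    | succ n ih =>
      intro f hf k hk
      push_cast
      exact contDiff_succ_iff_fderiv_apply.2 ⟨hd f hf k hk, by simp,
        fun v => ih _ (hD f hf v) k hk⟩
  have hc : ∀ f, Q f → ∀ k, 1 ≤ k → ContDiff ℝ ∞ (f k) := fun f hf k hk =>
    contDiff_infty.2 fun n => hcn n f hf k hk
  let b := Module.finBasis ℝ (ℂ × ℂ)
  obtain ⟨B, hB, hb⟩ := exists_norm_iteratedFDeriv_succ_le b
  have hneg : ∀ n : ℕ, ∀ f, Q f → ∀ (N : ℕ) (ρ : ℝ), ∃ C : ℝ, ∀ k : ℕ, 1 ≤ k → ∀ x : ℂ × ℂ,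
      ‖x‖ ≤ ρ → ‖iteratedFDeriv ℝ n (f k) x‖ ≤ C * ((k : ℝ) ^ N)⁻¹ := by
    intro n
    induction n with
    | zero => exact fun f hf N ρ => by simpa using hN f hf N ρ
    | succ n ih =>
      intro f hf N ρ
      choose C hC using fun i => ih _ (hD f hf (b i)) N ρ
      refine ⟨B * ∑ i, C i, fun k hk x hx => ((hb _ (hc f hf k hk) n x).trans ?_)⟩
      rw [mul_assoc, Finset.sum_mul]
      gcongr with i
      exact hC i k hk x hx
  have htemp : ∀ n : ℕ, ∀ f, Q f → ∃ (c : ℝ) (M p : ℕ), ∀ k : ℕ, 1 ≤ k → ∀ x : ℂ × ℂ,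
      ‖iteratedFDeriv ℝ n (f k) x‖ ≤ c * (k : ℝ) ^ M * (1 + ‖x‖) ^ p := by
    intro n
    induction n with
    | zero => exact fun f hf => by simpa using hT f hf
    | succ n ih =>
      intro f hf
      choose c M p hC using fun i => ih _ (hD f hf (b i))
      refine ⟨B * ∑ i, |c i|, ∑ i, M i, ∑ i, p i, fun k hk x =>
        ((hb _ (hc f hf k hk) n x).trans ?_)⟩
      have hk1 : (1 : ℝ) ≤ k := by exact_mod_cast hk
      have hx1 : (1 : ℝ) ≤ 1 + ‖x‖ := by linarith [norm_nonneg x]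
      rw [mul_assoc, mul_assoc, Finset.sum_mul]
      gcongr with i
      refine (hC i k hk x).trans ?_
      rw [← mul_assoc]
      gcongr
      · exact le_abs_self _
      · exact Finset.single_le_sum (f := M) (fun _ _ => Nat.zero_le _) (Finset.mem_univ i)
      · exact Finset.single_le_sum (f := p) (fun _ _ => Nat.zero_le _) (Finset.mem_univ i)
  refine ⟨⟨hc f hf, fun n N K hK => ?_⟩, fun n => htemp n f hf⟩
  obtain ⟨ρ, hρ⟩ := hK.isBounded.exists_norm_le
  obtain ⟨C, hC⟩ := hneg n f hf N ρ
  exact ⟨C, fun k hk x hx => hC k hk x (hρ x hx)⟩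

/-- The phase, divided by `k`, of `exp(ck|z-w|²) repKernel(z,u) repKernel(v,w)`, where the variable
consists of `(z,w)` and `(u,v)`. -/
def smoothPhase (c : ℝ) (x : (ℂ × ℂ) × (ℂ × ℂ)) : ℂ :=
  c * ((x.1.1 - x.1.2) * conj (x.1.1 - x.1.2)) +
    (x.1.1 * conj x.2.1 - x.1.1 * conj x.1.1 / 2 - x.2.1 * conj x.2.1 / 2) +
    (x.2.2 * conj x.1.2 - x.2.2 * conj x.2.2 / 2 - x.1.2 * conj x.1.2 / 2)

lemma temperate_fst {V W : Type*} [NormedAddCommGroup V] [NormedSpace ℝ V]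
    [NormedAddCommGroup W] [NormedSpace ℝ W] : (Prod.fst : V × W → V).HasTemperateGrowth :=
  (ContinuousLinearMap.fst ℝ V W).hasTemperateGrowth

lemma temperate_snd {V W : Type*} [NormedAddCommGroup V] [NormedSpace ℝ V]
    [NormedAddCommGroup W] [NormedSpace ℝ W] : (Prod.snd : V × W → W).HasTemperateGrowth :=
  (ContinuousLinearMap.snd ℝ V W).hasTemperateGrowth

lemma temperate_conj : (fun z : ℂ => conj z).HasTemperateGrowth :=
  Complex.conjCLE.hasTemperateGrowth

lemma temperate_smoothPhase (c : ℝ) : (smoothPhase c).HasTemperateGrowth := by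
  have h1 : (fun x : (ℂ × ℂ) × (ℂ × ℂ) => x.1.1).HasTemperateGrowth :=
    temperate_fst.comp temperate_fst
  have h2 : (fun x : (ℂ × ℂ) × (ℂ × ℂ) => x.1.2).HasTemperateGrowth :=
    temperate_snd.comp temperate_fst
  have h3 : (fun x : (ℂ × ℂ) × (ℂ × ℂ) => x.2.1).HasTemperateGrowth :=
    temperate_fst.comp temperate_snd
  have h4 : (fun x : (ℂ × ℂ) × (ℂ × ℂ) => x.2.2).HasTemperateGrowth :=
    temperate_snd.comp temperate_snd
  have h5 := temperate_conj.comp h1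
  have h6 := temperate_conj.comp h2
  have h7 := temperate_conj.comp h3
  have h8 := temperate_conj.comp h4
  have h9 := temperate_conj.comp (h1.sub h2)
  simp only [Function.comp_def] at *
  unfold smoothPhase
  simp only [div_eq_mul_inv]
  fun_prop

lemma re_smoothPhase (c : ℝ) (x y : ℂ × ℂ) : (smoothPhase c (x, y)).re =
    c * ‖x.1 - x.2‖ ^ 2 - ‖x.1 - y.1‖ ^ 2 / 2 - ‖x.2 - y.2‖ ^ 2 / 2 := by
  simp [smoothPhase, Complex.sq_norm, Complex.normSq_apply]
  ring

/-- If `c` is small, the growth of `exp(ck|z-w|²)` is absorbed by the decay of the two reproducing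
kernels and of `m`, since `|z-w| ≤ |z-u| + |u-v| + |v-w|`. -/
lemma norm_exp_smoothPhase_mul_le {c c₁ : ℝ} (hc : 0 ≤ c) (h1 : 3 * c ≤ 1 / 4) (h2 : 3 * c ≤ c₁)
    {k : ℕ} {B : ℝ} {x y : ℂ × ℂ} {m : ℂ}
    (hm : ‖m‖ ≤ B * Real.exp (-c₁ * k * ‖y.1 - y.2‖ ^ 2)) :
    ‖Complex.exp (k * smoothPhase c (x, y)) * m‖ ≤ B * Real.exp (-(k / 4 : ℝ) * ‖y - x‖ ^ 2) := by
  have hB : 0 ≤ B := by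
    by_contra! hB
    exact absurd ((norm_nonneg m).trans hm) (not_le.2 (mul_neg_of_neg_of_pos hB (Real.exp_pos _)))
  have key : c * ‖x.1 - x.2‖ ^ 2 - ‖x.1 - y.1‖ ^ 2 / 2 - ‖x.2 - y.2‖ ^ 2 / 2
      - c₁ * ‖y.1 - y.2‖ ^ 2 ≤ -(1 / 4) * ‖y - x‖ ^ 2 := by
    have ht : ‖x.1 - x.2‖ ≤ ‖x.1 - y.1‖ + ‖y.1 - y.2‖ + ‖x.2 - y.2‖ := by
      calc ‖x.1 - x.2‖ = ‖(x.1 - y.1) + (y.1 - y.2) + (y.2 - x.2)‖ := by congr 1; ring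
        _ ≤ _ := (norm_add₃_le).trans (by rw [norm_sub_rev y.2 x.2])
    have hn : ‖y - x‖ ^ 2 ≤ ‖x.1 - y.1‖ ^ 2 + ‖x.2 - y.2‖ ^ 2 := by
      rw [Prod.norm_def, Prod.fst_sub, Prod.snd_sub, norm_sub_rev y.1, norm_sub_rev y.2]
      rcases max_choice ‖x.1 - y.1‖ ‖x.2 - y.2‖ with h | h <;> rw [h] <;>
        nlinarith [sq_nonneg ‖x.1 - y.1‖, sq_nonneg ‖x.2 - y.2‖]
    generalize hd : ‖x.1 - x.2‖ = d at *
    generalize ‖x.1 - y.1‖ = a at *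
    generalize ‖x.2 - y.2‖ = b at *
    generalize ‖y.1 - y.2‖ = e at *
    have hd0 : 0 ≤ d := hd ▸ norm_nonneg _
    have e1 : d ^ 2 ≤ 3 * (a ^ 2 + e ^ 2 + b ^ 2) := by
      nlinarith [sq_nonneg (a - b), sq_nonneg (a - e), sq_nonneg (b - e)]
    have e2 : c * d ^ 2 ≤ c * (3 * (a ^ 2 + e ^ 2 + b ^ 2)) := by gcongr
    have e3 : 3 * c * (a ^ 2 + b ^ 2) ≤ 1 / 4 * (a ^ 2 + b ^ 2) := by gcongr
    have e4 : 3 * c * e ^ 2 ≤ c₁ * e ^ 2 := by gcongr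
    linarith
  rw [norm_mul, Complex.norm_exp]
  have hre : ((k : ℂ) * smoothPhase c (x, y)).re = k * (smoothPhase c (x, y)).re := by
    rw [← Complex.ofReal_natCast, Complex.re_ofReal_mul]
  rw [hre, re_smoothPhase]
  calc _ ≤ Real.exp (k * (c * ‖x.1 - x.2‖ ^ 2 - ‖x.1 - y.1‖ ^ 2 / 2 - ‖x.2 - y.2‖ ^ 2 / 2)) *
        (B * Real.exp (-c₁ * k * ‖y.1 - y.2‖ ^ 2)) := by gcongr
    _ = B * Real.exp (k * (c * ‖x.1 - x.2‖ ^ 2 - ‖x.1 - y.1‖ ^ 2 / 2 - ‖x.2 - y.2‖ ^ 2 / 2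
        - c₁ * ‖y.1 - y.2‖ ^ 2)) := by
        rw [mul_left_comm, ← Real.exp_add]; congr 2; ring
    _ ≤ B * Real.exp (k * (-(1 / 4) * ‖y - x‖ ^ 2)) := by gcongr
    _ = _ := by congr 2; ring

/-- The parametric integral `∫ p(k,x,y) exp(k q(x,y)) M_k(y) dy` whose integrand has the phase
`q = smoothPhase c`. -/
def smoothInt (M : ℕ → ℂ × ℂ → ℂ) (c : ℝ) (p : ℝ × ((ℂ × ℂ) × (ℂ × ℂ)) → ℂ) (k : ℕ)
    (x : ℂ × ℂ) : ℂ :=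
  ∫ y, p (k, (x, y)) * (Complex.exp (k * smoothPhase c (x, y)) * M k y) ∂(lam.prod lam)

/-- The amplitude of the derivative of `smoothInt M c p` in the direction `h`. -/
def smoothAmp (c : ℝ) (p : ℝ × ((ℂ × ℂ) × (ℂ × ℂ)) → ℂ) (h : ℂ × ℂ)
    (v : ℝ × ((ℂ × ℂ) × (ℂ × ℂ))) : ℂ :=
  fderiv ℝ p v (0, (h, 0)) + p v * ((v.1 : ℂ) * fderiv ℝ (smoothPhase c) v.2 (h, 0))

lemma temperate_smoothAmp (c : ℝ) {p : ℝ × ((ℂ × ℂ) × (ℂ × ℂ)) → ℂ} (hp : p.HasTemperateGrowth)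
    (h : ℂ × ℂ) : (smoothAmp c p h).HasTemperateGrowth := by
  have h1 := temperate_fderiv_apply hp (0, (h, 0))
  have h2 := (temperate_fderiv_apply (temperate_smoothPhase c) (h, 0)).comp
    (temperate_snd (V := ℝ))
  have h3 := Complex.ofRealCLM.hasTemperateGrowth.comp
    (temperate_fst (V := ℝ) (W := (ℂ × ℂ) × (ℂ × ℂ)))
  exact h1.add (hp.mul (h3.mul h2))

lemma one_add_norm_param_le {k : ℕ} (hk : 1 ≤ k) (x y : ℂ × ℂ) :
    1 + ‖((k : ℝ), (x, y))‖ ≤ 2 * k * (1 + ‖x‖) ^ 2 * (1 + ‖y - x‖) := by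
  have hk1 : (1 : ℝ) ≤ k := by exact_mod_cast hk
  have h1 := norm_le_norm_add_norm_sub' y x
  have h2 : ‖((k : ℝ), (x, y))‖ ≤ k + ‖x‖ + ‖y - x‖ := by
    refine max_le (by simp [add_assoc]; positivity) (max_le ?_ ?_) <;> simp only <;>
      linarith [norm_nonneg x, norm_nonneg (y - x)]
  have h3 : 1 + (k + ‖x‖ + ‖y - x‖) ≤ 2 * k * (1 + ‖x‖) * (1 + ‖y - x‖) := by
    have hx := norm_nonneg x
    have hy := norm_nonneg (y - x)
    have : 1 + (k + ‖x‖ + ‖y - x‖) ≤ 2 * k * (1 + ‖x‖ + ‖y - x‖) := by nlinarith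
    refine this.trans ?_
    rw [mul_assoc (2 * (k : ℝ))]
    gcongr
    nlinarith [mul_nonneg hx hy]
  have h4 : 1 + ‖x‖ ≤ (1 + ‖x‖) ^ 2 := by nlinarith [norm_nonneg x]
  calc _ ≤ 2 * k * (1 + ‖x‖) * (1 + ‖y - x‖) := by linarith
    _ ≤ _ := by gcongr

section

variable {M : ℕ → ℂ × ℂ → ℂ} {c c₁ : ℝ}

/-- The hypothesis bounds `M k` near `x` only: far from `x` a part `exp(-k‖y-x‖²/8)` of the Gaussian
in the integrand is available to compensate for its growth. -/
lemma norm_smoothInt_le (hc : 0 ≤ c) (h1 : 3 * c ≤ 1 / 4) (h2 : 3 * c ≤ c₁)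
    {p : ℝ × ((ℂ × ℂ) × (ℂ × ℂ)) → ℂ} (hp : p.HasTemperateGrowth) (q : ℕ) :
    ∃ (A : ℝ) (n : ℕ), 0 ≤ A ∧ ∀ k : ℕ, 1 ≤ k → ∀ (x : ℂ × ℂ) (B : ℝ),
      (∀ y, ‖M k y‖ * Real.exp (-(k / 8 : ℝ) * ‖y - x‖ ^ 2) ≤
        B * (1 + ‖y - x‖) ^ q * Real.exp (-c₁ * k * ‖y.1 - y.2‖ ^ 2)) →
      ‖smoothInt M c p k x‖ ≤ A * B * (k : ℝ) ^ n * (1 + ‖x‖) ^ (2 * n) := by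
  obtain ⟨n, C, hC, hn⟩ := temperate_bound hp
  refine ⟨C * 2 ^ n * ∫ y : ℂ × ℂ, gaussWeight (n + q) (1 / 8) y ∂(lam.prod lam), n,
    mul_nonneg (by positivity) (integral_nonneg fun y => gaussWeight_nonneg _ _ y),
    fun k hk x B hB => ?_⟩
  have hk1 : (1 : ℝ) ≤ k := by exact_mod_cast hk
  have h3 := norm_integral_le_gaussWeight (lam.prod lam) (x := x) (c := 1 / 8) (n := n + q)
    (A := C * 2 ^ n * B * (k : ℝ) ^ n * (1 + ‖x‖) ^ (2 * n))
    (f := fun y => p (k, (x, y)) * (Complex.exp (k * smoothPhase c (x, y)) * M k y)) (by norm_num)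
    fun y => ?_
  · refine h3.trans (le_of_eq (by ring))
  · have h4 : ‖Complex.exp (k * smoothPhase c (x, y)) * M k y‖ ≤
        B * (1 + ‖y - x‖) ^ q * Real.exp (-(1 / 8) * ‖y - x‖ ^ 2) := by
      have hm : ‖M k y‖ ≤ B * (1 + ‖y - x‖) ^ q * Real.exp (k / 8 * ‖y - x‖ ^ 2) *
          Real.exp (-c₁ * k * ‖y.1 - y.2‖ ^ 2) := by
        have := mul_le_mul_of_nonneg_right (hB y) (Real.exp_pos (k / 8 * ‖y - x‖ ^ 2)).le
        rw [mul_assoc, ← Real.exp_add] at this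
        simp only [neg_mul, neg_add_cancel, Real.exp_zero, mul_one] at this
        refine this.trans (le_of_eq ?_)
        rw [neg_mul, neg_mul]
        ring
      refine (norm_exp_smoothPhase_mul_le (x := x) hc h1 h2 hm).trans ?_
      rw [mul_assoc _ (Real.exp (k / 8 * ‖y - x‖ ^ 2)), ← Real.exp_add]
      have hB0 : 0 ≤ B * (1 + ‖y - x‖) ^ q := by
        by_contra! hB0
        have := (hB y).trans_lt (mul_neg_of_neg_of_pos hB0 (Real.exp_pos _))
        exact absurd this (not_lt.2 (by positivity))
      gcongr
      nlinarith [sq_nonneg ‖y - x‖]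
    rw [norm_mul]
    calc _ ≤ (C * (2 * k * (1 + ‖x‖) ^ 2 * (1 + ‖y - x‖)) ^ n) *
          (B * (1 + ‖y - x‖) ^ q * Real.exp (-(1 / 8) * ‖y - x‖ ^ 2)) := by
          gcongr
          refine (hn _).trans ?_
          gcongr
          exact one_add_norm_param_le hk x y
      _ = _ := by
        simp only [gaussWeight, mul_pow, pow_add, pow_mul]
        ring

lemma hasFDerivAt_smoothInt (hM : IsGaussKernel M) (hc : 0 ≤ c) (h1 : 3 * c ≤ 1 / 4)
    (h2 : 3 * c ≤ c₁) {C : ℝ} {m q : ℕ} (hb : ∀ k, 1 ≤ k → ∀ y : ℂ × ℂ,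
      ‖M k y‖ ≤ C * (k : ℝ) ^ m * (1 + ‖y‖) ^ q * Real.exp (-c₁ * k * ‖y.1 - y.2‖ ^ 2))
    {p : ℝ × ((ℂ × ℂ) × (ℂ × ℂ)) → ℂ} (hp : p.HasTemperateGrowth) {k : ℕ} (hk : 1 ≤ k)
    (x : ℂ × ℂ) :
    ∃ L : ℂ × ℂ →L[ℝ] ℂ, HasFDerivAt (smoothInt M c p k) L x ∧
      ∀ h, L h = smoothInt M c (smoothAmp c p h) k x := by
  have hk1 : (1 : ℝ) ≤ k := by exact_mod_cast hk
  have hj : ∀ v, HasFDerivAt (fun v : (ℂ × ℂ) × (ℂ × ℂ) => ((k : ℝ), v))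
      (ContinuousLinearMap.inr ℝ ℝ ((ℂ × ℂ) × (ℂ × ℂ))) v := fun v => hasFDerivAt_prodMk_right _ v
  have hpk : (fun v : (ℂ × ℂ) × (ℂ × ℂ) => p (k, v)).HasTemperateGrowth := by
    have : (fun v : (ℂ × ℂ) × (ℂ × ℂ) => ((k : ℝ), v)).HasTemperateGrowth := by
      have := (Function.HasTemperateGrowth.const (E := (ℂ × ℂ) × (ℂ × ℂ))
        ((k : ℝ), (0 : (ℂ × ℂ) × (ℂ × ℂ)))).add
        (ContinuousLinearMap.inr ℝ ℝ ((ℂ × ℂ) × (ℂ × ℂ))).hasTemperateGrowth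
      convert this using 2 with v
      ext1 <;> simp
    exact hp.comp this
  have hqk : (fun v : (ℂ × ℂ) × (ℂ × ℂ) => (k : ℂ) * smoothPhase c v).HasTemperateGrowth :=
    (Function.HasTemperateGrowth.const _).mul (temperate_smoothPhase c)
  have hdom : ∀ x' ∈ Metric.ball x 1, ∀ y : ℂ × ℂ,
      ‖Complex.exp (k * smoothPhase c (x', y)) * M k y‖ ≤
        C * (k : ℝ) ^ m * Real.exp (k / 4 * (‖x‖ + 1) ^ 2) * gaussWeight q (k / 8) y := by
    intro x' hx' y
    refine (norm_exp_smoothPhase_mul_le (x := x') hc h1 h2 (hb k hk y)).trans ?_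
    have hx1 : ‖x'‖ ≤ ‖x‖ + 1 := by
      have := norm_le_norm_add_norm_sub' x' x
      rw [Metric.mem_ball, dist_eq_norm] at hx'
      linarith
    have hC : 0 ≤ C := by simpa using (norm_nonneg _).trans (hb 1 le_rfl 0)
    have h5 : ‖y‖ ^ 2 ≤ 2 * ‖y - x'‖ ^ 2 + 2 * (‖x‖ + 1) ^ 2 := by
      have h6 := norm_le_norm_add_norm_sub' y x'
      have h7 : ‖y‖ ≤ (‖x‖ + 1) + ‖y - x'‖ := by linarith
      calc ‖y‖ ^ 2 ≤ ((‖x‖ + 1) + ‖y - x'‖) ^ 2 := by gcongr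
        _ ≤ _ := by nlinarith [sq_nonneg ((‖x‖ + 1) - ‖y - x'‖)]
    calc _ ≤ C * (k : ℝ) ^ m * (1 + ‖y‖) ^ q *
          Real.exp (k / 4 * (‖x‖ + 1) ^ 2 + -(k / 8 : ℝ) * ‖y‖ ^ 2) := by
          gcongr
          nlinarith
      _ = _ := by rw [Real.exp_add, gaussWeight]; ring
  obtain ⟨L, hL, hL'⟩ := hasFDerivAt_integral_gauss (lam.prod lam) hpk hqk
    (hM.1 k hk).aestronglyMeasurable
    (by positivity) (Metric.ball_mem_nhds x zero_lt_one) hdom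
  refine ⟨L, hL, fun h => (hL' h).trans ?_⟩
  refine integral_congr_ae (.of_forall fun y => ?_)
  simp only [smoothAmp]
  congr 2
  · have := ((temperate_differentiable hp ((k : ℝ), (x, y))).hasFDerivAt.comp _ (hj (x, y))).fderiv
    simp only [Function.comp_def] at this
    rw [this]
    rfl
  · rw [fderiv_const_mul ((temperate_differentiable (temperate_smoothPhase c)) _)]
    simp

end

/-- The geometric mean of the bound on bounded sets and of the Gaussian bound. -/
lemma IsLocNegl.gauss_bound {M : ℕ → ℂ × ℂ → ℂ} (hN : IsLocNegl M) {c C : ℝ} {m p : ℕ} (hC : 0 ≤ C)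
    (h : ∀ k, 1 ≤ k → ∀ y : ℂ × ℂ,
      ‖M k y‖ ≤ C * (k : ℝ) ^ m * (1 + ‖y‖) ^ p * Real.exp (-c * k * ‖y.1 - y.2‖ ^ 2))
    (N : ℕ) (ρ : ℝ) : ∃ B : ℝ, 0 ≤ B ∧ ∀ k, 1 ≤ k → ∀ y : ℂ × ℂ, ‖y‖ ≤ ρ →
      ‖M k y‖ ≤ B * ((k : ℝ) ^ N)⁻¹ * Real.exp (-(c / 2) * k * ‖y.1 - y.2‖ ^ 2) := by
  obtain ⟨C', h'⟩ := hN (2 * N + m) ρ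
  refine ⟨Real.sqrt (|C'| * (C * (1 + |ρ|) ^ p)), Real.sqrt_nonneg _, fun k hk y hy => ?_⟩
  have hk1 : (1 : ℝ) ≤ k := by exact_mod_cast hk
  refine abs_le_of_sq_le_sq' ?_ (by positivity) |>.2
  rw [mul_pow, mul_pow, Real.sq_sqrt (by positivity), ← Real.exp_nat_mul, sq]
  calc ‖M k y‖ * ‖M k y‖ ≤ (|C'| * ((k : ℝ) ^ (2 * N + m))⁻¹) * (C * (k : ℝ) ^ m * (1 + |ρ|) ^ p *
        Real.exp (-c * k * ‖y.1 - y.2‖ ^ 2)) := by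
        gcongr
        · exact (h' k hk y hy).trans (by gcongr; exact le_abs_self _)
        · exact (h k hk y).trans (by gcongr; exact hy.trans (le_abs_self _))
    _ = _ := by
        rw [pow_add, pow_mul']
        have he : ((2 : ℕ) : ℝ) * (-(c / 2) * k * ‖y.1 - y.2‖ ^ 2) = -c * k * ‖y.1 - y.2‖ ^ 2 := by
          push_cast; ring
        rw [he]
        field_simp

/-- Smoothing: an operator on `𝔖_k` with a negligible Gaussian kernel is residual. Composing the
kernel on both sides with the reproducing kernel makes it smooth, with controlled derivatives. -/
theorem isResidual_of_kernel {M : ℕ → ℂ × ℂ → ℂ} (hM : IsGaussKernel M) (hN : IsLocNegl M)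
    {E : (k : ℕ) → schwartzSpace k →ₗ[ℂ] schwartzSpace k}
    (hE : ∀ k, 1 ≤ k → HasKernel k (M k) (E k)) : IsResidual E := by
  obtain ⟨c₀, C, m, q, hc₀, hC, hb⟩ := hM.bound
  set c₁ := c₀ / 2 with hc₁
  have hc₁0 : 0 < c₁ := by positivity
  -- A small part `exp(-ck|z-w|²)` of the decay is split off from the smoothed kernel.
  set c := min c₁ (1 / 4) / 3 with hc
  have hc0 : 0 < c := by positivity
  have h3c : 3 * c = min c₁ (1 / 4) := by rw [hc]; ring
  have h1 : 3 * c ≤ 1 / 4 := h3c ▸ min_le_right _ _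
  have h2 : 3 * c ≤ c₁ := h3c ▸ min_le_left _ _
  have hb' : ∀ k, 1 ≤ k → ∀ y : ℂ × ℂ,
      ‖M k y‖ ≤ C * (k : ℝ) ^ m * (1 + ‖y‖) ^ q * Real.exp (-c₁ * k * ‖y.1 - y.2‖ ^ 2) := by
    refine fun k hk y => (hb k hk y).trans ?_
    gcongr
    rw [hc₁]; linarith
  -- The class stable under differentiation; the parameter `k` is a variable of the amplitude, so
  -- that the powers of `k` created by differentiating the phase stay in the class.
  let Q : (ℕ → ℂ × ℂ → ℂ) → Prop := fun f => ∃ p : ℝ × ((ℂ × ℂ) × (ℂ × ℂ)) → ℂ,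
    p.HasTemperateGrowth ∧ ∀ k, 1 ≤ k → f k = smoothInt M c p k
  let p₀ : ℝ × ((ℂ × ℂ) × (ℂ × ℂ)) → ℂ := fun v => ((v.1 : ℂ) * (2 * Real.pi : ℂ)⁻¹) ^ 2
  have hp₀ : p₀.HasTemperateGrowth := by
    have h3 : (fun v : ℝ × ((ℂ × ℂ) × (ℂ × ℂ)) => (v.1 : ℂ)).HasTemperateGrowth :=
      Complex.ofRealCLM.hasTemperateGrowth.comp temperate_fst
    exact (h3.mul (.const _)).pow 2
  have key := isNegligible_and_isTempered_of_class Q ?_ ?_ ?_ ?_ (f := smoothInt M c p₀)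
    ⟨p₀, hp₀, fun _ _ => rfl⟩
  · refine ⟨_, c, hc0, key.1, key.2, fun k hk => ?_⟩
    have h5 := HasKernel.comp isGaussKernel_repKernel (hM.kcomp isGaussKernel_repKernel) hk
      (hasKernel_id hk) (HasKernel.comp hM isGaussKernel_repKernel hk (hE k hk) (hasKernel_id hk))
    rw [LinearMap.comp_id, LinearMap.id_comp] at h5
    convert h5 using 1
    ext x
    have hint : Integrable (fun y : ℂ × ℂ => repKernel k (x.1, y.1) * (M k (y.1, y.2) *
        repKernel k (y.2, x.2))) (lam.prod lam) := by
      have := continuous_repKernel k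
      have hk1 : (0 : ℝ) < k := by exact_mod_cast hk
      refine integrable_of_le_gaussWeight (lam.prod lam) (x := x) (c := k / 2) (n := q)
        (A := (k / (2 * Real.pi)) ^ 2 * (C * (k : ℝ) ^ m * (1 + ‖x‖) ^ q)) ?_ (by positivity)
        fun y => ?_
      · exact (Continuous.aestronglyMeasurable (by fun_prop)).mul
          ((hM.1 k hk).aestronglyMeasurable.mul (Continuous.aestronglyMeasurable (by fun_prop)))
      · have hy : 1 + ‖y‖ ≤ (1 + ‖x‖) * (1 + ‖y - x‖) := by
          have := norm_le_norm_add_norm_sub' y x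
          nlinarith [norm_nonneg x, norm_nonneg (y - x)]
        have he : Real.exp (-c₁ * k * ‖y.1 - y.2‖ ^ 2) ≤ 1 := by
          apply Real.exp_le_one_iff.2
          have : 0 ≤ c₁ * k * ‖y.1 - y.2‖ ^ 2 := by positivity
          linarith
        have hn : ‖y - x‖ ^ 2 ≤ ‖x.1 - y.1‖ ^ 2 + ‖y.2 - x.2‖ ^ 2 := by
          rw [Prod.norm_def, Prod.fst_sub, Prod.snd_sub, norm_sub_rev y.1]
          rcases max_choice ‖x.1 - y.1‖ ‖y.2 - x.2‖ with h | h <;> rw [h] <;>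
            nlinarith [sq_nonneg ‖x.1 - y.1‖, sq_nonneg ‖y.2 - x.2‖]
        rw [norm_mul, norm_mul, norm_repKernel, norm_repKernel]
        calc _ ≤ k / (2 * Real.pi) * Real.exp (-(k / 2 : ℝ) * ‖x.1 - y.1‖ ^ 2) *
              ((C * (k : ℝ) ^ m * ((1 + ‖x‖) * (1 + ‖y - x‖)) ^ q * 1) *
              (k / (2 * Real.pi) * Real.exp (-(k / 2 : ℝ) * ‖y.2 - x.2‖ ^ 2))) := by
              gcongr
              exact (hb' k hk y).trans (by gcongr)
          _ = (k / (2 * Real.pi)) ^ 2 * (C * (k : ℝ) ^ m * (1 + ‖x‖) ^ q) * (1 + ‖y - x‖) ^ q *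
              Real.exp (-(k / 2 : ℝ) * (‖x.1 - y.1‖ ^ 2 + ‖y.2 - x.2‖ ^ 2)) := by
              rw [mul_add (-(k / 2 : ℝ)), Real.exp_add, mul_pow (1 + ‖x‖)]; ring
          _ ≤ (k / (2 * Real.pi)) ^ 2 * (C * (k : ℝ) ^ m * (1 + ‖x‖) ^ q) * (1 + ‖y - x‖) ^ q *
              Real.exp (-(k / 2 : ℝ) * ‖y - x‖ ^ 2) := by
              gcongr ?_ * Real.exp ?_
              nlinarith
          _ = _ := by rw [gaussWeight]; ring
    rw [kcomp]
    simp only [kcomp, ← integral_const_mul]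
    rw [integral_integral hint, smoothInt, ← integral_mul_const]
    refine integral_congr_ae (.of_forall fun y => ?_)
    simp only [p₀, repKernel, ofReal_exp_neg_sq, smoothPhase]
    have hexp : ∀ a m e₁ e₂ e₃ e₄ : ℂ, e₁ + e₂ = e₃ + e₄ →
        (a ^ 2 * (Complex.exp e₁ * m)) * Complex.exp e₂
        = a * Complex.exp e₃ * (m * (a * Complex.exp e₄)) := fun a m e₁ e₂ e₃ e₄ h => by
      calc _ = a ^ 2 * m * Complex.exp (e₁ + e₂) := by rw [Complex.exp_add]; ring
        _ = _ := by rw [h, Complex.exp_add]; ring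
    rw [← div_eq_mul_inv]
    apply hexp
    push_cast
    ring
  · rintro f ⟨p, hp, hf⟩ k hk x
    rw [hf k hk]
    obtain ⟨L, hL, -⟩ := hasFDerivAt_smoothInt hM hc0.le h1 h2 hb' hp hk x
    exact hL.differentiableAt
  · rintro f ⟨p, hp, hf⟩ v
    refine ⟨_, temperate_smoothAmp c hp v, fun k hk => ?_⟩
    ext x
    obtain ⟨L, hL, hL'⟩ := hasFDerivAt_smoothInt hM hc0.le h1 h2 hb' hp hk x
    simp only
    rw [hf k hk, hL.fderiv, hL']
  · rintro f ⟨p, hp, hf⟩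
    obtain ⟨A, n, hA, h⟩ := norm_smoothInt_le (M := M) hc0.le h1 h2 hp q
    refine ⟨A * C, m + n, q + 2 * n, fun k hk x => ?_⟩
    rw [hf k hk]
    refine (h k hk x (C * (k : ℝ) ^ m * (1 + ‖x‖) ^ q) fun y => ?_).trans (le_of_eq (by ring))
    have hy : 1 + ‖y‖ ≤ (1 + ‖x‖) * (1 + ‖y - x‖) := by
      have := norm_le_norm_add_norm_sub' y x
      nlinarith [norm_nonneg x, norm_nonneg (y - x)]
    have he : Real.exp (-(k / 8 : ℝ) * ‖y - x‖ ^ 2) ≤ 1 := by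
      apply Real.exp_le_one_iff.2
      have : 0 ≤ (k / 8 : ℝ) * ‖y - x‖ ^ 2 := by positivity
      linarith
    refine (mul_le_of_le_one_right (norm_nonneg _) he).trans ((hb' k hk y).trans ?_)
    rw [mul_assoc _ ((1 + ‖x‖) ^ q), ← mul_pow]
    gcongr
  · rintro f ⟨p, hp, hf⟩ N ρ
    obtain ⟨A, n, hA, h⟩ := norm_smoothInt_le (M := M) hc0.le h1 h2 hp q
    obtain ⟨B₁, hB₁, hB₁'⟩ := hN.gauss_bound hC hb (N + n) (ρ + 1)
    obtain ⟨B₂, hB₂, hB₂'⟩ := exists_natCast_pow_mul_exp_le (m + N + n) (c := 1 / 8) (by norm_num)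
    refine ⟨A * (B₁ + C * (1 + |ρ|) ^ q * B₂) * (1 + |ρ|) ^ (2 * n), fun k hk x hx => ?_⟩
    have hk1 : (1 : ℝ) ≤ k := by exact_mod_cast hk
    rw [hf k hk]
    have hρ : 0 ≤ ρ := (norm_nonneg _).trans hx
    have hxρ : ‖x‖ ≤ |ρ| := hx.trans (le_abs_self ρ)
    refine (h k hk x ((B₁ + C * (1 + |ρ|) ^ q * B₂) * ((k : ℝ) ^ (N + n))⁻¹) fun y => ?_).trans ?_
    · by_cases hy : ‖y‖ ≤ ρ + 1
      · have he : Real.exp (-(k / 8 : ℝ) * ‖y - x‖ ^ 2) ≤ 1 := by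
          apply Real.exp_le_one_iff.2
          have : 0 ≤ (k / 8 : ℝ) * ‖y - x‖ ^ 2 := by positivity
          linarith
        refine (mul_le_of_le_one_right (norm_nonneg _) he).trans ((hB₁' k hk y hy).trans ?_)
        refine mul_le_mul_of_nonneg_right ?_ (Real.exp_pos _).le
        have h1' : (1 : ℝ) ≤ (1 + ‖y - x‖) ^ q := one_le_pow₀ (by linarith [norm_nonneg (y - x)])
        calc B₁ * ((k : ℝ) ^ (N + n))⁻¹
            ≤ (B₁ + C * (1 + |ρ|) ^ q * B₂) * ((k : ℝ) ^ (N + n))⁻¹ * 1 := by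
              rw [mul_one]
              exact mul_le_mul_of_nonneg_right (le_add_of_nonneg_right (by positivity))
                (by positivity)
          _ ≤ _ := mul_le_mul_of_nonneg_left h1' (by positivity)
      · -- At distance at least `1` from `x`, the Gaussian `exp(-k‖y-x‖²/8)` is negligible.
        have ht : 1 ≤ ‖y - x‖ := by
          have := norm_le_norm_add_norm_sub' y x
          linarith
        have he : Real.exp (-(k / 8 : ℝ) * ‖y - x‖ ^ 2) ≤ Real.exp (-(1 / 8) * k) := by
          apply Real.exp_le_exp.2
          have : 1 ≤ ‖y - x‖ ^ 2 := one_le_pow₀ ht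
          nlinarith
        have hy' : 1 + ‖y‖ ≤ (1 + |ρ|) * (1 + ‖y - x‖) := by
          have := norm_le_norm_add_norm_sub' y x
          nlinarith [norm_nonneg x, norm_nonneg (y - x), abs_nonneg ρ]
        calc ‖M k y‖ * Real.exp (-(k / 8 : ℝ) * ‖y - x‖ ^ 2)
            ≤ (C * (k : ℝ) ^ m * ((1 + |ρ|) * (1 + ‖y - x‖)) ^ q *
              Real.exp (-c₁ * k * ‖y.1 - y.2‖ ^ 2)) * Real.exp (-(1 / 8) * k) := by
              gcongr
              refine (hb' k hk y).trans ?_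
              gcongr
          _ = C * (1 + |ρ|) ^ q * ((k : ℝ) ^ (m + N + n) * Real.exp (-(1 / 8) * k)) *
              ((k : ℝ) ^ (N + n))⁻¹ * (1 + ‖y - x‖) ^ q *
              Real.exp (-c₁ * k * ‖y.1 - y.2‖ ^ 2) := by
              rw [mul_pow, pow_add, pow_add, pow_add]
              field_simp
          _ ≤ _ := by
              have := hB₂' k
              gcongr
              exact (mul_le_mul_of_nonneg_left this (by positivity)).trans
                (le_add_of_nonneg_left hB₁)
    · calc A * ((B₁ + C * (1 + |ρ|) ^ q * B₂) * ((k : ℝ) ^ (N + n))⁻¹) * (k : ℝ) ^ n *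
            (1 + ‖x‖) ^ (2 * n)
          ≤ A * ((B₁ + C * (1 + |ρ|) ^ q * B₂) * ((k : ℝ) ^ (N + n))⁻¹) * (k : ℝ) ^ n *
            (1 + |ρ|) ^ (2 * n) := by gcongr
        _ = _ := by
          rw [pow_add]
          field_simp

/-! ### Interpolating kernels -/

lemma fderiv_eq_dz_add_dzbar (f : ℂ → ℂ) (z h : ℂ) :
    fderiv ℝ f z h = dz f z * h + dzbar f z * conj h := by
  have h1 : fderiv ℝ f z h = h.re * fderiv ℝ f z 1 + h.im * fderiv ℝ f z Complex.I := by
    have h2 : h = h.re • (1 : ℂ) + h.im • Complex.I := by simp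
    conv_lhs => rw [h2]
    rw [map_add, map_smul, map_smul, Complex.real_smul, Complex.real_smul]
  rw [h1, dz, dzbar]
  apply Complex.ext <;> simp <;> ring

lemma temperate_dz {f : ℂ → ℂ} (hf : f.HasTemperateGrowth) : (dz f).HasTemperateGrowth := by
  have h1 := temperate_fderiv_apply hf 1
  have h2 := temperate_fderiv_apply hf Complex.I
  unfold dz
  simp only [div_eq_mul_inv]
  fun_prop

lemma temperate_dzbar {f : ℂ → ℂ} (hf : f.HasTemperateGrowth) : (dzbar f).HasTemperateGrowth := by
  have h1 := temperate_fderiv_apply hf 1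
  have h2 := temperate_fderiv_apply hf Complex.I
  unfold dzbar
  simp only [div_eq_mul_inv]
  fun_prop

/-- The phase of the interpolating kernel at the points `x = (z,w)` and `v = (r,(u,s))`. -/
def interPhase (k : ℕ) (x : ℂ × ℂ) (v : ℝ × (ℂ × ℂ)) : ℂ :=
  k * (x.1 * conj v.2.1 - v.2.1 * conj v.2.1 + v.2.1 * conj x.2 - v.2.2 * conj v.2.2
    + v.1 * (v.2.2 * (conj x.2 - conj v.2.1)) - x.1 * conj x.1 * 2⁻¹ - x.2 * conj x.2 * 2⁻¹)

/-- The kernel interpolating between `Π_k f g Π_k`, at `r = 0`, and `Π_k f Π_k g Π_k`, at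
`r = 1`. In terms of Landau levels it is the kernel of `∑ₙ (1 - r²)ⁿ Π_k f Π_k⁽ⁿ⁾ g Π_k`, where
`Π_k⁽ⁿ⁾` is the projector onto the `n`-th level; the integration variable `s` is the difference of
the two integration points, divided by `r`. -/
def interKernel (k : ℕ) (f g : ℂ → ℂ) (r : ℝ) (x : ℂ × ℂ) : ℂ :=
  (k / (2 * Real.pi) : ℂ) ^ 3 *
    ∫ y, f y.1 * g (y.1 + r * y.2) * Complex.exp (interPhase k x (r, y)) ∂(lam.prod lam)

lemma temperate_interPhase (k : ℕ) (x : ℂ × ℂ) : (interPhase k x).HasTemperateGrowth := by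
  have h0 : (fun v : ℝ × (ℂ × ℂ) => (v.1 : ℂ)).HasTemperateGrowth :=
    Complex.ofRealCLM.hasTemperateGrowth.comp temperate_fst
  have h1 : (fun v : ℝ × (ℂ × ℂ) => v.2.1).HasTemperateGrowth := temperate_fst.comp temperate_snd
  have h2 : (fun v : ℝ × (ℂ × ℂ) => v.2.2).HasTemperateGrowth := temperate_snd.comp temperate_snd
  have h3 := temperate_conj.comp h1
  have h4 := temperate_conj.comp h2
  simp only [Function.comp_def] at *
  unfold interPhase
  fun_prop

lemma re_interPhase (k : ℕ) (x : ℂ × ℂ) (r : ℝ) (y : ℂ × ℂ) : (interPhase k x (r, y)).re =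
    -k * (‖x.1 - y.1‖ ^ 2 / 2 + ‖y.1 + r * y.2 - x.2‖ ^ 2 / 2 + (2 - r ^ 2) / 2 * ‖y.2‖ ^ 2) := by
  simp [interPhase, Complex.sq_norm, Complex.normSq_apply]
  ring

/-- The real part of the phase is negative definite as long as `r² < 2`; some `r > 1` are allowed so
that the derivative at `r = 1` can be taken. -/
lemma norm_exp_interPhase_le {k : ℕ} (hk : 1 ≤ k) (x : ℂ × ℂ) {r : ℝ} (hr : |r| ≤ 6 / 5)
    (y : ℂ × ℂ) : ‖Complex.exp (interPhase k x (r, y))‖ ≤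
      Real.exp (-(1 / 48) * k * ‖x.1 - x.2‖ ^ 2) *
        Real.exp (-(1 / 8) * ‖y - (x.1, 0)‖ ^ 2) := by
  have hk1 : (1 : ℝ) ≤ k := by exact_mod_cast hk
  rw [Complex.norm_exp, re_interPhase, ← Real.exp_add]
  apply Real.exp_le_exp.2
  have hr2 : r ^ 2 ≤ 36 / 25 := by
    rw [← sq_abs]
    calc |r| ^ 2 ≤ (6 / 5) ^ 2 := by gcongr
      _ = _ := by norm_num
  have ht : ‖x.1 - x.2‖ ≤ ‖x.1 - y.1‖ + ‖y.1 + r * y.2 - x.2‖ + |r| * ‖y.2‖ := by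
    calc ‖x.1 - x.2‖ = ‖(x.1 - y.1) + (y.1 + r * y.2 - x.2) + (-(r * y.2))‖ := by congr 1; ring
      _ ≤ _ := (norm_add₃_le).trans
        (by rw [norm_neg, norm_mul, Complex.norm_real, Real.norm_eq_abs])
  have hn : ‖y - (x.1, 0)‖ ^ 2 ≤ ‖x.1 - y.1‖ ^ 2 + ‖y.2‖ ^ 2 := by
    rw [Prod.norm_def, Prod.fst_sub, Prod.snd_sub, norm_sub_rev y.1, sub_zero]
    rcases max_choice ‖x.1 - y.1‖ ‖y.2‖ with h | h <;> rw [h] <;>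
      nlinarith [sq_nonneg ‖x.1 - y.1‖, sq_nonneg ‖y.2‖]
  generalize hd : ‖x.1 - x.2‖ = d at *
  generalize ‖x.1 - y.1‖ = a at *
  generalize ‖y.1 + r * y.2 - x.2‖ = b at *
  generalize ‖y.2‖ = e at *
  generalize ‖y - (x.1, 0)‖ ^ 2 = n at *
  have hd0 : 0 ≤ d := hd ▸ norm_nonneg _
  have e1 : d ^ 2 ≤ 3 * (a ^ 2 + b ^ 2 + r ^ 2 * e ^ 2) := by
    rw [← sq_abs r]
    nlinarith [sq_nonneg (a - b), sq_nonneg (a - |r| * e), sq_nonneg (b - |r| * e)]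
  have e2 : r ^ 2 * e ^ 2 ≤ 36 / 25 * e ^ 2 := by gcongr
  have e3 : n ≤ k * (a ^ 2 + e ^ 2) := by nlinarith [sq_nonneg a, sq_nonneg e]
  have e4 : (k : ℝ) * d ^ 2 ≤ k * (3 * (a ^ 2 + b ^ 2 + 36 / 25 * e ^ 2)) := by
    gcongr; linarith
  have e5 : (k : ℝ) * ((2 - 36 / 25) / 2 * e ^ 2) ≤ k * ((2 - r ^ 2) / 2 * e ^ 2) := by gcongr
  have e6 : 0 ≤ (k : ℝ) * a ^ 2 := by positivity
  have e7 : 0 ≤ (k : ℝ) * b ^ 2 := by positivity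
  have e8 : 0 ≤ (k : ℝ) * e ^ 2 := by positivity
  nlinarith

lemma norm_exp_interPhase_le' {k : ℕ} (hk : 1 ≤ k) (x : ℂ × ℂ) {r : ℝ} (hr : |r| ≤ 6 / 5)
    (y : ℂ × ℂ) : ‖Complex.exp (interPhase k x (r, y))‖ ≤
      Real.exp (1 / 8 * ‖x.1‖ ^ 2) * gaussWeight 0 (1 / 16) y := by
  refine (norm_exp_interPhase_le hk x hr y).trans ?_
  rw [gaussWeight, pow_zero, one_mul]
  have h1 : ‖y‖ ^ 2 ≤ 2 * ‖y - (x.1, 0)‖ ^ 2 + 2 * ‖x.1‖ ^ 2 := by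
    have h2 := norm_le_norm_add_norm_sub' y (x.1, 0)
    have h3 : ‖((x.1, 0) : ℂ × ℂ)‖ = ‖x.1‖ := by simp [Prod.norm_def]
    rw [h3] at h2
    calc ‖y‖ ^ 2 ≤ (‖x.1‖ + ‖y - (x.1, 0)‖) ^ 2 := by gcongr
      _ ≤ _ := by nlinarith [sq_nonneg (‖x.1‖ - ‖y - (x.1, 0)‖)]
  rw [← Real.exp_add, ← Real.exp_add]
  apply Real.exp_le_exp.2
  have : 0 ≤ (k : ℝ) * ‖x.1 - x.2‖ ^ 2 := by positivity
  linarith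

section Wirtinger

variable {P q : ℂ × ℂ → ℂ} {A A' B B' a a' b b' : ℂ × ℂ → ℂ}

/-- Stokes' formula for the partial Wirtinger derivatives on `ℂ²`. -/
lemma integral_wirtinger (hP : P.HasTemperateGrowth) (hq : q.HasTemperateGrowth) {C c : ℝ}
    (hc : 0 < c) (hb : ∀ y, ‖Complex.exp (q y)‖ ≤ C * gaussWeight 0 c y)
    (hPd : ∀ y h l, fderiv ℝ P y (h, l) = A y * h + A' y * conj h + B y * l + B' y * conj l)
    (hqd : ∀ y h l, fderiv ℝ q y (h, l) = a y * h + a' y * conj h + b y * l + b' y * conj l) :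
    (Integrable (fun y => (A y + P y * a y) * Complex.exp (q y)) (lam.prod lam) ∧
      ∫ y, (A y + P y * a y) * Complex.exp (q y) ∂(lam.prod lam) = 0) ∧
    (Integrable (fun y => (B y + P y * b y) * Complex.exp (q y)) (lam.prod lam) ∧
      ∫ y, (B y + P y * b y) * Complex.exp (q y) ∂(lam.prod lam) = 0) ∧
    (Integrable (fun y => (B' y + P y * b' y) * Complex.exp (q y)) (lam.prod lam) ∧
      ∫ y, (B' y + P y * b' y) * Complex.exp (q y) ∂(lam.prod lam) = 0) := by
  have hi : ∀ v, Integrable (fun y => (fderiv ℝ P y v + P y * fderiv ℝ q y v) *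
      Complex.exp (q y)) (lam.prod lam) := fun v =>
    integrable_temperate_mul_exp _ ((temperate_fderiv_apply hP v).add
      (hP.mul (temperate_fderiv_apply hq v))) (temperate_continuous hq) hc hb
  have h0 : ∀ v, ∫ y, (fderiv ℝ P y v + P y * fderiv ℝ q y v) *
      Complex.exp (q y) ∂(lam.prod lam) = 0 := fun v =>
    integral_fderiv_gauss _ hP hq hc hb v
  have comb : ∀ (v₁ v₂ : ℂ × ℂ) (t : ℂ) (F : ℂ × ℂ → ℂ),
      (∀ y, F y = 2⁻¹ * ((fderiv ℝ P y v₁ + P y * fderiv ℝ q y v₁) * Complex.exp (q y)) +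
        t * ((fderiv ℝ P y v₂ + P y * fderiv ℝ q y v₂) * Complex.exp (q y))) →
      Integrable F (lam.prod lam) ∧ ∫ y, F y ∂(lam.prod lam) = 0 := fun v₁ v₂ t F hF => by
    rw [show F = _ from funext hF]
    refine ⟨((hi v₁).const_mul _).add ((hi v₂).const_mul _), ?_⟩
    rw [integral_add ((hi v₁).const_mul _) ((hi v₂).const_mul _), integral_const_mul,
      integral_const_mul, h0, h0]
    simp
  have hI : Complex.I * Complex.I = -1 := Complex.I_mul_I
  refine ⟨comb (1, 0) (Complex.I, 0) (-Complex.I / 2) _ fun y => ?_,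
    comb (0, 1) (0, Complex.I) (-Complex.I / 2) _ fun y => ?_,
    comb (0, 1) (0, Complex.I) (Complex.I / 2) _ fun y => ?_⟩ <;>
  · simp only [hPd, hqd, map_zero, map_one, Complex.conj_I]
    ring_nf
    simp only [Complex.I_sq]
    ring

end Wirtinger

lemma fderiv_mul_comp {f g : ℂ → ℂ} (hf : Differentiable ℝ f) (hg : Differentiable ℝ g) (r : ℝ)
    (y : ℂ × ℂ) (h l : ℂ) :
    HasFDerivAt (fun y : ℂ × ℂ => f y.1 * g (y.1 + r * y.2))
      (fderiv ℝ (fun y : ℂ × ℂ => f y.1 * g (y.1 + r * y.2)) y) y ∧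
    fderiv ℝ (fun y : ℂ × ℂ => f y.1 * g (y.1 + r * y.2)) y (h, l) =
      (dz f y.1 * g (y.1 + r * y.2) + f y.1 * dz g (y.1 + r * y.2)) * h +
      (dzbar f y.1 * g (y.1 + r * y.2) + f y.1 * dzbar g (y.1 + r * y.2)) * conj h +
      (r * f y.1 * dz g (y.1 + r * y.2)) * l +
      (r * f y.1 * dzbar g (y.1 + r * y.2)) * conj l := by
  let L : ℂ × ℂ →L[ℝ] ℂ := ContinuousLinearMap.fst ℝ ℂ ℂ + r • ContinuousLinearMap.snd ℝ ℂ ℂ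
  have hL : ∀ y, L y = y.1 + r * y.2 := fun y => by simp [L]
  have h1 : HasFDerivAt (fun y : ℂ × ℂ => g (y.1 + r * y.2))
      ((fderiv ℝ g (y.1 + r * y.2)).comp L) y := by
    have h2 := (hg (L y)).hasFDerivAt.comp y L.hasFDerivAt
    rw [show (fun y : ℂ × ℂ => g (y.1 + r * y.2)) = g ∘ L from funext fun y => by simp [hL], ← hL y]
    exact h2
  have h3 : HasFDerivAt (fun y : ℂ × ℂ => f y.1)
      ((fderiv ℝ f y.1).comp (ContinuousLinearMap.fst ℝ ℂ ℂ)) y :=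
    (hf y.1).hasFDerivAt.comp y hasFDerivAt_fst
  have h4 := h3.mul h1
  refine ⟨h4.differentiableAt.hasFDerivAt, ?_⟩
  rw [show fderiv ℝ (fun y : ℂ × ℂ => f y.1 * g (y.1 + r * y.2)) y = _ from h4.fderiv]
  simp only [add_apply, smul_apply,
    ContinuousLinearMap.comp_apply, ContinuousLinearMap.coe_fst', smul_eq_mul, hL,
    fderiv_eq_dz_add_dzbar, map_add, map_mul, Complex.conj_ofReal]
  ring

lemma temperate_mul_comp {f g : ℂ → ℂ} (hf : f.HasTemperateGrowth) (hg : g.HasTemperateGrowth)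
    (r : ℝ) : (fun y : ℂ × ℂ => f y.1 * g (y.1 + r * y.2)).HasTemperateGrowth := by
  have h1 : (fun y : ℂ × ℂ => y.1 + (r : ℂ) * y.2).HasTemperateGrowth :=
    temperate_fst.add ((Function.HasTemperateGrowth.const _).mul temperate_snd)
  exact (hf.comp temperate_fst).mul (hg.comp h1)

/-- Integration by parts turns the `r`-derivative of the interpolating kernel into the
interpolating kernel of the differentiated symbols. -/
theorem integral_interKernel_deriv {k : ℕ} (hk : 1 ≤ k) {f g : ℂ → ℂ} (hf : f.HasTemperateGrowth)
    (hg : g.HasTemperateGrowth) {r : ℝ} (hr : |r| ≤ 6 / 5) (x : ℂ × ℂ) :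
    ∫ y, (f y.1 * (dz g (y.1 + r * y.2) * y.2 + dzbar g (y.1 + r * y.2) * conj y.2) +
      f y.1 * g (y.1 + r * y.2) * (k * (y.2 * (conj x.2 - conj y.1)))) *
        Complex.exp (interPhase k x (r, y)) ∂(lam.prod lam) =
    -(2 * r / k) * ∫ y, dz f y.1 * dzbar g (y.1 + r * y.2) *
        Complex.exp (interPhase k x (r, y)) ∂(lam.prod lam) := by
  have hk0 : (k : ℂ) ≠ 0 := by exact_mod_cast (by omega : k ≠ 0)
  let q : ℂ × ℂ → ℂ := fun y => interPhase k x (r, y)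
  have hq : q.HasTemperateGrowth := by
    have : (fun v : ℂ × ℂ => (r, v)).HasTemperateGrowth := by
      have := (Function.HasTemperateGrowth.const (E := ℂ × ℂ) (r, (0 : ℂ × ℂ))).add
        (ContinuousLinearMap.inr ℝ ℝ (ℂ × ℂ)).hasTemperateGrowth
      convert this using 2 with v
      ext1 <;> simp
    exact (temperate_interPhase k x).comp this
  have hb : ∀ y, ‖Complex.exp (q y)‖ ≤ Real.exp (1 / 8 * ‖x.1‖ ^ 2) * gaussWeight 0 (1 / 16) y :=
    norm_exp_interPhase_le' hk x hr
  have hqd : ∀ y h l, fderiv ℝ q y (h, l) = (k * (conj x.2 - conj y.1)) * h +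
      (k * (x.1 - y.1 - r * y.2)) * conj h +
      (k * (-conj y.2 + r * (conj x.2 - conj y.1))) * l + (-(k * y.2)) * conj l := by
    intro y h l
    have h1 : HasFDerivAt (fun y : ℂ × ℂ => y.1) (ContinuousLinearMap.fst ℝ ℂ ℂ) y :=
      hasFDerivAt_fst
    have h2 : HasFDerivAt (fun y : ℂ × ℂ => y.2) (ContinuousLinearMap.snd ℝ ℂ ℂ) y :=
      hasFDerivAt_snd
    have h3 : HasFDerivAt (fun y : ℂ × ℂ => conj y.1)
        ((Complex.conjCLE : ℂ →L[ℝ] ℂ).comp (ContinuousLinearMap.fst ℝ ℂ ℂ)) y :=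
      (Complex.conjCLE : ℂ →L[ℝ] ℂ).hasFDerivAt.comp y h1
    have h4 : HasFDerivAt (fun y : ℂ × ℂ => conj y.2)
        ((Complex.conjCLE : ℂ →L[ℝ] ℂ).comp (ContinuousLinearMap.snd ℝ ℂ ℂ)) y :=
      (Complex.conjCLE : ℂ →L[ℝ] ℂ).hasFDerivAt.comp y h2
    have h5 := (((((((h3.const_mul x.1).sub (h1.mul h3)).add (h1.mul_const (conj x.2))).sub
      (h2.mul h4)).add ((h2.mul (h3.const_sub (conj x.2))).const_mul (r : ℂ))).sub_const
      (x.1 * conj x.1 * 2⁻¹)).sub_const (x.2 * conj x.2 * 2⁻¹)).const_mul (k : ℂ)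
    rw [show fderiv ℝ q y = _ from h5.fderiv]
    simp
    ring
  have hcomp := fun {F G : ℂ → ℂ} (hF : F.HasTemperateGrowth) (hG : G.HasTemperateGrowth) =>
    integral_wirtinger (temperate_mul_comp hF hG r) hq (by norm_num) hb
      (fun y h l => (fderiv_mul_comp (temperate_differentiable hF) (temperate_differentiable hG) r
        y h l).2) hqd
  -- With `E` the exponential, the difference of the two sides is the combination
  -- `∂_u (s f g E) + k⁻¹ ∂_s̄ ((∂f) g E) - k⁻¹ ∂_s (f (∂̄g) E) + (r/k) ∂_u (f (∂̄g) E)`.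
  have hP1 : (fun y : ℂ × ℂ => y.2 * (f y.1 * g (y.1 + r * y.2))).HasTemperateGrowth :=
    temperate_snd.mul (temperate_mul_comp hf hg r)
  have e1 := (integral_wirtinger hP1 hq (by norm_num) hb
    (A := fun y => y.2 * (dz f y.1 * g (y.1 + r * y.2) + f y.1 * dz g (y.1 + r * y.2)))
    (A' := fun y => y.2 * (dzbar f y.1 * g (y.1 + r * y.2) + f y.1 * dzbar g (y.1 + r * y.2)))
    (B := fun y => f y.1 * g (y.1 + r * y.2) + y.2 * (r * f y.1 * dz g (y.1 + r * y.2)))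
    (B' := fun y => y.2 * (r * f y.1 * dzbar g (y.1 + r * y.2)))
    (fun y h l => by
      have h2 : HasFDerivAt (fun y : ℂ × ℂ => y.2) (ContinuousLinearMap.snd ℝ ℂ ℂ) y :=
        hasFDerivAt_snd
      obtain ⟨h3, h4⟩ := fderiv_mul_comp (temperate_differentiable hf)
        (temperate_differentiable hg) r y h l
      rw [show fderiv ℝ (fun y : ℂ × ℂ => y.2 * (f y.1 * g (y.1 + r * y.2))) y = _ from
        (h2.mul h3).fderiv]
      simp only [add_apply, smul_apply, smul_eq_mul,
        ContinuousLinearMap.coe_snd']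
      rw [h4]
      ring) hqd).1
  have e2 := (hcomp (temperate_dz hf) hg).2.2
  have e3 := (hcomp hf (temperate_dzbar hg)).2.1
  have e4 := (hcomp hf (temperate_dzbar hg)).1
  have e5 : Integrable (fun y : ℂ × ℂ => dz f y.1 * dzbar g (y.1 + r * y.2) *
      Complex.exp (q y)) (lam.prod lam) :=
    integrable_temperate_mul_exp _ (temperate_mul_comp (temperate_dz hf) (temperate_dzbar hg) r)
      (temperate_continuous hq) (by norm_num) hb
  have comb : ∀ {F G : ℂ × ℂ → ℂ} (c : ℂ),
      Integrable F (lam.prod lam) ∧ ∫ y, F y ∂(lam.prod lam) = 0 →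
      Integrable G (lam.prod lam) ∧ ∫ y, G y ∂(lam.prod lam) = 0 →
      Integrable (fun y => F y + c * G y) (lam.prod lam) ∧
        ∫ y, (F y + c * G y) ∂(lam.prod lam) = 0 := fun {F G} c hF hG => by
    refine ⟨hF.1.add (hG.1.const_mul c), ?_⟩
    rw [integral_add hF.1 (hG.1.const_mul c), integral_const_mul, hF.2, hG.2, mul_zero, add_zero]
  have hsum := comb (r / k : ℂ) (comb (-(k : ℂ)⁻¹) (comb (k : ℂ)⁻¹ e1 e2) e3) e4
  have hfin := integral_add hsum.1 (e5.const_mul (-(2 * r / k) : ℂ))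
  rw [hsum.2, zero_add, integral_const_mul] at hfin
  rw [← hfin]
  refine integral_congr_ae (.of_forall fun y => ?_)
  simp only [q]
  field_simp
  ring

/-! ### The Taylor expansion of the interpolating kernels -/

/-- The interpolating kernels satisfy a closed differential equation in `r`. -/
theorem hasDerivAt_interKernel {k : ℕ} (hk : 1 ≤ k) {f g : ℂ → ℂ} (hf : f.HasTemperateGrowth)
    (hg : g.HasTemperateGrowth) {r : ℝ} (hr : |r| < 6 / 5) (x : ℂ × ℂ) :
    HasDerivAt (fun r => interKernel k f g r x)
      (-(2 * r / k) * interKernel k (dz f) (dzbar g) r x) r := by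
  have hshift : (fun v : ℝ × (ℂ × ℂ) => v.2.1 + (v.1 : ℂ) * v.2.2).HasTemperateGrowth :=
    (temperate_fst.comp temperate_snd).add
      ((Complex.ofRealCLM.hasTemperateGrowth.comp temperate_fst).mul
        (temperate_snd.comp temperate_snd))
  have hp : (fun v : ℝ × (ℂ × ℂ) => f v.2.1 * g (v.2.1 + v.1 * v.2.2)).HasTemperateGrowth :=
    (hf.comp (temperate_fst.comp temperate_snd)).mul (hg.comp hshift)
  have hU : {r : ℝ | |r| < 6 / 5} ∈ nhds r :=
    (isOpen_lt continuous_abs continuous_const).mem_nhds hr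
  have hdom : ∀ r' ∈ {r : ℝ | |r| < 6 / 5}, ∀ y : ℂ × ℂ,
      ‖Complex.exp (interPhase k x (r', y)) * (fun _ => 1 : ℂ × ℂ → ℂ) y‖ ≤
        Real.exp (1 / 8 * ‖x.1‖ ^ 2) * gaussWeight 0 (1 / 16) y := fun r' hr' y => by
    rw [mul_one]; exact norm_exp_interPhase_le' hk x (le_of_lt hr') y
  obtain ⟨L, hL, hL'⟩ := hasFDerivAt_integral_gauss (lam.prod lam) hp (temperate_interPhase k x)
    (M := fun _ => 1) aestronglyMeasurable_const (by norm_num) hU hdom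
  simp only [mul_one] at hL hL'
  have h1 := hL.hasDerivAt.const_mul ((k / (2 * Real.pi) : ℂ) ^ 3)
  refine h1.congr_deriv ?_
  rw [hL', interKernel, mul_left_comm, ← integral_interKernel_deriv hk hf hg hr.le x]
  congr 1
  refine integral_congr_ae (.of_forall fun y => ?_)
  simp only
  congr 2
  · -- the derivative of the amplitude
    have h2 : HasFDerivAt (fun v : ℝ × (ℂ × ℂ) => f v.2.1)
        ((fderiv ℝ f y.1).comp ((ContinuousLinearMap.fst ℝ ℂ ℂ).comp
          (ContinuousLinearMap.snd ℝ ℝ (ℂ × ℂ)))) (r, y) :=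
      (temperate_differentiable hf y.1).hasFDerivAt.comp (r, y)
        (hasFDerivAt_fst.comp (r, y) hasFDerivAt_snd)
    have h3 : HasFDerivAt (fun v : ℝ × (ℂ × ℂ) => v.2.1 + (v.1 : ℂ) * v.2.2) _ (r, y) :=
      (hasFDerivAt_fst.comp (r, y) hasFDerivAt_snd).add
        ((Complex.ofRealCLM.hasFDerivAt.comp (r, y) hasFDerivAt_fst).mul
          (hasFDerivAt_snd.comp (r, y) hasFDerivAt_snd))
    have h4 : HasFDerivAt (fun v : ℝ × (ℂ × ℂ) => g (v.2.1 + (v.1 : ℂ) * v.2.2)) _ (r, y) :=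
      (temperate_differentiable hg (y.1 + r * y.2)).hasFDerivAt.comp (r, y) h3
    rw [show fderiv ℝ (fun v : ℝ × (ℂ × ℂ) => f v.2.1 * g (v.2.1 + v.1 * v.2.2)) (r, y) = _ from
      (h2.mul h4).fderiv]
    simp [fderiv_eq_dz_add_dzbar]
  · -- the derivative of the phase
    have h5 : HasDerivAt (fun t : ℝ => interPhase k x (t, y))
        (k * (y.2 * (conj x.2 - conj y.1))) r := by
      have h6 := ((((((hasDerivAt_id r).ofReal_comp.mul_const
        (y.2 * (conj x.2 - conj y.1))).const_add (x.1 * conj y.1 - y.1 * conj y.1 +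
          y.1 * conj x.2 - y.2 * conj y.2)).sub_const (x.1 * conj x.1 * 2⁻¹)).sub_const
          (x.2 * conj x.2 * 2⁻¹)).const_mul (k : ℂ))
      simpa [interPhase] using h6
    have h7 := (temperate_differentiable (temperate_interPhase k x) (r, y)).hasFDerivAt.comp r
      (hasFDerivAt_prodMk_left (𝕜 := ℝ) r y)
    exact congrArg (f y.1 * g (y.1 + r * y.2) * ·) (h7.hasDerivAt.unique h5)

lemma norm_interKernel_le (m n : ℕ) : ∃ A : ℝ, 0 ≤ A ∧ ∀ (k : ℕ), 1 ≤ k → ∀ (f g : ℂ → ℂ)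
    (Cf Cg : ℝ), (∀ u, ‖f u‖ ≤ Cf * (1 + ‖u‖) ^ m) → (∀ u, ‖g u‖ ≤ Cg * (1 + ‖u‖) ^ n) →
    ∀ r ∈ Set.Icc (0 : ℝ) 1, ∀ x : ℂ × ℂ, ‖interKernel k f g r x‖ ≤
      A * Cf * Cg * (k : ℝ) ^ 3 * (1 + ‖x‖) ^ (m + n) *
        Real.exp (-(1 / 48) * k * ‖x.1 - x.2‖ ^ 2) := by
  refine ⟨2 ^ n * ∫ y : ℂ × ℂ, gaussWeight (m + n) (1 / 8) y ∂(lam.prod lam),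
    mul_nonneg (by positivity) (integral_nonneg fun y => gaussWeight_nonneg _ _ y),
    fun k hk f g Cf Cg hf hg r hr x => ?_⟩
  have hCf : 0 ≤ Cf := by simpa using (norm_nonneg _).trans (hf 0)
  have hCg : 0 ≤ Cg := by simpa using (norm_nonneg _).trans (hg 0)
  have h1 := norm_integral_le_gaussWeight (lam.prod lam) (x := (x.1, 0)) (c := 1 / 8)
    (n := m + n) (A := 2 ^ n * Cf * Cg * (1 + ‖x‖) ^ (m + n) *
      Real.exp (-(1 / 48) * k * ‖x.1 - x.2‖ ^ 2))
    (f := fun y => f y.1 * g (y.1 + r * y.2) * Complex.exp (interPhase k x (r, y)))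
    (by norm_num) fun y => ?_
  · rw [interKernel, norm_mul, norm_pow]
    have h2 : ‖(k / (2 * Real.pi) : ℂ)‖ ≤ k := by
      rw [norm_div, Complex.norm_natCast]
      refine div_le_self (by positivity) ?_
      simp [abs_of_pos Real.pi_pos]
      linarith [Real.pi_gt_three]
    calc _ ≤ (k : ℝ) ^ 3 * _ := mul_le_mul (by gcongr) h1 (norm_nonneg _) (by positivity)
      _ = _ := by ring
  · rw [norm_mul, norm_mul]
    set t := ‖y - (x.1, 0)‖ with ht
    have ht1 : ‖y.1 - x.1‖ ≤ t := norm_fst_le (y - (x.1, 0))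
    have ht2 : ‖y.2‖ ≤ t := by simpa using norm_snd_le (y - (x.1, (0 : ℂ)))
    have hx1 : ‖x.1‖ ≤ ‖x‖ := norm_fst_le x
    have ht0 : 0 ≤ t := norm_nonneg _
    have hx0 := norm_nonneg x
    have hu : 1 + ‖y.1‖ ≤ (1 + ‖x‖) * (1 + t) := by
      have := norm_le_norm_add_norm_sub' y.1 x.1
      nlinarith
    have hv : 1 + ‖y.1 + r * y.2‖ ≤ 2 * ((1 + ‖x‖) * (1 + t)) := by
      have h3 := norm_le_norm_add_norm_sub' y.1 x.1
      have h4 : ‖y.1 + r * y.2‖ ≤ ‖y.1‖ + ‖y.2‖ := by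
        refine (norm_add_le _ _).trans ?_
        gcongr
        rw [norm_mul, Complex.norm_real, Real.norm_of_nonneg hr.1]
        exact mul_le_of_le_one_left (norm_nonneg _) hr.2
      nlinarith
    calc _ ≤ (Cf * ((1 + ‖x‖) * (1 + t)) ^ m) * (Cg * (2 * ((1 + ‖x‖) * (1 + t))) ^ n) *
          (Real.exp (-(1 / 48) * k * ‖x.1 - x.2‖ ^ 2) * Real.exp (-(1 / 8) * t ^ 2)) := by
          have h5 := norm_exp_interPhase_le hk x (r := r)
            (by rw [abs_of_nonneg hr.1]; linarith [hr.2]) y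
          gcongr
          · exact (hf _).trans (by gcongr)
          · exact (hg _).trans (by gcongr)
      _ = _ := by
        simp only [gaussWeight, mul_pow, pow_add, ← ht]
        ring

/-- The kernel of `Π_k h Π_k`. -/
def toepKernel (k : ℕ) (h : ℂ → ℂ) (x : ℂ × ℂ) : ℂ :=
  ∫ u, repKernel k (x.1, u) * h u * repKernel k (u, x.2) ∂lam

lemma interKernel_zero {k : ℕ} (hk : 1 ≤ k) (f g : ℂ → ℂ) (x : ℂ × ℂ) :
    interKernel k f g 0 x = toepKernel k (fun u => f u * g u) x := by
  have hk0 : (0 : ℝ) < k := by exact_mod_cast hk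
  have h1 : ∀ y : ℂ × ℂ, f y.1 * g (y.1 + (0 : ℝ) * y.2) * Complex.exp (interPhase k x (0, y)) =
      (f y.1 * g y.1 * Complex.exp (k * (x.1 * conj y.1 - y.1 * conj y.1 + y.1 * conj x.2 -
        x.1 * conj x.1 * 2⁻¹ - x.2 * conj x.2 * 2⁻¹))) * (Real.exp (-k * ‖y.2‖ ^ 2) : ℂ) := by
    intro y
    rw [ofReal_exp_neg_sq, mul_assoc (f y.1 * g y.1), ← Complex.exp_add]
    congr 2
    · simp
    · simp only [interPhase]
      push_cast
      ring
  rw [interKernel, toepKernel]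
  simp only [h1]
  rw [integral_prod_mul (fun u : ℂ => f u * g u * Complex.exp (k * (x.1 * conj u - u * conj u +
      u * conj x.2 - x.1 * conj x.1 * 2⁻¹ - x.2 * conj x.2 * 2⁻¹)))
      (fun s : ℂ => (Real.exp (-k * ‖s‖ ^ 2) : ℂ)), integral_complex_ofReal,
    integral_exp_neg_mul_sq_lam hk0,
    ← integral_mul_const, ← integral_const_mul]
  refine integral_congr_ae (.of_forall fun u => ?_)
  have hpi : (Real.pi : ℂ) ≠ 0 := by exact_mod_cast Real.pi_pos.ne'
  have hk1 : (k : ℂ) ≠ 0 := by exact_mod_cast hk0.ne'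
  have h2 : ∀ a e e₁ e₂ : ℂ, e = e₁ + e₂ → (k / (2 * Real.pi) : ℂ) ^ 3 *
      (a * Complex.exp e * ((2 * Real.pi / k : ℝ) : ℂ)) =
      (k / (2 * Real.pi) : ℂ) * Complex.exp e₁ * a * ((k / (2 * Real.pi) : ℂ) * Complex.exp e₂) :=
    fun a e e₁ e₂ h => by
      rw [h, Complex.exp_add]
      push_cast
      field_simp
  simp only [repKernel]
  apply h2
  ring

lemma interKernel_one {k : ℕ} (hk : 1 ≤ k) {f g : ℂ → ℂ} (hf : f.HasTemperateGrowth)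
    (hg : g.HasTemperateGrowth) (x : ℂ × ℂ) : interKernel k f g 1 x =
      ∫ u, repKernel k (x.1, u) * f u *
        ∫ v, repKernel k (u, v) * g v * repKernel k (v, x.2) ∂lam ∂lam := by
  have hint : Integrable (fun y : ℂ × ℂ => f y.1 * g (y.1 + (1 : ℝ) * y.2) *
      Complex.exp (interPhase k x (1, y))) (lam.prod lam) := by
    refine integrable_temperate_mul_exp _ (temperate_mul_comp hf hg 1) ?_ (by norm_num)
      (norm_exp_interPhase_le' hk x (by norm_num))
    have := temperate_continuous (temperate_interPhase k x)
    fun_prop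
  rw [interKernel, integral_prod _ hint, ← integral_const_mul]
  refine integral_congr_ae (.of_forall fun u => ?_)
  simp only
  rw [← integral_add_right_eq_self (fun v => repKernel k (u, v) * g v * repKernel k (v, x.2)) u,
    ← integral_const_mul, ← integral_const_mul]
  refine integral_congr_ae (.of_forall fun s => ?_)
  have h2 : ∀ a b e e₁ e₂ e₃ : ℂ, e = e₁ + e₂ + e₃ → (k / (2 * Real.pi) : ℂ) ^ 3 *
      (a * b * Complex.exp e) = (k / (2 * Real.pi) : ℂ) * Complex.exp e₁ * a *
      ((k / (2 * Real.pi) : ℂ) * Complex.exp e₂ * b * ((k / (2 * Real.pi) : ℂ) * Complex.exp e₃)) :=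
    fun a b e e₁ e₂ e₃ h => by
      rw [h, Complex.exp_add, Complex.exp_add]
      ring
  simp only [repKernel, Complex.ofReal_one, one_mul, add_comm s u]
  apply h2
  simp only [interPhase, map_add, Complex.ofReal_one]
  ring

/-- The expansion of the interpolating kernel in powers of `r²/k`, with remainder. At `r = 1` it
expresses `Π_k f Π_k g Π_k` through the operators `Π_k (∂ⁿf)(∂̄ⁿg) Π_k`. -/
theorem interKernel_expansion {k : ℕ} (hk : 1 ≤ k) (x : ℂ × ℂ) (N : ℕ) :
    ∀ {f g : ℂ → ℂ}, f.HasTemperateGrowth → g.HasTemperateGrowth → ∀ {B : ℝ},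
    (∀ r ∈ Set.Icc (0 : ℝ) 1, ‖interKernel k (dz^[N] f) (dzbar^[N] g) r x‖ ≤ B) →
    ∀ r ∈ Set.Icc (0 : ℝ) 1, ‖interKernel k f g r x - ∑ n ∈ Finset.range N,
      (-1 : ℂ) ^ n / (n.factorial : ℂ) * ((r : ℂ) ^ 2 / k) ^ n *
        interKernel k (dz^[n] f) (dzbar^[n] g) 0 x‖ ≤ (2 / k) ^ N * B := by
  have hk0 : (k : ℂ) ≠ 0 := by exact_mod_cast (by omega : k ≠ 0)
  induction N with
  | zero => intro f g hf hg B hB r hr; simpa using hB r hr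
  | succ N ih =>
    intro f g hf hg B hB
    set H : ℝ → ℂ := fun r => interKernel k f g r x - ∑ n ∈ Finset.range (N + 1),
      (-1 : ℂ) ^ n / (n.factorial : ℂ) * ((r : ℂ) ^ 2 / k) ^ n *
        interKernel k (dz^[n] f) (dzbar^[n] g) 0 x with hH
    set H' : ℝ → ℂ := fun r => -(2 * r / k) * (interKernel k (dz f) (dzbar g) r x -
      ∑ n ∈ Finset.range N, (-1 : ℂ) ^ n / (n.factorial : ℂ) * ((r : ℂ) ^ 2 / k) ^ n *
        interKernel k (dz^[n] (dz f)) (dzbar^[n] (dzbar g)) 0 x) with hH'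
    have hder : ∀ r ∈ Set.Icc (0 : ℝ) 1, HasDerivWithinAt H (H' r) (Set.Icc 0 1) r := by
      intro r hr
      have h1 := hasDerivAt_interKernel hk hf hg (r := r)
        (by rw [abs_of_nonneg hr.1]; linarith [hr.2]) x
      have h2 : HasDerivAt (fun r : ℝ => (r : ℂ) ^ 2 / k) (2 * r / k) r := by
        have := ((hasDerivAt_id r).ofReal_comp.pow 2).div_const (k : ℂ)
        simpa using this
      have h3 : HasDerivAt (fun r : ℝ => ∑ n ∈ Finset.range (N + 1),
          (-1 : ℂ) ^ n / (n.factorial : ℂ) * ((r : ℂ) ^ 2 / k) ^ n *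
            interKernel k (dz^[n] f) (dzbar^[n] g) 0 x) (∑ n ∈ Finset.range (N + 1),
          (-1 : ℂ) ^ n / (n.factorial : ℂ) * (n * ((r : ℂ) ^ 2 / k) ^ (n - 1) * (2 * r / k)) *
            interKernel k (dz^[n] f) (dzbar^[n] g) 0 x) r :=
        HasDerivAt.fun_sum fun n _ => ((h2.pow n).const_mul _).mul_const _
      refine ((h1.sub h3).congr_deriv ?_).hasDerivWithinAt
      rw [Finset.sum_range_succ', hH']
      simp only [mul_sub, Finset.mul_sum, Nat.cast_zero, zero_mul, mul_zero, add_zero]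
      congr 1
      refine Finset.sum_congr rfl fun n _ => ?_
      simp only [← Function.iterate_succ_apply, Nat.add_sub_cancel, Nat.factorial_succ]
      have : (n.factorial : ℂ) ≠ 0 := by exact_mod_cast n.factorial_ne_zero
      have : (n + 1 : ℂ) ≠ 0 := by exact_mod_cast n.succ_ne_zero
      push_cast
      field_simp
      ring
    have hH0 : H 0 = 0 := by
      simp only [hH]
      rw [Finset.sum_range_succ']
      simp
    have hbound : ∀ r ∈ Set.Ico (0 : ℝ) 1, ‖H' r‖ ≤ (2 / k) ^ (N + 1) * B := by
      intro r hr
      have h4 := ih (temperate_dz hf) (temperate_dzbar hg)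
        (fun r hr => by simpa only [← Function.iterate_succ_apply] using hB r hr) r
        ⟨hr.1, hr.2.le⟩
      rw [hH', norm_mul, pow_succ' (2 / (k : ℝ)), mul_assoc (2 / (k : ℝ))]
      refine mul_le_mul ?_ h4 (norm_nonneg _) (by positivity)
      rw [norm_neg, norm_div, norm_mul, Complex.norm_natCast, Complex.norm_real,
        Real.norm_of_nonneg hr.1, Complex.norm_two]
      gcongr
      linarith [hr.2]
    intro r hr
    have h5 := norm_image_sub_le_of_norm_deriv_le_segment' hder hbound r hr
    rw [hH0, sub_zero, sub_zero] at h5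
    have hB0 : 0 ≤ (2 / k : ℝ) ^ (N + 1) * B :=
      mul_nonneg (by positivity) ((norm_nonneg _).trans (hB 0 (by simp)))
    exact h5.trans (mul_le_of_le_one_right hB0 hr.2)

/-! ### Wirtinger calculus and symbol classes -/

lemma contDiff_dz {f : ℂ → ℂ} (hf : ContDiff ℝ ∞ f) : ContDiff ℝ ∞ (dz f) := by
  have h : ∀ v : ℂ, ContDiff ℝ ∞ (fun z => fderiv ℝ f z v) := fun v =>
    (hf.fderiv_right (by simp)).clm_apply contDiff_const
  exact ((h 1).sub (contDiff_const.mul (h Complex.I))).div_const 2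

lemma contDiff_dzbar {f : ℂ → ℂ} (hf : ContDiff ℝ ∞ f) : ContDiff ℝ ∞ (dzbar f) := by
  have h : ∀ v : ℂ, ContDiff ℝ ∞ (fun z => fderiv ℝ f z v) := fun v =>
    (hf.fderiv_right (by simp)).clm_apply contDiff_const
  exact ((h 1).add (contDiff_const.mul (h Complex.I))).div_const 2

lemma contDiff_iterate {D : (ℂ → ℂ) → ℂ → ℂ}
    (hD : ∀ {f : ℂ → ℂ}, ContDiff ℝ ∞ f → ContDiff ℝ ∞ (D f)) {f : ℂ → ℂ}
    (hf : ContDiff ℝ ∞ f) (n : ℕ) : ContDiff ℝ ∞ (D^[n] f) := by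
  induction n generalizing f with
  | zero => exact hf
  | succ n ih => exact ih (hD hf)

section WirtingerCalculus

variable {f g : ℂ → ℂ}

lemma dz_add (hf : Differentiable ℝ f) (hg : Differentiable ℝ g) :
    dz (fun z => f z + g z) = fun z => dz f z + dz g z := by
  ext z
  simp only [dz, fderiv_fun_add (hf z) (hg z), add_apply]
  ring

lemma dzbar_add (hf : Differentiable ℝ f) (hg : Differentiable ℝ g) :
    dzbar (fun z => f z + g z) = fun z => dzbar f z + dzbar g z := by
  ext z
  simp only [dzbar, fderiv_fun_add (hf z) (hg z), add_apply]
  ring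

lemma dz_mul (hf : Differentiable ℝ f) (hg : Differentiable ℝ g) :
    dz (fun z => f z * g z) = fun z => dz f z * g z + f z * dz g z := by
  ext z
  simp only [dz, fderiv_fun_mul (hf z) (hg z), add_apply, smul_apply, smul_eq_mul]
  ring

lemma dzbar_mul (hf : Differentiable ℝ f) (hg : Differentiable ℝ g) :
    dzbar (fun z => f z * g z) = fun z => dzbar f z * g z + f z * dzbar g z := by
  ext z
  simp only [dzbar, fderiv_fun_mul (hf z) (hg z), add_apply, smul_apply, smul_eq_mul]
  ring

lemma dz_const_mul (c : ℂ) (hf : Differentiable ℝ f) :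
    dz (fun z => c * f z) = fun z => c * dz f z := by
  ext z
  simp only [dz, fderiv_const_mul (hf z), smul_apply, smul_eq_mul]
  ring

lemma dzbar_const_mul (c : ℂ) (hf : Differentiable ℝ f) :
    dzbar (fun z => c * f z) = fun z => c * dzbar f z := by
  ext z
  simp only [dzbar, fderiv_const_mul (hf z), smul_apply, smul_eq_mul]
  ring

/-- The Wirtinger derivatives commute. -/
lemma dz_dzbar_comm (hf : ContDiff ℝ ∞ f) : dz (dzbar f) = dzbar (dz f) := by
  ext z
  have hd : DifferentiableAt ℝ (fderiv ℝ f) z :=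
    ((hf.fderiv_right (m := ∞) (by simp)).differentiable (by simp)) z
  have h1 : ∀ v h, fderiv ℝ (fun z => fderiv ℝ f z v) z h = fderiv ℝ (fderiv ℝ f) z h v :=
    fun v h => by
      rw [fderiv_clm_apply hd (differentiableAt_const v)]
      simp
  have h1' : ∀ v, DifferentiableAt ℝ (fun z => fderiv ℝ f z v) z := fun v =>
    hd.clm_apply (differentiableAt_const v)
  have hsymm : fderiv ℝ (fderiv ℝ f) z 1 Complex.I = fderiv ℝ (fderiv ℝ f) z Complex.I 1 :=
    ((hf.contDiffAt (x := z)).isSymmSndFDerivAt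
      (by simp; exact WithTop.coe_le_coe.2 le_top)) 1 Complex.I
  have h2 : ∀ h, fderiv ℝ (dzbar f) z h = (fderiv ℝ (fderiv ℝ f) z h 1 +
      Complex.I * fderiv ℝ (fderiv ℝ f) z h Complex.I) / 2 := fun h => by
    have h3 : dzbar f = fun z =>
        (2 : ℂ)⁻¹ * (fderiv ℝ f z 1 + Complex.I * fderiv ℝ f z Complex.I) := by
      ext z; rw [dzbar]; ring
    have hs : DifferentiableAt ℝ
        (fun z => fderiv ℝ f z 1 + Complex.I * fderiv ℝ f z Complex.I) z :=
      (h1' 1).add ((h1' Complex.I).const_mul _)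
    rw [h3, fderiv_const_mul hs,
      fderiv_fun_add (h1' 1) ((h1' Complex.I).const_mul _), fderiv_const_mul (h1' Complex.I)]
    simp only [smul_apply, add_apply, h1, smul_eq_mul]
    ring
  have h4 : ∀ h, fderiv ℝ (dz f) z h = (fderiv ℝ (fderiv ℝ f) z h 1 -
      Complex.I * fderiv ℝ (fderiv ℝ f) z h Complex.I) / 2 := fun h => by
    have h3 : dz f = fun z =>
        (2 : ℂ)⁻¹ * (fderiv ℝ f z 1 - Complex.I * fderiv ℝ f z Complex.I) := by
      ext z; rw [dz]; ring
    have hs : DifferentiableAt ℝ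
        (fun z => fderiv ℝ f z 1 - Complex.I * fderiv ℝ f z Complex.I) z :=
      (h1' 1).sub ((h1' Complex.I).const_mul _)
    rw [h3, fderiv_const_mul hs,
      fderiv_fun_sub (h1' 1) ((h1' Complex.I).const_mul _), fderiv_const_mul (h1' Complex.I)]
    simp only [smul_apply, sub_apply, h1, smul_eq_mul]
    ring
  rw [dz, dzbar, h2, h2, h4, h4, hsymm]
  ring

/-- The mixed derivative `∂^α ∂̄^β`. -/
def wirt (α β : ℕ) (f : ℂ → ℂ) : ℂ → ℂ := dz^[α] (dzbar^[β] f)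

lemma differentiable_of_contDiff (hf : ContDiff ℝ ∞ f) : Differentiable ℝ f :=
  hf.differentiable (by simp)

lemma iterate_add_of {D : (ℂ → ℂ) → ℂ → ℂ}
    (hD : ∀ {f : ℂ → ℂ}, ContDiff ℝ ∞ f → ContDiff ℝ ∞ (D f))
    (hadd : ∀ {f g : ℂ → ℂ}, Differentiable ℝ f → Differentiable ℝ g →
      D (fun z => f z + g z) = fun z => D f z + D g z)
    (hf : ContDiff ℝ ∞ f) (hg : ContDiff ℝ ∞ g) (n : ℕ) :
    D^[n] (fun z => f z + g z) = fun z => D^[n] f z + D^[n] g z := by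
  induction n generalizing f g with
  | zero => rfl
  | succ n ih =>
    simp only [Function.iterate_succ_apply]
    rw [hadd (differentiable_of_contDiff hf) (differentiable_of_contDiff hg), ih (hD hf) (hD hg)]

lemma iterate_const_mul_of {D : (ℂ → ℂ) → ℂ → ℂ}
    (hD : ∀ {f : ℂ → ℂ}, ContDiff ℝ ∞ f → ContDiff ℝ ∞ (D f)) (c : ℂ)
    (hmul : ∀ {f : ℂ → ℂ}, Differentiable ℝ f → D (fun z => c * f z) = fun z => c * D f z)
    (hf : ContDiff ℝ ∞ f) (n : ℕ) :
    D^[n] (fun z => c * f z) = fun z => c * D^[n] f z := by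
  induction n generalizing f with
  | zero => rfl
  | succ n ih =>
    simp only [Function.iterate_succ_apply]
    rw [hmul (differentiable_of_contDiff hf), ih (hD hf)]

lemma wirt_add (α β : ℕ) (hf : ContDiff ℝ ∞ f) (hg : ContDiff ℝ ∞ g) :
    wirt α β (fun z => f z + g z) = fun z => wirt α β f z + wirt α β g z := by
  rw [wirt, iterate_add_of contDiff_dzbar dzbar_add hf hg,
    iterate_add_of contDiff_dz dz_add (contDiff_iterate contDiff_dzbar hf β)
      (contDiff_iterate contDiff_dzbar hg β)]
  rfl

lemma wirt_const_mul (α β : ℕ) (c : ℂ) (hf : ContDiff ℝ ∞ f) :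
    wirt α β (fun z => c * f z) = fun z => c * wirt α β f z := by
  rw [wirt, iterate_const_mul_of contDiff_dzbar c (dzbar_const_mul c) hf,
    iterate_const_mul_of contDiff_dz c (dz_const_mul c) (contDiff_iterate contDiff_dzbar hf β)]
  rfl

lemma wirt_zero (α β : ℕ) : wirt α β (fun _ => 0) = fun _ => 0 := by
  have h := wirt_const_mul α β 0 (f := fun _ => 0) contDiff_const
  simpa using h

lemma wirt_sum {ι : Type*} (s : Finset ι) (α β : ℕ) {F : ι → ℂ → ℂ}
    (hF : ∀ i, ContDiff ℝ ∞ (F i)) :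
    wirt α β (fun z => ∑ i ∈ s, F i z) = fun z => ∑ i ∈ s, wirt α β (F i) z := by
  classical
  induction s using Finset.induction_on with
  | empty => simpa using wirt_zero α β
  | insert a s ha ih =>
    simp only [Finset.sum_insert ha]
    rw [wirt_add α β (hF a) (ContDiff.sum fun i _ => hF i), ih]

lemma wirt_succ_right (α β : ℕ) (f : ℂ → ℂ) : wirt α (β + 1) f = wirt α β (dzbar f) := rfl

lemma dz_iterate_dzbar (hf : ContDiff ℝ ∞ f) (β : ℕ) : dz (dzbar^[β] f) = dzbar^[β] (dz f) := by
  induction β generalizing f with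
  | zero => rfl
  | succ β ih =>
    rw [Function.iterate_succ_apply, ih (contDiff_dzbar hf), dz_dzbar_comm hf]
    rfl

lemma wirt_succ_left (α β : ℕ) (hf : ContDiff ℝ ∞ f) : wirt (α + 1) β f = wirt α β (dz f) := by
  rw [wirt, Function.iterate_succ_apply, dz_iterate_dzbar hf]
  rfl

end WirtingerCalculus

lemma wt_pos (z : ℂ) : 0 < wt z := zero_lt_one.trans_le (one_le_wt z)

lemma wt_zpow_le (z : ℂ) (j : ℤ) : wt z ^ j ≤ (1 + ‖z‖) ^ j.toNat := by
  calc wt z ^ j ≤ wt z ^ (j.toNat : ℤ) := by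
        gcongr
        · exact one_le_wt z
        · exact Int.self_le_toNat j
    _ = wt z ^ j.toNat := zpow_natCast _ _
    _ ≤ _ := by
      gcongr
      · exact (wt_pos z).le
      · exact wt_le z

/-- A sequence of functions, all of whose derivatives are `O(k^{-e} (1+|z|²)^{j/2})`. -/
def SymFam (j : ℤ) (e : ℕ) (f : ℕ → ℂ → ℂ) : Prop :=
  (∀ k, 1 ≤ k → ContDiff ℝ ∞ (f k)) ∧ ∀ α β : ℕ, ∃ C : ℝ, ∀ k : ℕ, 1 ≤ k → ∀ z,
    ‖wirt α β (f k) z‖ ≤ C * ((k : ℝ) ^ e)⁻¹ * wt z ^ j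

namespace SymFam

variable {j j' : ℤ} {e e' : ℕ} {f g : ℕ → ℂ → ℂ}

lemma congr (hf : SymFam j e f) (h : ∀ k, 1 ≤ k → ∀ z, g k z = f k z) : SymFam j e g := by
  have h' : ∀ k, 1 ≤ k → g k = f k := fun k hk => funext (h k hk)
  refine ⟨fun k hk => h' k hk ▸ hf.1 k hk, fun α β => ?_⟩
  obtain ⟨C, hC⟩ := hf.2 α β
  exact ⟨C, fun k hk z => by rw [h' k hk]; exact hC k hk z⟩

lemma bound (hf : SymFam j e f) (α β : ℕ) : ∃ C : ℝ, 0 ≤ C ∧ ∀ k : ℕ, 1 ≤ k → ∀ z,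
    ‖wirt α β (f k) z‖ ≤ C * ((k : ℝ) ^ e)⁻¹ * wt z ^ j := by
  obtain ⟨C, hC⟩ := hf.2 α β
  refine ⟨C, ?_, hC⟩
  have := (norm_nonneg _).trans (hC 1 le_rfl 0)
  simpa [wt] using this

lemma add (hf : SymFam j e f) (hg : SymFam j e g) : SymFam j e (fun k z => f k z + g k z) := by
  refine ⟨fun k hk => (hf.1 k hk).add (hg.1 k hk), fun α β => ?_⟩
  obtain ⟨C, hC⟩ := hf.2 α β
  obtain ⟨C', hC'⟩ := hg.2 α β
  refine ⟨C + C', fun k hk z => ?_⟩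
  rw [wirt_add α β (hf.1 k hk) (hg.1 k hk), add_mul, add_mul]
  exact (norm_add_le _ _).trans (add_le_add (hC k hk z) (hC' k hk z))

/-- Multiplication by constants which are `O(k^{-e'})`. -/
lemma const_mul (hf : SymFam j e f) {c : ℕ → ℂ} {A : ℝ}
    (hc : ∀ k : ℕ, 1 ≤ k → ‖c k‖ ≤ A * ((k : ℝ) ^ e')⁻¹) :
    SymFam j (e' + e) (fun k z => c k * f k z) := by
  have hA : 0 ≤ A := by simpa using (norm_nonneg _).trans (hc 1 le_rfl)
  refine ⟨fun k hk => contDiff_const.mul (hf.1 k hk), fun α β => ?_⟩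
  obtain ⟨C, hC0, hC⟩ := hf.bound α β
  refine ⟨A * C, fun k hk z => ?_⟩
  rw [wirt_const_mul α β (c k) (hf.1 k hk), norm_mul]
  calc _ ≤ (A * ((k : ℝ) ^ e')⁻¹) * (C * ((k : ℝ) ^ e)⁻¹ * wt z ^ j) :=
        mul_le_mul (hc k hk) (hC k hk z) (norm_nonneg _) (by positivity)
    _ = _ := by rw [pow_add, mul_inv]; ring

lemma const_mul' (hf : SymFam j e f) (c : ℂ) : SymFam j e (fun k z => c * f k z) := by
  have := hf.const_mul (e' := 0) (c := fun _ => c) (A := ‖c‖) (by simp)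
  simpa using this

lemma sub (hf : SymFam j e f) (hg : SymFam j e g) : SymFam j e (fun k z => f k z - g k z) :=
  (hf.add (hg.const_mul' (-1))).congr fun k _ z => by ring

lemma zero (j : ℤ) (e : ℕ) : SymFam j e (fun _ _ => 0) :=
  ⟨fun _ _ => contDiff_const, fun α β => ⟨0, fun k _ z => by simp [wirt_zero]⟩⟩

lemma sum {ι : Type*} (s : Finset ι) {F : ι → ℕ → ℂ → ℂ} (hF : ∀ i ∈ s, SymFam j e (F i)) :
    SymFam j e (fun k z => ∑ i ∈ s, F i k z) := by
  classical
  induction s using Finset.induction_on with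
  | empty => simpa using zero j e
  | insert a s ha ih =>
    simp only [Finset.sum_insert ha]
    exact (hF a (Finset.mem_insert_self a s)).add
      (ih fun i hi => hF i (Finset.mem_insert_of_mem hi))

lemma mono (hf : SymFam j e f) (h : e' ≤ e) : SymFam j e' f := by
  refine ⟨hf.1, fun α β => ?_⟩
  obtain ⟨C, hC0, hC⟩ := hf.bound α β
  refine ⟨C, fun k hk z => (hC k hk z).trans ?_⟩
  have hk1 : (1 : ℝ) ≤ k := by exact_mod_cast hk
  have := (wt_pos z).le
  gcongr

lemma inv_pow_mul (hf : SymFam j e f) (n : ℕ) :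
    SymFam j (n + e) (fun k z => ((k : ℂ) ^ n)⁻¹ * f k z) :=
  hf.const_mul (A := 1) fun k _ => by simp

lemma dz (hf : SymFam j e f) : SymFam j e (fun k => dz (f k)) := by
  refine ⟨fun k hk => contDiff_dz (hf.1 k hk), fun α β => ?_⟩
  obtain ⟨C, hC⟩ := hf.2 (α + 1) β
  exact ⟨C, fun k hk z => by rw [← wirt_succ_left α β (hf.1 k hk)]; exact hC k hk z⟩

lemma dzbar (hf : SymFam j e f) : SymFam j e (fun k => dzbar (f k)) :=
  ⟨fun k hk => contDiff_dzbar (hf.1 k hk), fun α β => hf.2 α (β + 1)⟩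

lemma iterate_dz (hf : SymFam j e f) (n : ℕ) : SymFam j e (fun k => Bargmann.dz^[n] (f k)) := by
  induction n generalizing f with
  | zero => exact hf
  | succ n ih => exact ih hf.dz

lemma iterate_dzbar (hf : SymFam j e f) (n : ℕ) :
    SymFam j e (fun k => Bargmann.dzbar^[n] (f k)) := by
  induction n generalizing f with
  | zero => exact hf
  | succ n ih => exact ih hf.dzbar

lemma mul (hf : SymFam j e f) (hg : SymFam j' e' g) :
    SymFam (j + j') (e + e') (fun k z => f k z * g k z) := by
  refine ⟨fun k hk => (hf.1 k hk).mul (hg.1 k hk), fun α β => ?_⟩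
  have hsum : ∀ {F G : ℕ → ℂ → ℂ} {α β : ℕ}, (∀ k, 1 ≤ k → ContDiff ℝ ∞ (F k)) →
      (∀ k, 1 ≤ k → ContDiff ℝ ∞ (G k)) →
      (∃ C : ℝ, ∀ k : ℕ, 1 ≤ k → ∀ z,
        ‖wirt α β (F k) z‖ ≤ C * ((k : ℝ) ^ (e + e'))⁻¹ * wt z ^ (j + j')) →
      (∃ C : ℝ, ∀ k : ℕ, 1 ≤ k → ∀ z,
        ‖wirt α β (G k) z‖ ≤ C * ((k : ℝ) ^ (e + e'))⁻¹ * wt z ^ (j + j')) →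
      ∃ C : ℝ, ∀ k : ℕ, 1 ≤ k → ∀ z,
        ‖wirt α β (fun z => F k z + G k z) z‖ ≤ C * ((k : ℝ) ^ (e + e'))⁻¹ * wt z ^ (j + j') := by
    rintro F G α β hF hG ⟨C, hC⟩ ⟨C', hC'⟩
    refine ⟨C + C', fun k hk z => ?_⟩
    rw [wirt_add α β (hF k hk) (hG k hk), add_mul, add_mul]
    exact (norm_add_le _ _).trans (add_le_add (hC k hk z) (hC' k hk z))
  induction β generalizing f g with
  | zero =>
    induction α generalizing f g with
    | zero =>
      obtain ⟨C, hC0, hC⟩ := hf.bound 0 0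
      obtain ⟨C', hC0', hC'⟩ := hg.bound 0 0
      refine ⟨C * C', fun k hk z => ?_⟩
      have h1 := hC k hk z
      have h2 := hC' k hk z
      simp only [wirt, Function.iterate_zero, id_eq] at h1 h2 ⊢
      have := (wt_pos z).le
      rw [norm_mul, zpow_add₀ (wt_pos z).ne', pow_add, mul_inv]
      calc _ ≤ (C * ((k : ℝ) ^ e)⁻¹ * wt z ^ j) * (C' * ((k : ℝ) ^ e')⁻¹ * wt z ^ j') :=
            mul_le_mul h1 h2 (norm_nonneg _) (by positivity)
        _ = _ := by ring
    | succ α ih =>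
      obtain ⟨C, hC⟩ := hsum (fun k hk => (contDiff_dz (hf.1 k hk)).mul (hg.1 k hk))
        (fun k hk => (hf.1 k hk).mul (contDiff_dz (hg.1 k hk))) (ih hf.dz hg) (ih hf hg.dz)
      refine ⟨C, fun k hk z => ?_⟩
      rw [wirt_succ_left _ _ ((hf.1 k hk).mul (hg.1 k hk)),
        dz_mul (differentiable_of_contDiff (hf.1 k hk)) (differentiable_of_contDiff (hg.1 k hk))]
      exact hC k hk z
  | succ β ih =>
    obtain ⟨C, hC⟩ := hsum (fun k hk => (contDiff_dzbar (hf.1 k hk)).mul (hg.1 k hk))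
      (fun k hk => (hf.1 k hk).mul (contDiff_dzbar (hg.1 k hk))) (ih hf.dzbar hg) (ih hf hg.dzbar)
    refine ⟨C, fun k hk z => ?_⟩
    rw [wirt_succ_right, dzbar_mul (differentiable_of_contDiff (hf.1 k hk))
      (differentiable_of_contDiff (hg.1 k hk))]
    exact hC k hk z

lemma norm_le (hf : SymFam j e f) : ∃ C : ℝ, 0 ≤ C ∧ ∀ k : ℕ, 1 ≤ k → ∀ z,
    ‖f k z‖ ≤ C * ((k : ℝ) ^ e)⁻¹ * (1 + ‖z‖) ^ j.toNat := by
  obtain ⟨C, hC0, hC⟩ := hf.bound 0 0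
  refine ⟨C, hC0, fun k hk z => (hC k hk z).trans ?_⟩
  gcongr
  exact wt_zpow_le z j

lemma fix (hf : SymFam j e f) {k : ℕ} (hk : 1 ≤ k) : SymFam j 0 (fun _ => f k) := by
  refine ⟨fun _ _ => hf.1 k hk, fun α β => ?_⟩
  obtain ⟨C, hC⟩ := hf.2 α β
  exact ⟨C * ((k : ℝ) ^ e)⁻¹, fun _ _ z => by simpa using hC k hk z⟩

lemma temperate (hf : SymFam j e f) {k : ℕ} (hk : 1 ≤ k) : (f k).HasTemperateGrowth := by
  obtain ⟨B, hB, hb⟩ := exists_norm_iteratedFDeriv_succ_le Complex.basisOneI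
  refine ⟨hf.1 k hk, fun n => ?_⟩
  have key : ∀ n : ℕ, ∀ h : ℂ → ℂ, SymFam j 0 (fun _ => h) →
      ∃ C : ℝ, ∀ x, ‖iteratedFDeriv ℝ n h x‖ ≤ C * (1 + ‖x‖) ^ j.toNat := by
    intro n
    induction n with
    | zero =>
      intro h hh
      obtain ⟨C, -, hC⟩ := hh.norm_le
      exact ⟨C, fun x => by simpa using hC 1 le_rfl x⟩
    | succ n ih =>
      intro h hh
      have hstep : ∀ v : ℂ, SymFam j 0 (fun _ z => fderiv ℝ h z v) := fun v =>
        ((hh.dz.const_mul' v).add (hh.dzbar.const_mul' (conj v))).congr fun _ _ z => by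
          rw [fderiv_eq_dz_add_dzbar]; ring
      choose C hC using fun i => ih _ (hstep (Complex.basisOneI i))
      refine ⟨B * ∑ i, C i, fun x => (hb h (hh.1 1 le_rfl) n x).trans ?_⟩
      rw [mul_assoc, Finset.sum_mul]
      gcongr with i
      exact hC i x
  obtain ⟨C, hC⟩ := key n _ (hf.fix hk)
  exact ⟨_, C, hC⟩

end SymFam

lemma IsSymbol.symFam_coeff {j : ℤ} {a σ : ℕ → ℂ → ℂ} (h : IsSymbol j a σ) (l : ℕ) :
    SymFam j 0 (fun _ => σ l) :=
  ⟨fun _ _ => h.2.1 l, fun α β => by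
    obtain ⟨C, hC⟩ := h.2.2.1 l α β
    exact ⟨C, fun _ _ z => by simpa [wirt] using hC z⟩⟩

lemma IsSymbol.symFam_sub {j : ℤ} {a σ : ℕ → ℂ → ℂ} (h : IsSymbol j a σ) (L : ℕ) :
    SymFam j L (fun k z => a k z - ∑ l ∈ Finset.range L, ((k : ℂ) ^ l)⁻¹ * σ l z) := by
  have hpos : ∀ L, 1 ≤ L →
      SymFam j L (fun k z => a k z - ∑ l ∈ Finset.range L, ((k : ℂ) ^ l)⁻¹ * σ l z) :=
    fun L hL => ⟨fun k hk => (h.1 k hk).sub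
      (ContDiff.sum fun l _ => contDiff_const.mul (h.2.1 l)), fun α β => h.2.2.2 L hL α β⟩
  rcases Nat.eq_zero_or_pos L with rfl | hL
  · exact (((hpos 1 le_rfl).mono (Nat.zero_le 1)).add (h.symFam_coeff 0)).congr
      fun k _ z => by simp
  · exact hpos L hL

/-! ### Asymptotic expansions, Borel summation and the product of symbols -/

lemma wirt_sub (α β : ℕ) {f g : ℂ → ℂ} (hf : ContDiff ℝ ∞ f) (hg : ContDiff ℝ ∞ g) :
    wirt α β (fun z => f z - g z) = fun z => wirt α β f z - wirt α β g z := by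
  have h := wirt_add α β hf (contDiff_const (c := (-1 : ℂ)) |>.mul hg)
  rw [wirt_const_mul α β (-1) hg] at h
  simpa [sub_eq_add_neg] using h

lemma SymFam.wirt {j : ℤ} {e : ℕ} {f : ℕ → ℂ → ℂ} (hf : SymFam j e f) (α β : ℕ) :
    SymFam j e (fun k => wirt α β (f k)) := (hf.iterate_dzbar β).iterate_dz α

/-- The asymptotic expansion `f_k ~ ∑ k^{-ℓ} ρ_ℓ` in the symbol class of order `j`. -/
structure HasExpansion (j : ℤ) (f ρ : ℕ → ℂ → ℂ) : Prop where
  coeff : ∀ l, SymFam j 0 (fun _ => ρ l)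
  sub : ∀ L, SymFam j L (fun k z => f k z - ∑ l ∈ Finset.range L, ((k : ℂ) ^ l)⁻¹ * ρ l z)

lemma IsSymbol.hasExpansion {j : ℤ} {a σ : ℕ → ℂ → ℂ} (h : IsSymbol j a σ) :
    HasExpansion j a σ := ⟨h.symFam_coeff, h.symFam_sub⟩

namespace HasExpansion

variable {j j' : ℤ} {f g ρ σ : ℕ → ℂ → ℂ}

lemma symFam (h : HasExpansion j f ρ) : SymFam j 0 f := (h.sub 0).congr fun k _ z => by simp

lemma contDiff_coeff (h : HasExpansion j f ρ) (l : ℕ) : ContDiff ℝ ∞ (ρ l) :=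
  (h.coeff l).1 1 le_rfl

lemma isSymbol (h : HasExpansion j f ρ) : IsSymbol j f ρ := by
  refine ⟨h.symFam.1, h.contDiff_coeff, fun l α β => ?_, fun L _ α β => (h.sub L).2 α β⟩
  obtain ⟨C, hC⟩ := (h.coeff l).2 α β
  exact ⟨C, fun z => by simpa [wirt] using hC 1 le_rfl z⟩

lemma wirt (h : HasExpansion j f ρ) (α β : ℕ) :
    HasExpansion j (fun k => wirt α β (f k)) (fun l => wirt α β (ρ l)) := by
  refine ⟨fun l => (h.coeff l).wirt α β, fun L => ((h.sub L).wirt α β).congr fun k hk z => ?_⟩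
  have h1 : ∀ l, ContDiff ℝ ∞ (fun z => ((k : ℂ) ^ l)⁻¹ * ρ l z) := fun l =>
    contDiff_const.mul (h.contDiff_coeff l)
  rw [wirt_sub α β (h.symFam.1 k hk) (ContDiff.sum fun l _ => h1 l),
    wirt_sum _ α β h1]
  simp only [wirt_const_mul α β _ (h.contDiff_coeff _)]

/-- Expansions multiply by the Cauchy product. -/
lemma mul (hf : HasExpansion j f ρ) (hg : HasExpansion j' g σ) :
    HasExpansion (j + j') (fun k z => f k z * g k z)
      (fun t z => ∑ p ∈ Finset.HasAntidiagonal.antidiagonal t, ρ p.1 z * σ p.2 z) := by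
  refine ⟨fun t => SymFam.sum _ fun p _ => (hf.coeff p.1).mul (hg.coeff p.2), fun L => ?_⟩
  have h1 : SymFam (j + j') L (fun k z => (f k z - ∑ l ∈ Finset.range L, ((k : ℂ) ^ l)⁻¹ * ρ l z)
      * g k z) := (hf.sub L).mul hg.symFam
  have h2 : SymFam (j + j') L (fun k z => ∑ l ∈ Finset.range L, ((k : ℂ) ^ l)⁻¹ * (ρ l z *
      (g k z - ∑ m ∈ Finset.range (L - l), ((k : ℂ) ^ m)⁻¹ * σ m z))) := by
    refine SymFam.sum _ fun l hl => ?_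
    have := ((hf.coeff l).mul (hg.sub (L - l))).inv_pow_mul l
    have hl' := Finset.mem_range.1 hl
    rwa [show l + (0 + (L - l)) = L by omega] at this
  refine (h1.add h2).congr fun k _ z => ?_
  have h3 : ∑ t ∈ Finset.range L, ((k : ℂ) ^ t)⁻¹ *
        ∑ p ∈ Finset.HasAntidiagonal.antidiagonal t, ρ p.1 z * σ p.2 z =
      ∑ l ∈ Finset.range L, ∑ m ∈ Finset.range (L - l),
        ((k : ℂ) ^ (l + m))⁻¹ * (ρ l z * σ m z) := by
    rw [← Finset.sum_range_diag_flip]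
    refine Finset.sum_congr rfl fun t _ => ?_
    rw [Finset.Nat.sum_antidiagonal_eq_sum_range_succ (fun l m => ρ l z * σ m z), Finset.mul_sum]
    refine Finset.sum_congr rfl fun l hl => ?_
    rw [Nat.add_sub_cancel' (Nat.lt_succ_iff.1 (Finset.mem_range.1 hl))]
  rw [h3]
  simp only [mul_sub, Finset.mul_sum, Finset.sum_sub_distrib, sub_mul, Finset.sum_mul]
  have h4 : ∀ l m, ((k : ℂ) ^ (l + m))⁻¹ * (ρ l z * σ m z) =
      ((k : ℂ) ^ l)⁻¹ * (ρ l z * (((k : ℂ) ^ m)⁻¹ * σ m z)) := fun l m => by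
    rw [pow_add, mul_inv]; ring
  simp only [h4, mul_assoc]
  ring

end HasExpansion

/-- Borel summation: any sequence of coefficients of order `j` is the expansion of a symbol.
The `ℓ`-th term is switched on for those `k` which are large compared with its seminorms. -/
lemma exists_hasExpansion {j : ℤ} {ρ : ℕ → ℂ → ℂ} (hρ : ∀ l, SymFam j 0 (fun _ => ρ l)) :
    ∃ c, HasExpansion j c ρ := by
  have h0 : ∀ l α β, ∃ C : ℝ, 0 ≤ C ∧ ∀ z, ‖wirt α β (ρ l) z‖ ≤ C * wt z ^ j := fun l α β => by
    obtain ⟨C, hC0, hC⟩ := (hρ l).bound α β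
    exact ⟨C, hC0, fun z => by simpa using hC 1 le_rfl z⟩
  choose C hC0 hC using h0
  have hsm : ∀ l, ContDiff ℝ ∞ (ρ l) := fun l => (hρ l).1 1 le_rfl
  set A : ℕ → ℝ := fun l =>
    ∑ α ∈ Finset.range (l + 1), ∑ β ∈ Finset.range (l + 1), C l α β with hAdef
  have hCA : ∀ l α β, α ≤ l → β ≤ l → C l α β ≤ A l := fun l α β hα hβ => by
    refine le_trans ?_ (Finset.single_le_sum
      (f := fun α => ∑ β ∈ Finset.range (l + 1), C l α β)
      (fun α _ => Finset.sum_nonneg fun β _ => hC0 l α β)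
      (Finset.mem_range.2 (Nat.lt_succ_iff.2 hα)))
    exact Finset.single_le_sum (f := fun β => C l α β) (fun β _ => hC0 l α β)
      (Finset.mem_range.2 (Nat.lt_succ_iff.2 hβ))
  -- The threshold `K l ≥ 2 ^ l * A l` makes the tail summable; `K l ≥ l` makes the truncation of
  -- the sum at `k` immaterial.
  choose K hK using fun l : ℕ => exists_nat_ge (max ((l : ℕ) : ℝ) (2 ^ (l : ℕ) * A l))
  have hKl : ∀ l, l ≤ K l := fun l => by exact_mod_cast (le_max_left _ _).trans (hK l)
  set e : ℕ → ℕ → ℂ := fun l k => if K l ≤ k then ((k : ℂ) ^ l)⁻¹ else 0 with hedef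
  refine ⟨fun k z => ∑ l ∈ Finset.range (k + 1), e l k * ρ l z, hρ,
    fun L => ⟨fun k _ => ?_, fun α β => ?_⟩⟩
  · exact (ContDiff.sum fun l _ => contDiff_const.mul (hsm l)).sub
      (ContDiff.sum fun l _ => contDiff_const.mul (hsm l))
  -- From the index `l₀` on, the seminorm `(α, β)` is controlled by `A l`, and there is a spare
  -- factor `k⁻¹` to be paired with it.
  set l₀ : ℕ := max (max α β) (L + 1)
  set d : ℕ → ℕ → ℂ := fun l k => e l k - if l < L then ((k : ℂ) ^ l)⁻¹ else 0 with hddef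
  set M : ℕ → ℝ := fun l => (if l < l₀ then ((K l : ℝ) ^ L + 1) * C l α β else 0) + (1 / 2) ^ l
    with hMdef
  have hMs : Summable M := by
    refine Summable.add (summable_of_ne_finset_zero (s := Finset.range l₀) fun l hl => ?_)
      summable_geometric_two
    rw [if_neg (by simpa using hl)]
  have hM0 : ∀ l, 0 ≤ M l := fun l => by
    have := hC0 l α β
    simp only [hMdef]
    split_ifs <;> positivity
  have key : ∀ k : ℕ, 1 ≤ k → ∀ l, ‖d l k‖ * C l α β ≤ M l * ((k : ℝ) ^ L)⁻¹ := by
    intro k hk l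
    have hk0 : (0 : ℝ) < k := by exact_mod_cast hk
    have hk1 : (1 : ℝ) ≤ k := by exact_mod_cast hk
    have hCl := hC0 l α β
    have hinv : ∀ m, L ≤ m → ((k : ℝ) ^ m)⁻¹ ≤ ((k : ℝ) ^ L)⁻¹ := fun m hm => by
      gcongr
    by_cases hl : l < l₀
    · have hd : ‖d l k‖ ≤ ((K l : ℝ) ^ L + 1) * ((k : ℝ) ^ L)⁻¹ := by
        by_cases hlL : l < L
        · by_cases hkK : K l ≤ k
          · simp only [hddef, hedef, if_pos hlL, if_pos hkK, sub_self, norm_zero]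
            positivity
          · simp only [hddef, hedef, if_pos hlL, if_neg hkK, zero_sub, norm_neg, norm_inv, norm_pow,
              Complex.norm_natCast]
            have h1 : ((k : ℝ) ^ l)⁻¹ ≤ 1 := inv_le_one_of_one_le₀ (one_le_pow₀ hk1)
            refine h1.trans ?_
            rw [← div_eq_mul_inv, le_div_iff₀ (by positivity), one_mul]
            have : (k : ℝ) ^ L ≤ (K l : ℝ) ^ L := by
              gcongr
              omega
            linarith
        · simp only [hddef, hedef, if_neg hlL, sub_zero]
          have h2 : (0 : ℝ) ≤ (K l : ℝ) ^ L := by positivity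
          split_ifs
          · simp only [norm_inv, norm_pow, Complex.norm_natCast]
            refine (hinv l (not_lt.1 hlL)).trans ?_
            exact le_mul_of_one_le_left (by positivity) (by linarith)
          · simp only [norm_zero]; positivity
      have h3 : ((K l : ℝ) ^ L + 1) * C l α β ≤ M l := by
        simp only [hMdef, if_pos hl]
        have : (0 : ℝ) ≤ (1 / 2) ^ l := by positivity
        linarith
      calc _ ≤ ((K l : ℝ) ^ L + 1) * ((k : ℝ) ^ L)⁻¹ * C l α β := by gcongr
        _ = (((K l : ℝ) ^ L + 1) * C l α β) * ((k : ℝ) ^ L)⁻¹ := by ring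
        _ ≤ _ := by gcongr
    · have hl' := not_lt.1 hl
      have hα : α ≤ l := ((le_max_left _ _).trans (le_max_left _ _)).trans hl'
      have hβ : β ≤ l := ((le_max_right _ _).trans (le_max_left _ _)).trans hl'
      have hlL : L + 1 ≤ l := (le_max_right _ _).trans hl'
      have hMl : M l = (1 / 2) ^ l := by simp only [hMdef, if_neg hl, zero_add]
      rw [hMl]
      simp only [hddef, hedef, if_neg (show ¬ l < L by omega), sub_zero]
      split_ifs with hkK
      · simp only [norm_inv, norm_pow, Complex.norm_natCast]
        have h1 : 2 ^ l * C l α β ≤ k := calc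
          (2 : ℝ) ^ l * C l α β ≤ 2 ^ l * A l := by gcongr; exact hCA l α β hα hβ
          _ ≤ K l := (le_max_right _ _).trans (hK l)
          _ ≤ k := by exact_mod_cast hkK
        have h2 : ((k : ℝ) ^ l)⁻¹ ≤ ((k : ℝ) ^ (L + 1))⁻¹ := by
          gcongr
        have h3 : C l α β ≤ (1 / 2) ^ l * k := by
          rw [one_div, inv_pow, ← div_eq_inv_mul, le_div_iff₀ (by positivity)]
          linarith
        calc _ ≤ ((k : ℝ) ^ (L + 1))⁻¹ * ((1 / 2) ^ l * k) := by gcongr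
          _ = _ := by rw [pow_succ]; field_simp
      · simp only [norm_zero, zero_mul]; positivity
  refine ⟨∑' l, M l, fun k hk z => ?_⟩
  have hw : (0 : ℝ) ≤ wt z ^ j := (zpow_pos (wt_pos z) j).le
  set n := max (k + 1) L
  have hexp : ∀ z, (∑ l ∈ Finset.range (k + 1), e l k * ρ l z) -
      ∑ l ∈ Finset.range L, ((k : ℂ) ^ l)⁻¹ * ρ l z = ∑ l ∈ Finset.range n, d l k * ρ l z := by
    intro z
    have h1 : ∑ l ∈ Finset.range (k + 1), e l k * ρ l z =
        ∑ l ∈ Finset.range n, e l k * ρ l z := by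
      refine Finset.sum_subset (Finset.range_mono (le_max_left _ _)) fun l _ hl => ?_
      have : ¬ K l ≤ k := by
        have := hKl l
        simp only [Finset.mem_range] at hl
        omega
      simp only [hedef, if_neg this, zero_mul]
    have h2 : ∑ l ∈ Finset.range L, ((k : ℂ) ^ l)⁻¹ * ρ l z =
        ∑ l ∈ Finset.range n, (if l < L then ((k : ℂ) ^ l)⁻¹ else 0) * ρ l z := by
      rw [← Finset.sum_subset (Finset.range_mono (le_max_right (k + 1) L)) fun l _ hl => by
        rw [if_neg (by simpa using hl), zero_mul]]
      exact Finset.sum_congr rfl fun l hl => by rw [if_pos (Finset.mem_range.1 hl)]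
    rw [h1, h2, ← Finset.sum_sub_distrib]
    simp only [hddef, sub_mul]
  simp only [hexp]
  rw [wirt_sum _ α β fun l => contDiff_const.mul (hsm l)]
  calc _ ≤ ∑ l ∈ Finset.range n, M l * ((k : ℝ) ^ L)⁻¹ * wt z ^ j := by
        refine norm_sum_le_of_le _ fun l _ => ?_
        rw [wirt_const_mul α β _ (hsm l), norm_mul]
        calc _ ≤ ‖d l k‖ * (C l α β * wt z ^ j) := by gcongr; exact hC l α β z
          _ = ‖d l k‖ * C l α β * wt z ^ j := by ring
          _ ≤ _ := mul_le_mul_of_nonneg_right (key k hk l) hw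
    _ = (∑ l ∈ Finset.range n, M l) * ((k : ℝ) ^ L)⁻¹ * wt z ^ j := by
        rw [Finset.sum_mul, Finset.sum_mul]
    _ ≤ _ := by
        gcongr
        exact hMs.sum_le_tsum _ fun l _ => hM0 l

/-- `(∂/∂z₁ ∂/∂z̄₂)^p` acts on a finite sum of tensor products factor by factor. -/
lemma mixedD_iterate_sum {ι : Type*} (s : Finset ι) {f g : ι → ℂ → ℂ}
    (hf : ∀ i, ContDiff ℝ ∞ (f i)) (hg : ∀ i, ContDiff ℝ ∞ (g i)) (p : ℕ) :
    mixedD^[p] (fun z₁ z₂ => ∑ i ∈ s, f i z₁ * g i z₂) =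
      fun z₁ z₂ => ∑ i ∈ s, dz^[p] (f i) z₁ * dzbar^[p] (g i) z₂ := by
  induction p generalizing f g with
  | zero => rfl
  | succ p ih =>
    rw [Function.iterate_succ_apply]
    have h : mixedD (fun z₁ z₂ => ∑ i ∈ s, f i z₁ * g i z₂) =
        fun z₁ z₂ => ∑ i ∈ s, dz (f i) z₁ * dzbar (g i) z₂ := by
      ext z₁ z₂
      have h1 : ∀ u, dzbar (fun v => ∑ i ∈ s, f i u * g i v) z₂ =
          ∑ i ∈ s, dzbar (g i) z₂ * f i u := fun u => by
        have := congrFun (wirt_sum s 0 1 (F := fun i v => f i u * g i v)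
          fun i => contDiff_const.mul (hg i)) z₂
        refine this.trans (Finset.sum_congr rfl fun i _ => ?_)
        rw [wirt_const_mul 0 1 _ (hg i), mul_comm]
        rfl
      have h2 := congrFun (wirt_sum s 1 0 (F := fun i u => dzbar (g i) z₂ * f i u)
          fun i => contDiff_const.mul (hf i)) z₁
      simp only [mixedD, h1]
      refine h2.trans (Finset.sum_congr rfl fun i _ => ?_)
      rw [wirt_const_mul 1 0 _ (hf i), mul_comm]
      rfl
    rw [h, ih (fun i => contDiff_dz (hf i)) (fun i => contDiff_dzbar (hg i))]
    rfl

lemma symbolProduct_eq {σ τ : ℕ → ℂ → ℂ} (hσ : ∀ l, ContDiff ℝ ∞ (σ l))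
    (hτ : ∀ l, ContDiff ℝ ∞ (τ l)) (t : ℕ) (z : ℂ) :
    symbolProduct σ τ t z =
      ∑ p ∈ Finset.HasAntidiagonal.antidiagonal t, (-1 : ℂ) ^ p.1 / (p.1.factorial : ℂ) *
        ∑ q ∈ Finset.HasAntidiagonal.antidiagonal p.2,
          dz^[p.1] (σ q.1) z * dzbar^[p.1] (τ q.2) z := by
  rw [symbolProduct, expMixedD]
  refine Finset.sum_congr rfl fun p _ => congrArg₂ _ rfl ?_
  exact congrFun (congrFun (mixedD_iterate_sum (Finset.HasAntidiagonal.antidiagonal p.2)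
    (f := fun q : ℕ × ℕ => σ q.1) (g := fun q : ℕ × ℕ => τ q.2)
    (fun q => hσ q.1) (fun q => hτ q.2) p.1) z) z

section Product

variable {j j' : ℤ} {a b c σ τ : ℕ → ℂ → ℂ}

lemma HasExpansion.dz_mul_dzbar (ha : HasExpansion j a σ) (hb : HasExpansion j' b τ) (n : ℕ) :
    HasExpansion (j + j') (fun k z => dz^[n] (a k) z * dzbar^[n] (b k) z)
      (fun t z => ∑ q ∈ Finset.HasAntidiagonal.antidiagonal t,
        dz^[n] (σ q.1) z * dzbar^[n] (τ q.2) z) :=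
  (ha.wirt n 0).mul (hb.wirt 0 n)

lemma symFam_symbolProduct (ha : HasExpansion j a σ) (hb : HasExpansion j' b τ) (t : ℕ) :
    SymFam (j + j') 0 (fun _ => symbolProduct σ τ t) :=
  (SymFam.sum (Finset.HasAntidiagonal.antidiagonal t) fun p _ =>
    ((ha.dz_mul_dzbar hb p.1).coeff p.2).const_mul' ((-1 : ℂ) ^ p.1 / (p.1.factorial : ℂ))).congr
    fun _ _ z => symbolProduct_eq ha.contDiff_coeff hb.contDiff_coeff t z

/-- A symbol with the expansion `symbolProduct σ τ` agrees up to `O(k^{-N})` with the truncated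
star product of the symbols themselves. -/
lemma HasExpansion.symFam_starProduct_sub (ha : HasExpansion j a σ) (hb : HasExpansion j' b τ)
    (hc : HasExpansion (j + j') c (symbolProduct σ τ)) (N : ℕ) :
    SymFam (j + j') N (fun k z => (∑ n ∈ Finset.range N, (-1 : ℂ) ^ n / (n.factorial : ℂ) *
      (((k : ℂ) ^ n)⁻¹ * (dz^[n] (a k) z * dzbar^[n] (b k) z))) - c k z) := by
  set H : ℕ → ℕ → ℂ → ℂ := fun n t z =>
    ∑ q ∈ Finset.HasAntidiagonal.antidiagonal t, dz^[n] (σ q.1) z * dzbar^[n] (τ q.2) z with hH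
  have h1 : SymFam (j + j') N (fun k z => ∑ n ∈ Finset.range N, (-1 : ℂ) ^ n / (n.factorial : ℂ) *
      (((k : ℂ) ^ n)⁻¹ * (dz^[n] (a k) z * dzbar^[n] (b k) z -
        ∑ q ∈ Finset.range (N - n), ((k : ℂ) ^ q)⁻¹ * H n q z))) := by
    refine SymFam.sum _ fun n hn => SymFam.const_mul' ?_ _
    have := ((ha.dz_mul_dzbar hb n).sub (N - n)).inv_pow_mul n
    have hn' := Finset.mem_range.1 hn
    rwa [show n + (N - n) = N by omega] at this
  refine (h1.sub (hc.sub N)).congr fun k _ z => ?_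
  have h2 : ∑ t ∈ Finset.range N, ((k : ℂ) ^ t)⁻¹ * symbolProduct σ τ t z =
      ∑ n ∈ Finset.range N, ∑ q ∈ Finset.range (N - n),
        ((k : ℂ) ^ (n + q))⁻¹ * ((-1 : ℂ) ^ n / (n.factorial : ℂ) * H n q z) := by
    rw [← Finset.sum_range_diag_flip]
    refine Finset.sum_congr rfl fun t _ => ?_
    rw [symbolProduct_eq ha.contDiff_coeff hb.contDiff_coeff,
      Finset.Nat.sum_antidiagonal_eq_sum_range_succ
        (fun n q => (-1 : ℂ) ^ n / (n.factorial : ℂ) * H n q z), Finset.mul_sum]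
    refine Finset.sum_congr rfl fun l hl => ?_
    rw [Nat.add_sub_cancel' (Nat.lt_succ_iff.1 (Finset.mem_range.1 hl))]
  rw [h2]
  have h3 : ∀ n q, ((k : ℂ) ^ (n + q))⁻¹ * ((-1 : ℂ) ^ n / (n.factorial : ℂ) * H n q z) =
      (-1 : ℂ) ^ n / (n.factorial : ℂ) * (((k : ℂ) ^ n)⁻¹ * (((k : ℂ) ^ q)⁻¹ * H n q z)) :=
    fun n q => by rw [pow_add, mul_inv]; ring
  simp only [h3, mul_sub, Finset.mul_sum, Finset.sum_sub_distrib]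
  ring

end Product

/-! ### Composition of Toeplitz operators -/

section ToepKernel

lemma integrable_toepKernel {k : ℕ} (hk : 1 ≤ k) {h : ℂ → ℂ} (hc : Continuous h) {C : ℝ} {m : ℕ}
    (hb : ∀ z, ‖h z‖ ≤ C * (1 + ‖z‖) ^ m) (x : ℂ × ℂ) :
    Integrable (fun u => repKernel k (x.1, u) * h u * repKernel k (u, x.2)) lam :=
  (isGaussKernel_repKernel_mul (a := fun _ => h) (fun _ _ => hc) fun _ _ => hb).integrable_mul
    isGaussKernel_repKernel hk x.1 x.2

lemma integrable_toepKernel_symFam {j : ℤ} {e : ℕ} {f : ℕ → ℂ → ℂ} (hf : SymFam j e f) {k : ℕ}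
    (hk : 1 ≤ k) (x : ℂ × ℂ) :
    Integrable (fun u => repKernel k (x.1, u) * f k u * repKernel k (u, x.2)) lam := by
  obtain ⟨C, -, hC⟩ := hf.norm_le
  exact integrable_toepKernel hk (hf.1 k hk).continuous (hC k hk) x

lemma toepKernel_sub {k : ℕ} {f g : ℂ → ℂ} {x : ℂ × ℂ}
    (hf : Integrable (fun u => repKernel k (x.1, u) * f u * repKernel k (u, x.2)) lam)
    (hg : Integrable (fun u => repKernel k (x.1, u) * g u * repKernel k (u, x.2)) lam) :
    toepKernel k (fun u => f u - g u) x = toepKernel k f x - toepKernel k g x := by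
  simp only [toepKernel]
  rw [← integral_sub hf hg]
  simp only [mul_sub, sub_mul]

lemma toepKernel_const_mul (k : ℕ) (c : ℂ) (f : ℂ → ℂ) (x : ℂ × ℂ) :
    toepKernel k (fun u => c * f u) x = c * toepKernel k f x := by
  simp only [toepKernel]
  rw [← integral_const_mul]
  refine integral_congr_ae (.of_forall fun u => ?_)
  simp only
  ring

lemma toepKernel_sum {k : ℕ} {x : ℂ × ℂ} {ι : Type*} (s : Finset ι) {f : ι → ℂ → ℂ}
    (hf : ∀ i ∈ s, Integrable (fun u => repKernel k (x.1, u) * f i u * repKernel k (u, x.2)) lam) :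
    toepKernel k (fun u => ∑ i ∈ s, f i u) x = ∑ i ∈ s, toepKernel k (f i) x := by
  simp only [toepKernel]
  rw [← integral_finsetSum s hf]
  simp only [Finset.mul_sum, Finset.sum_mul]

lemma norm_toepKernel_le (m : ℕ) : ∃ A : ℝ, 0 ≤ A ∧ ∀ k : ℕ, 1 ≤ k → ∀ (f : ℂ → ℂ) (C : ℝ),
    (∀ u, ‖f u‖ ≤ C * (1 + ‖u‖) ^ m) → ∀ x : ℂ × ℂ,
      ‖toepKernel k f x‖ ≤ A * C * (k : ℝ) ^ 3 * (1 + ‖x‖) ^ m := by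
  obtain ⟨A, hA, h⟩ := norm_interKernel_le m 0
  refine ⟨A, hA, fun k hk f C hf x => ?_⟩
  have hC : 0 ≤ C := by simpa using (norm_nonneg _).trans (hf 0)
  have h1 := h k hk f (fun _ => 1) C 1 hf (by simp) 0 (by simp) x
  rw [interKernel_zero hk] at h1
  simp only [mul_one, add_zero] at h1
  refine h1.trans (mul_le_of_le_one_right (by positivity) (Real.exp_le_one_iff.2 ?_))
  have : 0 ≤ (k : ℝ) * ‖x.1 - x.2‖ ^ 2 := by positivity
  linarith

end ToepKernel

section Composition

variable {j j' : ℤ} {a b c σ τ : ℕ → ℂ → ℂ}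

lemma SymFam.isGaussKernel {e : ℕ} (ha : SymFam j e a) :
    IsGaussKernel (fun k x => repKernel k x * a k x.2) := by
  obtain ⟨C, hC0, hC⟩ := ha.norm_le
  refine isGaussKernel_repKernel_mul (C := C) (m := j.toNat) (fun k hk => (ha.1 k hk).continuous)
    fun k hk z => (hC k hk z).trans ?_
  have hk1 : (1 : ℝ) ≤ k := by exact_mod_cast hk
  gcongr
  exact mul_le_of_le_one_right hC0 (inv_le_one_of_one_le₀ (one_le_pow₀ hk1))

/-- The kernels of `Op(a) Op(b)` and of `Op(c)`, projected on the right, agree locally up to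
`O(k^{-N})` for every `N` when `c` expands as the star product of `a` and `b`. -/
lemma isLocNegl_kcomp_sub (ha : HasExpansion j a σ) (hb : HasExpansion j' b τ)
    (hc : HasExpansion (j + j') c (symbolProduct σ τ)) :
    IsLocNegl (fun k x =>
      Bargmann.kcomp (fun k x => repKernel k x * a k x.2)
        (Bargmann.kcomp (fun k x => repKernel k x * b k x.2) repKernel) k x +
      -Bargmann.kcomp (fun k x => repKernel k x * c k x.2) repKernel k x) := fun N ρ => by
  -- Three extra orders compensate for the factor `k ^ 3` in the bounds of the kernels.
  set M := N + 3
  obtain ⟨Ca, -, hCa⟩ := (ha.symFam.iterate_dz M).norm_le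
  obtain ⟨Cb, -, hCb⟩ := (hb.symFam.iterate_dzbar M).norm_le
  obtain ⟨Cd, hCd0, hCd⟩ := (ha.symFam_starProduct_sub hb hc M).norm_le
  obtain ⟨A₁, hA₁, h₁⟩ := norm_interKernel_le j.toNat j'.toNat
  obtain ⟨A₂, hA₂, h₂⟩ := norm_toepKernel_le (j + j').toNat
  refine ⟨2 ^ M * (A₁ * Ca * Cb * (1 + ρ) ^ (j.toNat + j'.toNat)) +
    A₂ * Cd * (1 + ρ) ^ (j + j').toNat, fun k hk x hx => ?_⟩
  have hk0 : (0 : ℝ) < k := by exact_mod_cast hk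
  have hρ : 0 ≤ ρ := (norm_nonneg x).trans hx
  have hfa : ∀ u, ‖dz^[M] (a k) u‖ ≤ Ca * (1 + ‖u‖) ^ j.toNat := fun u => by
    simpa using hCa k hk u
  have hgb : ∀ u, ‖dzbar^[M] (b k) u‖ ≤ Cb * (1 + ‖u‖) ^ j'.toNat := fun u => by
    simpa using hCb k hk u
  have hCa0 : 0 ≤ Ca := by simpa using (norm_nonneg _).trans (hfa 0)
  have hCb0 : 0 ≤ Cb := by simpa using (norm_nonneg _).trans (hgb 0)
  have hB : ∀ r ∈ Set.Icc (0 : ℝ) 1, ‖interKernel k (dz^[M] (a k)) (dzbar^[M] (b k)) r x‖ ≤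
      A₁ * Ca * Cb * (k : ℝ) ^ 3 * (1 + ρ) ^ (j.toNat + j'.toNat) := fun r hr => by
    refine (h₁ k hk _ _ Ca Cb hfa hgb r hr x).trans ?_
    have : 0 ≤ (k : ℝ) * ‖x.1 - x.2‖ ^ 2 := by positivity
    calc _ ≤ A₁ * Ca * Cb * (k : ℝ) ^ 3 * (1 + ‖x‖) ^ (j.toNat + j'.toNat) :=
          mul_le_of_le_one_right (by positivity) (Real.exp_le_one_iff.2 (by linarith))
      _ ≤ _ := by gcongr
  have h3 := interKernel_expansion hk x M (ha.symFam.temperate hk) (hb.symFam.temperate hk) hB 1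
    (by simp)
  have h4 := h₂ k hk _ _ (hCd k hk) x
  have hsum : ∑ n ∈ Finset.range M, (-1 : ℂ) ^ n / (n.factorial : ℂ) *
      (((1 : ℝ) : ℂ) ^ 2 / k) ^ n * interKernel k (dz^[n] (a k)) (dzbar^[n] (b k)) 0 x -
      toepKernel k (c k) x = toepKernel k (fun z => (∑ n ∈ Finset.range M,
        (-1 : ℂ) ^ n / (n.factorial : ℂ) *
          (((k : ℂ) ^ n)⁻¹ * (dz^[n] (a k) z * dzbar^[n] (b k) z))) - c k z) x := by
    have h5 : ∀ n, SymFam (j + j') (n + 0) (fun k z => (-1 : ℂ) ^ n / (n.factorial : ℂ) *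
        (((k : ℂ) ^ n)⁻¹ * (dz^[n] (a k) z * dzbar^[n] (b k) z))) := fun n =>
      (((ha.symFam.iterate_dz n).mul (hb.symFam.iterate_dzbar n)).inv_pow_mul n).const_mul' _
    rw [toepKernel_sub (integrable_toepKernel_symFam (SymFam.sum (Finset.range M)
        fun n _ => (h5 n).mono (Nat.zero_le _)) hk x) (integrable_toepKernel_symFam hc.symFam hk x),
      toepKernel_sum _ fun n _ => integrable_toepKernel_symFam (h5 n) hk x]
    congr 1
    refine Finset.sum_congr rfl fun n _ => ?_
    rw [toepKernel_const_mul, toepKernel_const_mul, interKernel_zero hk]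
    simp only [Complex.ofReal_one, one_pow, div_pow]
    ring
  have h6 : Bargmann.kcomp (fun k x => repKernel k x * a k x.2)
      (Bargmann.kcomp (fun k x => repKernel k x * b k x.2) repKernel) k x =
      interKernel k (a k) (b k) 1 x :=
    (interKernel_one hk (ha.symFam.temperate hk) (hb.symFam.temperate hk) x).symm
  have h7 : Bargmann.kcomp (fun k x => repKernel k x * c k x.2) repKernel k x =
      toepKernel k (c k) x := rfl
  beta_reduce
  rw [h6, h7, ← sub_eq_add_neg, ← sub_add_sub_cancel _ (∑ n ∈ Finset.range M,
    (-1 : ℂ) ^ n / (n.factorial : ℂ) * (((1 : ℝ) : ℂ) ^ 2 / k) ^ n *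
      interKernel k (dz^[n] (a k)) (dzbar^[n] (b k)) 0 x), hsum, add_mul]
  refine (norm_add_le _ _).trans (add_le_add (h3.trans (le_of_eq ?_)) (h4.trans ?_))
  · rw [div_pow, show (k : ℝ) ^ M = k ^ N * k ^ 3 from pow_add _ _ _]
    field_simp
  · calc A₂ * (Cd * ((k : ℝ) ^ M)⁻¹) * (k : ℝ) ^ 3 * (1 + ‖x‖) ^ (j + j').toNat ≤
        A₂ * (Cd * ((k : ℝ) ^ M)⁻¹) * (k : ℝ) ^ 3 * (1 + ρ) ^ (j + j').toNat := by gcongr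
      _ = _ := by
        rw [show (k : ℝ) ^ M = k ^ N * k ^ 3 from pow_add _ _ _]
        field_simp

/-- Besides `Op(a) Op(b) - Op(c)`, the difference `A_k B_k - Op(c)` consists of products with at
least one residual factor, whose kernels are locally negligible by the ideal property. -/
theorem IsToeplitz.comp {A B : (k : ℕ) → schwartzSpace k →ₗ[ℂ] schwartzSpace k}
    (hA : IsToeplitz j A σ) (hB : IsToeplitz j' B τ) :
    IsToeplitz (j + j') (fun k => A k ∘ₗ B k) (symbolProduct σ τ) := by
  obtain ⟨a, Ta, Sa, ha, hTa, hSa, hAa⟩ := hA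
  obtain ⟨b, Tb, Sb, hb, hTb, hSb, hBb⟩ := hB
  have ha' := ha.hasExpansion
  have hb' := hb.hasExpansion
  obtain ⟨c, hc⟩ := exists_hasExpansion (symFam_symbolProduct ha' hb')
  have hT : ∀ k : ℕ, ∃ T : schwartzSpace k →ₗ[ℂ] schwartzSpace k, 1 ≤ k → IsOp k (c k) T := by
    intro k
    by_cases hk : 1 ≤ k
    · obtain ⟨C, -, hC⟩ := hc.symFam.norm_le
      obtain ⟨T, h⟩ := exists_isOp hk (hc.symFam.1 k hk).continuous (hC k hk)
      exact ⟨T, fun _ => h⟩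
    · exact ⟨0, fun h => absurd h hk⟩
  choose Tc hTc using hT
  obtain ⟨Ka, hKa, hNa, hHa⟩ := hSa.exists_kernel
  obtain ⟨Kb, hKb, hNb, hHb⟩ := hSb.exists_kernel
  have hGa := ha'.symFam.isGaussKernel
  have hGb := hb'.symFam.isGaussKernel
  have hGc := hc.symFam.isGaussKernel
  have hP := isGaussKernel_repKernel
  have hD := ((hGa.kcomp (hGb.kcomp hP)).add (hGc.kcomp hP).neg).add
    (((hGa.kcomp hKb).add (hKa.kcomp hGb)).add (hKa.kcomp hKb))
  have hN := (isLocNegl_kcomp_sub ha' hb' hc).add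
    (((IsLocNegl.kcomp_right hGa hKb hNb).add (IsLocNegl.kcomp_left hKa hNa hGb)).add
      (IsLocNegl.kcomp_left hKa hNa hKb))
  refine ⟨c, Tc, fun k => A k ∘ₗ B k - Tc k, hc.isSymbol, hTc,
    isResidual_of_kernel hD hN fun k hk => ?_, fun k _ => by beta_reduce; abel⟩
  have hka := (hTa k hk).hasKernel hk
  have hkb := (hTb k hk).hasKernel hk
  have hkc := (hTc k hk).hasKernel hk
  have hid := hasKernel_id hk
  have h := ((HasKernel.comp hGa (hGb.kcomp hP) hk hka (HasKernel.comp hGb hP hk hkb hid)).add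
    (HasKernel.comp hGc hP hk hkc hid).neg).add
    (((HasKernel.comp hGa hKb hk hka (hHb k hk)).add
      (HasKernel.comp hKa hGb hk (hHa k hk) hkb)).add
      (HasKernel.comp hKa hKb hk (hHa k hk) (hHb k hk)))
  convert h using 1
  simp only [LinearMap.comp_id]
  rw [hAa k hk, hBb k hk, LinearMap.add_comp, LinearMap.comp_add, LinearMap.comp_add]
  abel

end Composition

/-! ### Uniqueness of the contravariant symbol -/

/-- On the diagonal the kernel of `Π_k h Π_k` is a Gaussian average of `h` (the Berezin
transform), here written after rescaling to width one. -/
lemma toepKernel_diag {k : ℕ} (hk : 1 ≤ k) (h : ℂ → ℂ) (z : ℂ) :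
    (k : ℂ)⁻¹ * toepKernel k h (z, z) = (1 / (2 * Real.pi) : ℂ) ^ 2 *
      ∫ s, (Real.exp (-1 * ‖s‖ ^ 2) : ℂ) * h (z + ((Real.sqrt k)⁻¹ : ℝ) • s) ∂lam := by
  have hk0 : (0 : ℝ) < k := by exact_mod_cast hk
  have hs : 0 < Real.sqrt k := Real.sqrt_pos.2 hk0
  have h1 : toepKernel k h (z, z) = (k / (2 * Real.pi) : ℂ) ^ 2 *
      ∫ v, (Real.exp (-k * ‖v‖ ^ 2) : ℂ) * h (z + v) ∂lam := by
    rw [toepKernel, ← integral_add_right_eq_self _ z, ← integral_const_mul]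
    refine integral_congr_ae (.of_forall fun v => ?_)
    simp only
    have h2 : repKernel k (z, v + z) * repKernel k (v + z, z) =
        (k / (2 * Real.pi) : ℂ) ^ 2 * (Real.exp (-k * ‖v‖ ^ 2) : ℂ) := by
      rw [← conj_repKernel k z (v + z), Complex.mul_conj', norm_repKernel,
        show z - (v + z) = -v by ring, norm_neg]
      push_cast
      rw [mul_pow, ← Complex.exp_nat_mul]
      congr 2
      push_cast
      ring
    rw [add_comm z v]
    linear_combination h (v + z) * h2
  have h3 : ∫ s, (Real.exp (-1 * ‖s‖ ^ 2) : ℂ) * h (z + ((Real.sqrt k)⁻¹ : ℝ) • s) ∂lam =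
      k * ∫ v, (Real.exp (-k * ‖v‖ ^ 2) : ℂ) * h (z + v) ∂lam := by
    have h4 := Measure.integral_comp_smul lam
      (fun v => (Real.exp (-k * ‖v‖ ^ 2) : ℂ) * h (z + v)) (Real.sqrt k)⁻¹
    rw [Complex.finrank_real_complex, inv_pow, Real.sq_sqrt hk0.le, inv_inv, abs_of_pos hk0,
      Complex.real_smul] at h4
    rw [← Complex.ofReal_natCast k, ← h4]
    refine integral_congr_ae (.of_forall fun s => ?_)
    simp only
    rw [norm_smul, mul_pow, Real.norm_of_nonneg (by positivity), inv_pow, Real.sq_sqrt hk0.le]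
    rw [show -(k : ℝ) * ((k : ℝ)⁻¹ * ‖s‖ ^ 2) = -1 * ‖s‖ ^ 2 by field_simp]
  have hk1 : (k : ℂ) ≠ 0 := by exact_mod_cast hk0.ne'
  rw [h3, h1]
  field_simp

open Filter Topology in
/-- The Berezin transform recovers the symbol in the semiclassical limit. -/
lemma tendsto_toepKernel_diag {h : ℂ → ℂ} (hc : Continuous h) {C : ℝ} {m : ℕ}
    (hb : ∀ z, ‖h z‖ ≤ C * (1 + ‖z‖) ^ m) (z : ℂ) :
    Tendsto (fun k : ℕ => (k : ℂ)⁻¹ * toepKernel k h (z, z)) atTop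
      (𝓝 (h z / (2 * Real.pi))) := by
  have hC : 0 ≤ C := by simpa using (norm_nonneg _).trans (hb 0)
  have h1 : Tendsto (fun k : ℕ => ∫ s, (Real.exp (-1 * ‖s‖ ^ 2) : ℂ) *
      h (z + ((Real.sqrt k)⁻¹ : ℝ) • s) ∂lam) atTop
      (𝓝 (∫ s, (Real.exp (-1 * ‖s‖ ^ 2) : ℂ) * h z ∂lam)) := by
    refine tendsto_integral_filter_of_dominated_convergence
      (fun s => C * (1 + ‖z‖) ^ m * gaussWeight m 1 s) (.of_forall fun k => ?_) ?_
      ((integrable_gaussWeight lam m one_pos).const_mul _) (.of_forall fun s => ?_)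
    · exact Continuous.aestronglyMeasurable (by fun_prop)
    · filter_upwards [eventually_ge_atTop 1] with k hk
      refine .of_forall fun s => ?_
      have hk1 : (1 : ℝ) ≤ Real.sqrt k := Real.one_le_sqrt.2 (by exact_mod_cast hk)
      have h2 : ‖z + ((Real.sqrt k)⁻¹ : ℝ) • s‖ ≤ ‖z‖ + ‖s‖ := by
        refine (norm_add_le _ _).trans (add_le_add_right ?_ _)
        rw [norm_smul, Real.norm_of_nonneg (by positivity)]
        exact mul_le_of_le_one_left (norm_nonneg s) (inv_le_one_of_one_le₀ hk1)
      rw [norm_mul, Complex.norm_real, Real.norm_of_nonneg (Real.exp_nonneg _), gaussWeight]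
      calc _ ≤ Real.exp (-1 * ‖s‖ ^ 2) * (C * ((1 + ‖z‖) * (1 + ‖s‖)) ^ m) := by
            gcongr
            refine (hb _).trans ?_
            gcongr
            nlinarith [norm_nonneg z, norm_nonneg s]
        _ = _ := by rw [mul_pow]; ring
    · have h3 : Tendsto (fun k : ℕ => (Real.sqrt k)⁻¹) atTop (𝓝 0) :=
        (Real.tendsto_sqrt_atTop.comp tendsto_natCast_atTop_atTop).inv_tendsto_atTop
      have h4 : Tendsto (fun k : ℕ => z + ((Real.sqrt k)⁻¹ : ℝ) • s) atTop (𝓝 z) := by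
        simpa using tendsto_const_nhds.add (h3.smul_const s)
      exact ((hc.tendsto z).comp h4).const_mul _
  have h5 : (1 / (2 * Real.pi) : ℂ) ^ 2 * ∫ s, (Real.exp (-1 * ‖s‖ ^ 2) : ℂ) * h z ∂lam =
      h z / (2 * Real.pi) := by
    rw [integral_mul_const, integral_complex_ofReal, integral_exp_neg_mul_sq_lam one_pos]
    have hpi : (Real.pi : ℂ) ≠ 0 := by exact_mod_cast Real.pi_pos.ne'
    push_cast
    field_simp
  rw [← h5]
  refine (h1.const_mul _).congr' ?_
  filter_upwards [eventually_ge_atTop 1] with k hk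
  exact (toepKernel_diag hk h z).symm

lemma IsOp.apply_repKernel {k : ℕ} (hk : 1 ≤ k) {a : ℂ → ℂ}
    {T : schwartzSpace k →ₗ[ℂ] schwartzSpace k} (hT : IsOp k a T) (z : ℂ) :
    (T ⟨_, repKernel_mem hk z⟩).1 z = toepKernel k a (z, z) := (hT.hasKernel hk _ z).2

/-- The diagonal matrix elements of a residual sequence between coherent states are
negligible. -/
lemma IsResidual.norm_apply_repKernel_le {S : (k : ℕ) → schwartzSpace k →ₗ[ℂ] schwartzSpace k}
    (hS : IsResidual S) (N : ℕ) (z : ℂ) : ∃ C : ℝ, ∀ (k : ℕ) (hk : 1 ≤ k),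
      ‖(S k ⟨_, repKernel_mem hk z⟩).1 z‖ ≤ C * ((k : ℝ) ^ N)⁻¹ := by
  obtain ⟨K, hK, hN, hH⟩ := hS.exists_kernel
  obtain ⟨C, hC⟩ := IsLocNegl.kcomp_left hK hN isGaussKernel_repKernel N ‖(z, z)‖
  refine ⟨C, fun k hk => ?_⟩
  rw [(hH k hk _ z).2]
  exact hC k hk (z, z) le_rfl

open Filter Topology in
/-- The contravariant symbol of a Toeplitz sequence is unique, whatever the orders. -/
theorem IsToeplitz.symbol_unique {i j : ℤ} {A : (k : ℕ) → schwartzSpace k →ₗ[ℂ] schwartzSpace k}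
    {σ ρ : ℕ → ℂ → ℂ} (hσ : IsToeplitz j A σ) (hρ : IsToeplitz i A ρ) : σ = ρ := by
  obtain ⟨a, T, S, ha, hT, hS, hA⟩ := hσ
  obtain ⟨a', T', S', ha', hT', hS', hA'⟩ := hρ
  have ha := ha.hasExpansion
  have ha' := ha'.hasExpansion
  funext L
  induction L using Nat.strong_induction_on with
  | _ L ih =>
  funext z
  -- The expansions of `a` and `a'` are truncated so late that the cubic loss in the bound of
  -- `norm_toepKernel_le` is harmless.
  set M := L + 3 with hM
  set q : ℕ → (ℂ → ℂ) → ℂ := fun k h => (k : ℂ)⁻¹ * toepKernel k h (z, z) with hq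
  have hlim : ∀ {j : ℤ} {h : ℂ → ℂ}, SymFam j 0 (fun _ => h) →
      Tendsto (fun k => q k h) atTop (𝓝 (h z / (2 * Real.pi))) := fun hh => by
    obtain ⟨C, -, hC⟩ := hh.norm_le
    exact tendsto_toepKernel_diag (hh.1 1 le_rfl).continuous
      (fun u => by simpa using hC 1 le_rfl u) z
  -- After multiplication by `k ^ L`, the expansion of a symbol loses its terms above the `L`-th.
  have hmain : ∀ {j : ℤ} {a σ : ℕ → ℂ → ℂ}, HasExpansion j a σ →
      Tendsto (fun k : ℕ => (k : ℂ) ^ L * (q k (a k) -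
        ∑ l ∈ Finset.range L, ((k : ℂ) ^ l)⁻¹ * q k (σ l))) atTop
        (𝓝 (σ L z / (2 * Real.pi))) := by
    intro j a σ ha
    obtain ⟨A, hA0, hA⟩ := norm_toepKernel_le j.toNat
    obtain ⟨C, hC0, hC⟩ := (ha.sub M).norm_le
    have hinv : Tendsto (fun k : ℕ => (k : ℝ)⁻¹) atTop (𝓝 0) := tendsto_inv_atTop_nhds_zero_nat
    have hinvC : Tendsto (fun k : ℕ => (k : ℂ)⁻¹) atTop (𝓝 0) := tendsto_inv_atTop_nhds_zero_nat
    have hsub : ∀ k, 1 ≤ k → q k (fun u => a k u - ∑ l ∈ Finset.range M, ((k : ℂ) ^ l)⁻¹ * σ l u) =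
        q k (a k) - ∑ l ∈ Finset.range M, ((k : ℂ) ^ l)⁻¹ * q k (σ l) := by
      intro k hk
      have h1 : ∀ l, SymFam j (l + 0) (fun k u => ((k : ℂ) ^ l)⁻¹ * σ l u) := fun l =>
        (ha.coeff l).inv_pow_mul l
      simp only [hq]
      rw [toepKernel_sub (integrable_toepKernel_symFam ha.symFam hk _)
        (integrable_toepKernel_symFam (SymFam.sum (Finset.range M)
          fun l _ => (h1 l).mono (Nat.zero_le _)) hk _),
        toepKernel_sum _ fun l _ => integrable_toepKernel_symFam (h1 l) hk _, mul_sub,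
        Finset.mul_sum]
      simp only [toepKernel_const_mul]
      congr 1
      exact Finset.sum_congr rfl fun l _ => by ring
    have hrem : Tendsto (fun k : ℕ => (k : ℂ) ^ L * (q k (a k) -
        ∑ l ∈ Finset.range M, ((k : ℂ) ^ l)⁻¹ * q k (σ l))) atTop (𝓝 0) := by
      refine squeeze_zero_norm' (a := fun k : ℕ => A * C * (1 + ‖(z, z)‖) ^ j.toNat * (k : ℝ)⁻¹)
        ?_ (by simpa using hinv.const_mul (A * C * (1 + ‖(z, z)‖) ^ j.toNat))
      filter_upwards [eventually_ge_atTop 1] with k hk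
      have hk0 : (0 : ℝ) < k := by exact_mod_cast hk
      rw [← hsub k hk, hq, norm_mul, norm_mul, norm_pow, norm_inv, Complex.norm_natCast]
      calc _ ≤ (k : ℝ) ^ L * ((k : ℝ)⁻¹ * (A * (C * ((k : ℝ) ^ M)⁻¹) * (k : ℝ) ^ 3 *
            (1 + ‖(z, z)‖) ^ j.toNat)) := by
            gcongr
            exact hA k hk _ _ (hC k hk) _
        _ = _ := by
          rw [hM, pow_add]
          field_simp
    have hterm : ∀ l, Tendsto (fun k : ℕ => (k : ℂ)⁻¹ ^ (l + 1) * q k (σ (L + 1 + l))) atTop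
        (𝓝 0) := fun l => by
      simpa using (hinvC.pow (l + 1)).mul (hlim (ha.coeff (L + 1 + l)))
    have htot := (hrem.add (hlim (ha.coeff L))).add
      (tendsto_finsetSum (Finset.range 2) fun l _ => hterm l)
    simp only [zero_add, Finset.sum_const_zero, add_zero] at htot
    refine htot.congr' ?_
    filter_upwards [eventually_ge_atTop 1] with k hk
    have hk0 : (k : ℂ) ≠ 0 := by exact_mod_cast (by omega : k ≠ 0)
    rw [hM]
    simp only [Finset.sum_range_succ, Finset.sum_range_zero, add_zero, zero_add, pow_succ,
      pow_zero, one_mul]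
    field_simp
    ring
  -- The operators coincide, so that the Berezin transforms of `a` and `a'` differ by `O(k^{-∞})`.
  have hdiff : Tendsto (fun k : ℕ => (k : ℂ) ^ L * (q k (a k) - q k (a' k))) atTop (𝓝 0) := by
    obtain ⟨C, hC⟩ := hS.norm_apply_repKernel_le L z
    obtain ⟨C', hC'⟩ := hS'.norm_apply_repKernel_le L z
    have hinv : Tendsto (fun k : ℕ => (k : ℝ)⁻¹) atTop (𝓝 0) := tendsto_inv_atTop_nhds_zero_nat
    refine squeeze_zero_norm' (a := fun k : ℕ => (C + C') * (k : ℝ)⁻¹) ?_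
      (by simpa using hinv.const_mul (C + C'))
    filter_upwards [eventually_ge_atTop 1] with k hk
    have hk0 : (0 : ℝ) < k := by exact_mod_cast hk
    have h1 : toepKernel k (a k) (z, z) - toepKernel k (a' k) (z, z) =
        (S' k ⟨_, repKernel_mem hk z⟩).1 z - (S k ⟨_, repKernel_mem hk z⟩).1 z := by
      rw [← (hT k hk).apply_repKernel hk z, ← (hT' k hk).apply_repKernel hk z]
      have h2 : T k + S k = T' k + S' k := (hA k hk).symm.trans (hA' k hk)
      have h3 := congrArg (fun f => (f ⟨_, repKernel_mem hk z⟩).1 z) h2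
      simp only [LinearMap.add_apply, Submodule.coe_add, Pi.add_apply] at h3
      linear_combination h3
    simp only [hq]
    rw [← mul_sub, h1, norm_mul, norm_mul, norm_pow, norm_inv, Complex.norm_natCast]
    calc _ ≤ (k : ℝ) ^ L * ((k : ℝ)⁻¹ * (C' * ((k : ℝ) ^ L)⁻¹ + C * ((k : ℝ) ^ L)⁻¹)) := by
          gcongr
          exact (norm_sub_le _ _).trans (add_le_add (hC' k hk) (hC k hk))
      _ = _ := by field_simp; ring
  have h := tendsto_nhds_unique hdiff (((hmain ha).sub (hmain ha')).congr fun k => by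
    rw [Finset.sum_congr rfl fun l hl => by rw [ih l (Finset.mem_range.1 hl)]]
    ring)
  have hpi : (Real.pi : ℂ) ≠ 0 := by exact_mod_cast Real.pi_pos.ne'
  field_simp at h
  linear_combination -h

end Bargmann

end

theorem mainTheorem5 (j j' : ℤ)
    (A B : (k : ℕ) → Bargmann.schwartzSpace k →ₗ[ℂ] Bargmann.schwartzSpace k)
    (σ τ : ℕ → ℂ → ℂ)
    (hA : Bargmann.IsToeplitz j A σ) (hB : Bargmann.IsToeplitz j' B τ) :
    Bargmann.IsToeplitz (j + j') (fun k => A k ∘ₗ B k) (Bargmann.symbolProduct σ τ) ∧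
      ∀ (i : ℤ) (ρ : ℕ → ℂ → ℂ), Bargmann.IsToeplitz i (fun k => A k ∘ₗ B k) ρ →
        ρ = Bargmann.symbolProduct σ τ := by
  exact ⟨hA.comp hB, fun i ρ h => h.symbol_unique (hA.comp hB)⟩
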